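/- Conventions. For a group $G$ and a subset $S$ whose Cayley graph (edges between distinct $g,h$ with $g^{-1}h\in S\cup S^{-1}$) is connected, let $d$ be the graph distance, let $B(m)=\{g : d(e,g)\le m\}$, let $B(n-1)^{c,\infty}$ be the union of the infinite connected components of $G\setminus B(n-1)$ (the unique infinite component when $G$ is one-ended), and let $S(n,r)^\infty=B(n+r)\cap B(n-1)^{c,\infty}$, viewed as an induced subgraph of the Cayley graph. The connection thickness $\mathrm{th}_{G,S}(n)\in\mathbb Z_{\ge 0}\cup\{\infty\}$ is the least $r\ge 0$ such that $S(n,r)^\infty$ is connected ($\infty$ if there is none). The lamplighter group $\Gamma\wr L$ consists of the pairs $(\gamma,f)$ with $\gamma\in\Gamma$ and $f:\Gamma\to L$ finitely supported, with product $(\gamma,f)(\gamma',f')=(\gamma\gamma',\,x\mapsto f(x)f'(\gamma^{-1}x))$. We identify $\gamma\in\Gamma$ with $(\gamma,1)$ and $s\in L$ with $(e,\delta_s)$, where $\delta_s$ equals $s$ at $e$ and the identity elsewhere. The "switch-walk-switch" set of $S_\Gamma\subset\Gamma$ is the product set $LS_\Gamma L$. Theorem. Let $L$ be a non-trivial finite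 group. (1) Consider $\mathbb Z\wr L$ with the switch-walk-switch generating set $LS_{\mathbb Z}L$, where $S_{\mathbb Z}=\{\pm1\}$ or $S_{\mathbb Z}=\{0,\pm1\}$. Then $\mathrm{th}(n)=n+2$ for all $n\ge 2$. Moreover $S(n,r)^\infty$ has at least $2|L|^{n-r}$ connected components whenever $1\le r+1\le n$ (and $n\ge 2$, in the case $S_{\mathbb Z}=\{0,\pm1\}$). (2) Let $d\ge 3$ and let $T_d$ be a group with a subset $S_T$ such that the Cayley graph of $(T_d,S_T)$ is the $d$-regular tree. For $T_d\wr L$ with the generating set $LS_TL$, there are constants $c>0$ and $K>1$ such that for all $n\ge 1$ the thickness $\mathrm{th}(n)$ is finite and $$|\mathrm{th}(n)-\log_{d-1}(n)|\le c,$$ and for every integer $r$ with $0\le r\le \log_{d-1}(n)-c$ the number of connected components of $S(n,r)^\infty$ is at least $K^n$. -/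

import Mathlib

open scoped Pointwise

noncomputable section

/-- The elements of the (unrestricted) regular wreath product whose lamp function has finite
support. An element `g` has lamp function `g.left : Γ → L` and position `g.right : Γ`; the product
is `(γ, f) (γ', f') = (γ γ', x ↦ f x * f' (γ⁻¹ x))`. -/
def finiteLamps (Γ L : Type*) [Group Γ] [Group L] : Subgroup (L ≀ᵣ Γ) where
  carrier := {g | (Function.mulSupport g.left).Finite}
  one_mem' := by simp
  mul_mem' := by
    intro a b ha hb
    have hb' : (Function.mulSupport fun x ↦ b.left (a.right⁻¹ * x)).Finite := by
      refine (hb.image (fun x ↦ a.right * x)).subset ?_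
      intro x hx
      exact ⟨a.right⁻¹ * x, hx, by simp⟩
    exact (ha.union hb').subset (Function.mulSupport_mul _ _)
  inv_mem' := by
    intro a ha
    refine (ha.image (fun x ↦ a.right⁻¹ * x)).subset ?_
    intro x hx
    refine ⟨a.right * x, ?_, by simp⟩
    simpa [Function.mem_mulSupport] using hx

/-- The lamplighter group `Γ ≀ L` (restricted wreath product) with base group `Γ` and
lamp group `L`. -/
abbrev Lamplighter (Γ L : Type*) [Group Γ] [Group L] : Type _ := finiteLamps Γ L

namespace Lamplighter

variable {Γ L : Type*} [Group Γ] [Group L]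

/-- The element `(γ, 1)`: right multiplication by it moves the lamplighter by `γ`. -/
def walk (γ : Γ) : Lamplighter Γ L :=
  ⟨⟨1, γ⟩, by change (Function.mulSupport (1 : Γ → L)).Finite; simp⟩

open scoped Classical in
/-- The element `(1, δ_s)`: right multiplication by it multiplies the lamp at the current position
of the lamplighter by `s`. -/
def switch (s : L) : Lamplighter Γ L :=
  ⟨⟨Pi.mulSingle 1 s, 1⟩, (Set.finite_singleton 1).subset Pi.mulSupport_mulSingle_subset⟩

/-- The "switch-walk-switch" set `L S L`, for a subset `S` of the base group. -/
def switchWalkSwitch (L : Type*) [Group L] (S : Set Γ) : Set (Lamplighter Γ L) :=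
  Set.range switch * walk '' S * Set.range switch

end Lamplighter

namespace CayleySphere

variable {G : Type*} [Group G] (S : Set G)

/-- The complement of the ball of radius `n - 1` around the identity in the Cayley graph of
`(G, S)` (everything when `n = 0`). -/
def ballCompl (n : ℕ) : Set G :=
  {g | n ≤ (SimpleGraph.mulCayley S).dist 1 g}

/-- The union of the infinite connected components of the complement of the ball of radius
`n - 1`. For a one-ended group this is the unique infinite component. -/
def ballComplInf (n : ℕ) : Set G :=
  {g | ∃ hg : g ∈ ballCompl S n,
    (((SimpleGraph.mulCayley S).induce (ballCompl S n)).connectedComponentMk ⟨g, hg⟩).supp.Infinite}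

/-- The set `S(n,r)^∞` of the elements of the annulus of radius `n` and thickness `r` that are
connected to infinity outside the ball of radius `n - 1`. -/
def annulusInf (n r : ℕ) : Set G :=
  {g | (SimpleGraph.mulCayley S).dist 1 g ≤ n + r} ∩ ballComplInf S n

/-- `S(n,r)^∞` as a graph: the subgraph of the Cayley graph induced on it. -/
def annulusGraph (n r : ℕ) : SimpleGraph (annulusInf S n r) :=
  (SimpleGraph.mulCayley S).induce (annulusInf S n r)

/-- The connection thickness: the least `r` such that `S(n,r)^∞` is connected, `⊤` if there
is none. -/
def thickness (n : ℕ) : ℕ∞ :=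
  sInf {t | ∃ r : ℕ, t = r ∧ (annulusGraph S n r).Connected}

/-- The number of connected components of `S(n,r)^∞`. -/
def numComponents (n r : ℕ) : ℕ :=
  Nat.card (annulusGraph S n r).ConnectedComponent

end CayleySphere

/-- The Cayley graph of `(T, S)` is the `d`-regular tree. -/
def IsRegularTreeCayley {T : Type*} [Group T] (S : Set T) (d : ℕ) : Prop :=
  (SimpleGraph.mulCayley S).IsTree ∧ ∀ v, ((SimpleGraph.mulCayley S).neighborSet v).encard = d

end

/-!
The argument takes place over a rooted tree `t : CayleyTree S q`, where the root has `q + 1` children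
and every other vertex has `q`. A regular Cayley tree is of this kind
(`CayleyTree.ofIsRegularTreeCayley`), and so is the line, with `q = 1` (`CayleyTree.lineTree`).

A shortest word for an element with lamps `f` and position `γ` is a tour of the subtree (the *hull*)
spanned by the root, `γ` and the lit lamps. If the hull has `N ≥ 1` edges, then the word length is
`2 * N - height γ` (`CayleyTree.dist_eq_len`). The theorem is therefore about the ways in which a
lamplighter can change the hull while this number stays between `n` and `n + r`. An element lies in
an infinite component only if some vertex of height at most `2 * N - n + 1` is outside the hull
(`CayleyTree.exists_notMem_hull_of_mem_ballComplInf`): otherwise each walk to the boundary of the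
hull enters the ball of radius `n - 1`.

*Branching trees, upper bound* (`CayleyTree.connected_annulusGraph`). Let `K` be about `log_q n`, so
that a hull with about `n / 2` edges is too small to contain all descendants of a vertex at depth
`K - 1`. In an annulus of thickness `K + 3` the lamplighter can return to the root, removing the deepest
leaf below the position whenever the word would become too long; the walk to this leaf is made
possible by temporary twigs of depth less than `K`, which keep the word long enough
(`CayleyTree.Linked.prune_deepest`). From the root, leaves of the hull can be exchanged for vertices
near the root until the hull is a fixed subtree of height at most `K - 1`, in which all lamps can be
changed.

*Branching trees, lower bound* (`CayleyTree.two_pow_le_numComponents`). Light all lamps at height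
`D` outside one branch at the root, where `D > r`, and put the lamplighter deep in this branch, so
that the word length is `n`. On leaving the branch the hull has fewer than `(n + D) / 2` edges. The
lamplighter can then not reach the height `D` before entering the branch again, as there a hull with
so few edges makes the word shorter than `n`. So the lamps at height at least `D` outside the branch
are invariants of the component, and at least `q ^ D` of them are at height `D + 1`.

*The line.* Here the hull is an interval containing `0`. In the annulus of thickness `n + 2`, every
element can be moved to an interval with `n + 1` edges, and such intervals can be shifted by removing
an edge on one side and adding one on the other (`CayleyTree.connected_annulusGraph_line`). For
thickness at most `n + 1`, a lamplighter with `n` in the hull cannot get beyond `-1`, since the word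
length would become `2 * n + 2` (`CayleyTree.not_connected_annulusGraph_line`). For thickness
`r < n`, a lamplighter with `n` in the hull cannot get below `n - r`, where the word length would
exceed `n + r`, so that the `n - r` lamps at `0, …, n - r - 1` are invariants; the same holds on the other side
(`CayleyTree.two_mul_pow_le_numComponents_line`).
-/

/-! ### Elements and edges of the lamplighter group -/

namespace Lamplighter

variable {Γ L : Type*} [Group Γ] [Group L]

/-- The lamp function of an element of the lamplighter group. -/
def lamps (g : Lamplighter Γ L) : Γ → L := g.1.left

/-- The position of the lamplighter. -/
def pos (g : Lamplighter Γ L) : Γ := g.1.right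

/-- The element of the lamplighter group with lamp function `f` and position `γ`. -/
def state (f : Γ → L) (γ : Γ) (hf : (Function.mulSupport f).Finite) : Lamplighter Γ L :=
  ⟨⟨f, γ⟩, hf⟩

@[simp] lemma lamps_state (f : Γ → L) (γ : Γ) (hf) : lamps (state f γ hf) = f := rfl
@[simp] lemma pos_state (f : Γ → L) (γ : Γ) (hf) : pos (state f γ hf) = γ := rfl
@[simp] lemma lamps_one : lamps (1 : Lamplighter Γ L) = 1 := rfl
@[simp] lemma pos_one : pos (1 : Lamplighter Γ L) = 1 := rfl

lemma finite_lamps (g : Lamplighter Γ L) : (Function.mulSupport (lamps g)).Finite := g.2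

lemma ext_lamps_pos {g g' : Lamplighter Γ L} (h : lamps g = lamps g') (h' : pos g = pos g') :
    g = g' :=
  Subtype.ext (RegularWreathProduct.ext h h')

lemma pos_mul_generator (g : Lamplighter Γ L) (a b : L) (s : Γ) :
    pos (g * (switch a * walk s * switch b)) = pos g * s := by
  simp [pos, switch, walk]

open scoped Classical in
lemma lamps_mul_generator (g : Lamplighter Γ L) (a b : L) (s x : Γ) :
    lamps (g * (switch a * walk s * switch b)) x =
      lamps g x * ((if x = pos g then a else 1) * (if x = pos g * s then b else 1)) := by
  simp only [pos, lamps, switch, walk, Subgroup.coe_mul, RegularWreathProduct.mul_left,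
    RegularWreathProduct.mul_right, Pi.mul_apply, Pi.mulSingle_apply, Pi.one_apply, mul_one,
    one_mul]
  congr 3 <;> rw [inv_mul_eq_iff_eq_mul] <;> simp [inv_mul_eq_iff_eq_mul]

/-- Two elements are adjacent for the switch-walk-switch generators when the positions are adjacent
in the base graph (or equal, if `1` is a walk generator) and the lamps agree away from the two
positions. -/
lemma adj_iff {S : Set Γ} {g g' : Lamplighter Γ L} :
    (SimpleGraph.mulCayley (switchWalkSwitch L S)).Adj g g' ↔
      g ≠ g' ∧ ((SimpleGraph.mulCayley S).Adj (pos g) (pos g') ∨ (pos g = pos g' ∧ 1 ∈ S)) ∧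
        ∀ x, x ≠ pos g → x ≠ pos g' → lamps g x = lamps g' x := by
  classical
  have fwd : ∀ g g' : Lamplighter Γ L, ∀ s ∈ switchWalkSwitch L S, g * s = g' →
      ((SimpleGraph.mulCayley S).Adj (pos g) (pos g') ∨ (pos g = pos g' ∧ 1 ∈ S)) ∧
        ∀ x, x ≠ pos g → x ≠ pos g' → lamps g x = lamps g' x := by
    rintro g _ _ ⟨_, ⟨_, ⟨a, rfl⟩, _, ⟨s, hs, rfl⟩, rfl⟩, _, ⟨b, rfl⟩, rfl⟩ rfl
    dsimp only
    refine ⟨?_, ?_⟩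
    · rw [pos_mul_generator]
      by_cases h : s = 1
      · subst h; right; simpa using hs
      · left
        rw [SimpleGraph.mulCayley_adj']
        exact ⟨by simpa using h, s, hs, Or.inl rfl⟩
    · intro x hx hx'
      rw [lamps_mul_generator, pos_mul_generator] at *
      simp [hx, hx']
  have bwd : ∀ g g' : Lamplighter Γ L, ∀ s ∈ S, pos g * s = pos g' →
      (∀ x, x ≠ pos g → x ≠ pos g' → lamps g x = lamps g' x) →
      ∃ σ ∈ switchWalkSwitch L S, g * σ = g' := by
    intro g g' s hs hp hl
    refine ⟨switch ((lamps g (pos g))⁻¹ * lamps g' (pos g)) * walk s *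
      switch (if pos g = pos g' then 1 else (lamps g (pos g'))⁻¹ * lamps g' (pos g')),
      ⟨_, ⟨_, ⟨_, rfl⟩, _, ⟨s, hs, rfl⟩, rfl⟩, _, ⟨_, rfl⟩, rfl⟩, ?_⟩
    refine ext_lamps_pos ?_ (by rw [pos_mul_generator, hp])
    funext x
    rw [lamps_mul_generator, hp]
    by_cases h1 : x = pos g
    · subst h1
      by_cases h2 : pos g = pos g' <;> simp [h2]
    · by_cases h2 : x = pos g'
      · subst h2
        have : pos g ≠ pos g' := fun h => h1 h.symm
        simp [h1, this]
      · simp [h1, h2, hl x h1 h2]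
  rw [SimpleGraph.mulCayley_adj']
  refine and_congr_right fun hne => ⟨?_, ?_⟩
  · rintro ⟨s, hs, h | h⟩
    · exact fwd g g' s hs h
    · obtain ⟨h1, h2⟩ := fwd g' g s hs h.symm
      refine ⟨h1.imp (fun h => h.symm) (fun h => ⟨h.1.symm, h.2⟩), fun x hx hx' => (h2 x hx' hx).symm⟩
  · rintro ⟨h | ⟨h, h1⟩, hl⟩
    · rw [SimpleGraph.mulCayley_adj'] at h
      obtain ⟨-, s, hs, h | h⟩ := h
      · obtain ⟨σ, hσ, h⟩ := bwd g g' s hs h hl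
        exact ⟨σ, hσ, Or.inl h⟩
      · obtain ⟨σ, hσ, h⟩ := bwd g' g s hs h.symm (fun x hx hx' => (hl x hx' hx).symm)
        exact ⟨σ, hσ, Or.inr h.symm⟩
    · obtain ⟨σ, hσ, h⟩ := bwd g g' 1 h1 (by simpa using h) hl
      exact ⟨σ, hσ, Or.inl h⟩

end Lamplighter

/-! ### Rooted trees -/

/-- A rooted tree structure with root `1` on the Cayley graph of `(Γ, S)`: every vertex other than
the root has `q` children, and the root has `q + 1`. The parent of the root is the root itself. -/
structure CayleyTree {Γ : Type*} [Group Γ] (S : Set Γ) (q : ℕ) where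
  height : Γ → ℕ
  parent : Γ → Γ
  parent_one : parent 1 = 1
  height_eq_zero : ∀ v, height v = 0 ↔ v = 1
  height_parent_add_one : ∀ v, v ≠ 1 → height (parent v) + 1 = height v
  adj_iff : ∀ u v, (SimpleGraph.mulCayley S).Adj u v ↔
    (v ≠ 1 ∧ parent v = u) ∨ (u ≠ 1 ∧ parent u = v)
  ncard_children_one : {u | u ≠ 1 ∧ parent u = 1}.ncard = q + 1
  ncard_children : ∀ v, v ≠ 1 → {u | u ≠ 1 ∧ parent u = v}.ncard = q

namespace CayleyTree

variable {Γ L : Type*} [Group Γ] [Group L] {S : Set Γ} {q : ℕ} (t : CayleyTree S q)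

/-- `u` lies on the geodesic from the root to `v`. -/
def Below (u v : Γ) : Prop := ∃ k, t.parent^[k] v = u

variable {t}

lemma height_one : t.height 1 = 0 := (t.height_eq_zero 1).2 rfl

lemma height_pos {v : Γ} (hv : v ≠ 1) : 0 < t.height v :=
  Nat.pos_of_ne_zero fun h => hv ((t.height_eq_zero v).1 h)

lemma ne_one_of_height_pos {v : Γ} (hv : 0 < t.height v) : v ≠ 1 := by
  rintro rfl; simp [height_one] at hv

lemma height_parent (v : Γ) : t.height (t.parent v) = t.height v - 1 := by
  by_cases h : v = 1
  · subst h; simp [t.parent_one, height_one]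
  · have := t.height_parent_add_one v h; omega

lemma height_iterate (k : ℕ) (v : Γ) : t.height (t.parent^[k] v) = t.height v - k := by
  induction k with
  | zero => simp
  | succ k ih => rw [Function.iterate_succ_apply', height_parent, ih]; omega

lemma Below.refl (v : Γ) : t.Below v v := ⟨0, rfl⟩

lemma Below.trans {u v w : Γ} (h : t.Below u v) (h' : t.Below v w) : t.Below u w := by
  obtain ⟨k, rfl⟩ := h; obtain ⟨l, rfl⟩ := h'
  exact ⟨k + l, by rw [Function.iterate_add_apply]⟩

lemma below_parent (v : Γ) : t.Below (t.parent v) v := ⟨1, rfl⟩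

lemma one_below (v : Γ) : t.Below 1 v :=
  ⟨t.height v, (t.height_eq_zero _).1 (by rw [height_iterate]; omega)⟩

lemma Below.height_le {u v : Γ} (h : t.Below u v) : t.height u ≤ t.height v := by
  obtain ⟨k, rfl⟩ := h; rw [height_iterate]; omega

lemma Below.eq_iterate {u v : Γ} (h : t.Below u v) :
    t.parent^[t.height v - t.height u] v = u := by
  obtain ⟨k, rfl⟩ := h
  rw [height_iterate]
  by_cases hk : k ≤ t.height v
  · congr 2; omega
  · have h1 : t.parent^[k] v = 1 := (t.height_eq_zero _).1 (by rw [height_iterate]; omega)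
    rw [h1, show t.height v - (t.height v - k) = t.height v by omega]
    exact (t.height_eq_zero _).1 (by rw [height_iterate]; omega)

lemma Below.eq_of_height_le {u v : Γ} (h : t.Below u v) (hh : t.height v ≤ t.height u) :
    u = v := by
  have := h.eq_iterate
  rw [show t.height v - t.height u = 0 by omega] at this
  exact this.symm

lemma Below.antisymm {u v : Γ} (h : t.Below u v) (h' : t.Below v u) : u = v :=
  h.eq_of_height_le h'.height_le

lemma Below.eq_or_parent {u v : Γ} (h : t.Below u v) : u = v ∨ t.Below u (t.parent v) := by
  obtain ⟨k, rfl⟩ := h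
  cases k with
  | zero => exact Or.inl rfl
  | succ k => exact Or.inr ⟨k, by rw [Function.iterate_succ_apply]⟩

lemma Below.height_lt {u v : Γ} (h : t.Below u v) (hne : u ≠ v) : t.height u < t.height v := by
  by_contra h'; exact hne (h.eq_of_height_le (by omega))

lemma Below.parent_of_ne {u v : Γ} (h : t.Below u v) (hne : u ≠ v) : t.Below u (t.parent v) :=
  h.eq_or_parent.resolve_left hne

/-- Vertices below the same vertex are comparable. -/
lemma Below.below_of_height_le {u u' v : Γ} (h : t.Below u v) (h' : t.Below u' v)
    (hh : t.height u ≤ t.height u') : t.Below u u' := by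
  refine ⟨t.height u' - t.height u, ?_⟩
  conv_lhs => rw [← h'.eq_iterate, height_iterate]
  rw [← Function.iterate_add_apply]
  have := h'.height_le
  rw [show t.height v - (t.height v - t.height u') - t.height u +
    (t.height v - t.height u') = t.height v - t.height u by omega]
  exact h.eq_iterate

lemma below_one_iff {u : Γ} : t.Below u 1 ↔ u = 1 :=
  ⟨fun h => h.antisymm (one_below u), fun h => h ▸ Below.refl _⟩

lemma Below.ne_one {u v : Γ} (h : t.Below u v) (hu : u ≠ 1) : v ≠ 1 := by
  rintro rfl; exact hu (below_one_iff.1 h)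

/-- The child of `u` on the way to `v`. -/
lemma Below.exists_child {u v : Γ} (h : t.Below u v) (hne : u ≠ v) :
    ∃ c, c ≠ 1 ∧ t.parent c = u ∧ t.Below c v := by
  have hlt := h.height_lt hne
  refine ⟨t.parent^[t.height v - t.height u - 1] v, ?_, ?_, ⟨_, rfl⟩⟩
  · apply ne_one_of_height_pos (t := t); rw [height_iterate]; omega
  · rw [← Function.iterate_succ_apply' t.parent]
    rw [show (t.height v - t.height u - 1).succ = t.height v - t.height u by omega]
    exact h.eq_iterate

lemma finite_below (v : Γ) : {u | t.Below u v}.Finite := by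
  classical
  refine (((Finset.range (t.height v + 1)).image fun k => t.parent^[k] v).finite_toSet).subset ?_
  intro u hu
  simp only [Finset.coe_image, Set.mem_image, Finset.coe_range, Set.mem_Iio]
  exact ⟨_, by grind, Below.eq_iterate hu⟩

lemma ncard_children_pos (hq : 0 < q) (v : Γ) : {u | u ≠ 1 ∧ t.parent u = v}.ncard ≠ 0 := by
  by_cases h : v = 1
  · subst h; rw [t.ncard_children_one]; omega
  · rw [t.ncard_children v h]; omega

lemma exists_child (hq : 0 < q) (v : Γ) : ∃ c, c ≠ 1 ∧ t.parent c = v :=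
  Set.nonempty_of_ncard_ne_zero (ncard_children_pos hq v)

lemma finite_children (hq : 0 < q) (v : Γ) : {u | u ≠ 1 ∧ t.parent u = v}.Finite :=
  Set.finite_of_ncard_ne_zero (ncard_children_pos hq v)

lemma height_child {c v : Γ} (hc : c ≠ 1) (h : t.parent c = v) : t.height c = t.height v + 1 := by
  rw [← h]; exact (t.height_parent_add_one c hc).symm

lemma finite_height_le (hq : 0 < q) (k : ℕ) : {v | t.height v ≤ k}.Finite := by
  induction k with
  | zero =>
    refine (Set.finite_singleton (1 : Γ)).subset fun v hv => ?_
    exact (t.height_eq_zero v).1 (by simpa using hv)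
  | succ k ih =>
    refine ((ih.biUnion fun v _ => finite_children (t := t) hq v).union ih).subset fun v hv => ?_
    simp only [Set.mem_ofPred_eq] at hv
    by_cases h : v = 1
    · right; subst h; simp [height_one]
    · left
      have := t.height_parent_add_one v h
      simp only [Set.mem_iUnion, Set.mem_ofPred_eq]
      exact ⟨t.parent v, by omega, h, rfl⟩

lemma exists_descendant (hq : 0 < q) (v : Γ) (k : ℕ) :
    ∃ u, t.Below v u ∧ t.height u = t.height v + k := by
  induction k with
  | zero => exact ⟨v, Below.refl v, rfl⟩
  | succ k ih =>
    obtain ⟨u, hu, hk⟩ := ih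
    obtain ⟨c, hc, rfl⟩ := t.exists_child hq u
    exact ⟨c, hu.trans (below_parent c), by rw [height_child hc rfl, hk]; omega⟩

/-! ### Hulls -/

variable (t) in
/-- The hull of the root, the position `γ` and the lit lamps of `f`: the vertices of the smallest
subtree containing them. -/
def hull (f : Γ → L) (γ : Γ) : Set Γ := {u | t.Below u γ ∨ ∃ v, f v ≠ 1 ∧ t.Below u v}

variable (t) in
/-- The number of edges of the hull, counted by their upper endpoints. -/
noncomputable def size (f : Γ → L) (γ : Γ) : ℕ := (t.hull f γ \ {1}).ncard

variable (t) in
/-- The length of a shortest walk from the root to `γ` that visits all lit lamps: every edge of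
the hull is crossed twice, except those between the root and `γ`. -/
noncomputable def len (f : Γ → L) (γ : Γ) : ℕ := 2 * t.size f γ - t.height γ

lemma mem_hull_pos (f : Γ → L) (γ : Γ) : γ ∈ t.hull f γ := Or.inl (Below.refl _)

lemma mem_hull_of_lit {f : Γ → L} {v : Γ} (hv : f v ≠ 1) (γ : Γ) : v ∈ t.hull f γ :=
  Or.inr ⟨v, hv, Below.refl _⟩

lemma one_mem_hull (f : Γ → L) (γ : Γ) : 1 ∈ t.hull f γ := Or.inl (one_below _)

lemma mem_hull_of_below {f : Γ → L} {γ u v : Γ} (h : t.Below u v) (hv : v ∈ t.hull f γ) :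
    u ∈ t.hull f γ := by
  rcases hv with hv | ⟨w, hw, hv⟩
  · exact Or.inl (h.trans hv)
  · exact Or.inr ⟨w, hw, h.trans hv⟩

lemma finite_hull {f : Γ → L} (hf : (Function.mulSupport f).Finite) (γ : Γ) :
    (t.hull f γ).Finite := by
  refine ((finite_below (t := t) γ).union
    (hf.biUnion fun v _ => finite_below (t := t) v)).subset ?_
  rintro u (hu | ⟨v, hv, hu⟩)
  · exact Or.inl hu
  · right; simp only [Set.mem_iUnion]; exact ⟨v, hv, hu⟩

/-- To bound a hull from above it is enough to bound its generators. -/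
lemma hull_subset {f f' : Γ → L} {γ γ' : Γ} (hγ : γ ∈ t.hull f' γ')
    (hf : ∀ v, f v ≠ 1 → v ∈ t.hull f' γ') : t.hull f γ ⊆ t.hull f' γ' := by
  rintro u (hu | ⟨v, hv, hu⟩)
  · exact mem_hull_of_below hu hγ
  · exact mem_hull_of_below hu (hf v hv)

lemma size_le_of_subset {f f' : Γ → L} {γ γ' : Γ} (hf' : (Function.mulSupport f').Finite)
    (h : t.hull f γ ⊆ t.hull f' γ') : t.size f γ ≤ t.size f' γ' :=
  Set.ncard_le_ncard (Set.sdiff_subset_sdiff_left h) ((finite_hull hf' γ').subset Set.sdiff_subset)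

lemma size_eq_of_hull_eq {f f' : Γ → L} {γ γ' : Γ} (h : t.hull f γ = t.hull f' γ') :
    t.size f γ = t.size f' γ' := by rw [size, size, h]

lemma size_le_add_one {f f' : Γ → L} {γ γ' w : Γ} (hf' : (Function.mulSupport f').Finite)
    (h : t.hull f γ ⊆ insert w (t.hull f' γ')) : t.size f γ ≤ t.size f' γ' + 1 := by
  refine (Set.ncard_le_ncard (t := insert w (t.hull f' γ' \ {1})) ?_ ?_).trans
    (Set.ncard_insert_le _ _)
  · rintro u ⟨hu, hu1⟩
    rcases h hu with rfl | h
    · exact Or.inl rfl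
    · exact Or.inr ⟨h, hu1⟩
  · exact ((finite_hull hf' γ').subset Set.sdiff_subset).insert _

lemma size_eq_add_one {f f' : Γ → L} {γ γ' w : Γ} (hf' : (Function.mulSupport f').Finite)
    (hw : w ≠ 1) (hw' : w ∉ t.hull f' γ')
    (h : t.hull f γ = insert w (t.hull f' γ')) : t.size f γ = t.size f' γ' + 1 := by
  rw [size, size, h, Set.insert_sdiff_of_notMem _ (by simpa using hw),
    Set.ncard_insert_of_notMem (fun h => hw' h.1) ((finite_hull hf' γ').subset Set.sdiff_subset)]

lemma ncard_below (v : Γ) : ({u | t.Below u v} \ {1}).ncard = t.height v := by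
  classical
  have : {u | t.Below u v} \ {1} =
      (fun k => t.parent^[k] v) '' (Finset.range (t.height v) : Set ℕ) := by
    ext u
    simp only [Set.mem_sdiff, Set.mem_ofPred_eq, Set.mem_singleton_iff, Finset.coe_range,
      Set.mem_image, Set.mem_Iio]
    constructor
    · rintro ⟨h, h1⟩
      refine ⟨_, ?_, h.eq_iterate⟩
      have := h.height_le; have := t.height_pos h1; omega
    · rintro ⟨k, hk, rfl⟩
      exact ⟨⟨k, rfl⟩, ne_one_of_height_pos (t := t) (by rw [height_iterate]; omega)⟩
  rw [this, Set.InjOn.ncard_image, Set.ncard_coe_finset, Finset.card_range]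
  intro a ha b hb hab
  simp only [Finset.coe_range, Set.mem_Iio] at ha hb
  have := congrArg t.height hab
  simp only [height_iterate] at this
  omega

lemma height_le_size_of_mem {f : Γ → L} (hf : (Function.mulSupport f).Finite) {γ u : Γ}
    (hu : u ∈ t.hull f γ) : t.height u ≤ t.size f γ := by
  rw [← ncard_below u]
  exact Set.ncard_le_ncard (Set.sdiff_subset_sdiff_left fun v hv => mem_hull_of_below hv hu)
    ((finite_hull hf γ).subset Set.sdiff_subset)

lemma height_le_size {f : Γ → L} (hf : (Function.mulSupport f).Finite) (γ : Γ) :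
    t.height γ ≤ t.size f γ := height_le_size_of_mem hf (mem_hull_pos f γ)

lemma len_add_height {f : Γ → L} (hf : (Function.mulSupport f).Finite) (γ : Γ) :
    t.len f γ + t.height γ = 2 * t.size f γ := by
  have := height_le_size (t := t) hf γ; rw [len]; omega

lemma size_pos_of_mem {f : Γ → L} (hf : (Function.mulSupport f).Finite) {γ u : Γ}
    (hu : u ∈ t.hull f γ) (h1 : u ≠ 1) : 0 < t.size f γ :=
  (height_pos h1).trans_le (height_le_size_of_mem hf hu)

lemma size_eq_zero {f : Γ → L} (hf : (Function.mulSupport f).Finite) {γ : Γ}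
    (h : t.size f γ = 0) : γ = 1 ∧ ∀ v, v ≠ 1 → f v = 1 := by
  constructor
  · by_contra h1; have := size_pos_of_mem hf (mem_hull_pos (t := t) f γ) h1; omega
  · intro v hv; by_contra h1
    have := size_pos_of_mem hf (mem_hull_of_lit (t := t) h1 γ) hv; omega

end CayleyTree

namespace CayleyTree

open Lamplighter CayleySphere Function

variable {Γ L : Type*} [Group Γ] [Group L] {S : Set Γ} {q : ℕ} {t : CayleyTree S q}

/-! ### Word length -/

lemma hull_subset_of_agree {f f' : Γ → L} {γ γ' : Γ}
    (h : ∀ x, x ≠ γ → x ≠ γ' → f x = f' x) (hγ' : γ' ∈ t.hull f γ) :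
    t.hull f' γ' ⊆ t.hull f γ := by
  refine hull_subset hγ' fun v hv => ?_
  by_cases h1 : v = γ
  · subst h1; exact mem_hull_pos _ _
  by_cases h2 : v = γ'
  · subst h2; exact hγ'
  exact mem_hull_of_lit (by rwa [h v h1 h2]) _

lemma hull_child_subset {f f' : Γ → L} {γ γ' : Γ}
    (h : ∀ x, x ≠ γ → x ≠ γ' → f x = f' x) (hγ' : t.parent γ' = γ) :
    t.hull f' γ' ⊆ insert γ' (t.hull f γ) := by
  have key : ∀ u, t.Below u γ' → u ∈ insert γ' (t.hull f γ) := by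
    intro u hu
    rcases hu.eq_or_parent with rfl | hu
    · exact Or.inl rfl
    · exact Or.inr (Or.inl (hγ' ▸ hu))
  rintro u (hu | ⟨v, hv, hu⟩)
  · exact key u hu
  · by_cases h2 : v = γ'
    · subst h2; exact key u hu
    by_cases h1 : v = γ
    · subst h1; exact Or.inr (Or.inl hu)
    exact Or.inr (Or.inr ⟨v, by rwa [h v h1 h2], hu⟩)

lemma len_le_of_step {f f' : Γ → L} {γ γ' : Γ} (hf : (mulSupport f).Finite)
    (hf' : (mulSupport f').Finite) (hadj : (SimpleGraph.mulCayley S).Adj γ γ' ∨ γ = γ')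
    (h : ∀ x, x ≠ γ → x ≠ γ' → f x = f' x) : t.len f' γ' ≤ t.len f γ + 1 := by
  have e1 := len_add_height (t := t) hf γ
  have e2 := len_add_height (t := t) hf' γ'
  rcases hadj with hadj | rfl
  · rcases (t.adj_iff _ _).1 hadj with ⟨h1, hp⟩ | ⟨h1, hp⟩
    · have := size_le_add_one hf (hull_child_subset h hp)
      have := height_child h1 hp
      omega
    · have := size_le_of_subset hf (hull_subset_of_agree h (Or.inl (hp ▸ below_parent γ)))
      have := height_child h1 hp
      omega
  · have := size_le_of_subset hf (hull_subset_of_agree h (mem_hull_pos (t := t) f γ))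
    omega

lemma len_le_of_adj {g g' : Lamplighter Γ L}
    (h : (SimpleGraph.mulCayley (switchWalkSwitch L S)).Adj g g') :
    t.len (lamps g') (pos g') ≤ t.len (lamps g) (pos g) + 1 := by
  obtain ⟨-, h1, h2⟩ := Lamplighter.adj_iff.1 h
  exact len_le_of_step g.finite_lamps g'.finite_lamps (h1.imp id And.left) h2

lemma size_one : t.size (1 : Γ → L) 1 = 0 := by
  rw [size, Set.ncard_eq_zero ((finite_hull (by simp) 1).subset Set.sdiff_subset)]
  ext u
  simp only [hull, Set.mem_sdiff, Set.mem_ofPred_eq, Pi.one_apply, ne_eq, not_true_eq_false,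
    false_and, exists_false, or_false, below_one_iff, Set.mem_singleton_iff, Set.mem_empty_iff_false]
  tauto

lemma len_le_length {g : Lamplighter Γ L}
    (w : (SimpleGraph.mulCayley (switchWalkSwitch L S)).Walk 1 g) :
    t.len (lamps g) (pos g) ≤ w.length := by
  have key : ∀ {a b : Lamplighter Γ L}
      (w : (SimpleGraph.mulCayley (switchWalkSwitch L S)).Walk a b),
      t.len (lamps b) (pos b) ≤ t.len (lamps a) (pos a) + w.length := by
    intro a b w
    induction w with
    | nil => simp
    | cons h w ih => have := len_le_of_adj (t := t) h; rw [SimpleGraph.Walk.length_cons]; omega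
  have := key w
  simpa [len, size_one] using this

lemma size_le_len {f : Γ → L} (hf : (mulSupport f).Finite) (γ : Γ) :
    t.size f γ ≤ t.len f γ := by
  have := len_add_height (t := t) hf γ
  have := height_le_size (t := t) hf γ
  omega

/-- Moving towards a lit lamp further down does not change the hull. -/
lemma hull_eq_of_below_lit {f : Γ → L} {γ γ' v : Γ} (h : t.Below γ γ') (h' : t.Below γ' v)
    (hv : f v ≠ 1) : t.hull f γ' = t.hull f γ :=
  (hull_subset (Or.inr ⟨v, hv, h'⟩) fun _ hu => mem_hull_of_lit hu _).antisymm
    (hull_subset (Or.inl h) fun _ hu => mem_hull_of_lit hu _)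

lemma finite_update {f : Γ → L} [DecidableEq Γ] (hf : (mulSupport f).Finite) (v : Γ) (a : L) :
    (mulSupport (update f v a)).Finite :=
  (hf.insert v).subset fun u hu => by
    by_cases h : u = v
    · exact Or.inl h
    · exact Or.inr (by simpa [h] using hu)

/-- When the lamplighter leaves a leaf of the hull towards the parent and erases its lamp, the hull
loses that leaf. -/
lemma hull_erase_leaf {f f' : Γ → L} {γ p : Γ} (hγ : γ ≠ 1)
    (hp : t.parent γ = p) (hleaf : ∀ v, f v ≠ 1 → t.Below γ v → γ = v) (h1 : f' γ = 1)
    (h : ∀ x, x ≠ p → x ≠ γ → f' x = f x) :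
    γ ∉ t.hull f' p ∧ t.hull f γ = insert γ (t.hull f' p) := by
  have hhp := height_child hγ hp
  refine ⟨?_, (hull_child_subset h hp).antisymm ?_⟩
  · rintro (hb | ⟨v, hv, hb⟩)
    · have := hb.height_le; omega
    · by_cases hvγ : v = γ
      · exact hv (hvγ ▸ h1)
      by_cases hvp : v = p
      · have := hb.height_le; rw [hvp] at this; omega
      rw [h v hvp hvγ] at hv
      exact hvγ (hleaf v hv hb).symm
  · rintro u (rfl | hu)
    · exact mem_hull_pos _ _
    · exact hull_subset_of_agree (fun x h1 h2 => (h x h2 h1).symm)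
        (Or.inl (hp ▸ below_parent γ)) hu

lemma size_erase_leaf {f f' : Γ → L} {γ p : Γ} (hf' : (mulSupport f').Finite) (hγ : γ ≠ 1)
    (hp : t.parent γ = p) (hleaf : ∀ v, f v ≠ 1 → t.Below γ v → γ = v) (h1 : f' γ = 1)
    (h : ∀ x, x ≠ p → x ≠ γ → f' x = f x) : t.size f γ = t.size f' p + 1 :=
  have ⟨h2, h3⟩ := hull_erase_leaf hγ hp hleaf h1 h
  size_eq_add_one hf' hγ h2 h3

/-- Away from the elements with an empty hull, `len` strictly decreases along some edge: either
towards a lit lamp further down, or back to the parent, erasing the lamps on the way. -/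
lemma exists_walk_of_size_ne_zero (m : ℕ) : ∀ g : Lamplighter Γ L,
    t.size (lamps g) (pos g) ≠ 0 → t.len (lamps g) (pos g) = m →
    ∃ w : (SimpleGraph.mulCayley (switchWalkSwitch L S)).Walk 1 g, w.length = m := by
  classical
  induction m with
  | zero =>
    intro g hs hm
    have := size_le_len (t := t) g.finite_lamps (pos g)
    omega
  | succ m ih =>
    intro g hs hm
    set f := lamps g with hfdef
    set γ := pos g with hγdef
    have hf : (mulSupport f).Finite := g.finite_lamps
    have e1 := len_add_height (t := t) hf γ
    by_cases hd : ∃ v, f v ≠ 1 ∧ t.Below γ v ∧ γ ≠ v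
    · obtain ⟨v, hv, hb, hne⟩ := hd
      obtain ⟨c, hc1, hcp, hcv⟩ := hb.exists_child hne
      have hγc : t.Below γ c := hcp ▸ below_parent c
      have hsz := size_eq_of_hull_eq (hull_eq_of_below_lit hγc hcv hv)
      have e2 := len_add_height (t := t) hf c
      have hhc := height_child hc1 hcp
      obtain ⟨w, hw⟩ := ih (state f c hf) (by simpa [hsz] using hs) (by simp; omega)
      refine ⟨w.concat (Lamplighter.adj_iff.2 ⟨fun h => ?_, Or.inl ?_, ?_⟩),
        by rw [SimpleGraph.Walk.length_concat, hw]⟩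
      · have hcγ : c = γ := congrArg pos h
        rw [hcγ] at hhc
        omega
      · exact (t.adj_iff _ _).2 (Or.inr ⟨hc1, hcp⟩)
      · intro x _ _; rfl
    · push Not at hd
      have hγ1 : γ ≠ 1 := by
        intro h1
        apply hs
        rw [size, Set.ncard_eq_zero ((finite_hull hf γ).subset Set.sdiff_subset)]
        ext u
        simp only [Set.mem_sdiff, Set.mem_singleton_iff, Set.mem_empty_iff_false, iff_false,
          not_and, not_not]
        rintro (hu | ⟨v, hv, hu⟩)
        · rw [h1] at hu; exact below_one_iff.1 hu
        · have := hd v hv (h1 ▸ one_below v)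
          rw [← this, h1] at hu; exact below_one_iff.1 hu
      obtain ⟨p, hp⟩ : ∃ p, t.parent γ = p := ⟨_, rfl⟩
      have hhp := height_child hγ1 hp
      set f' := update (update f γ 1) p 1 with hf'def
      have hf' : (mulSupport f').Finite := finite_update (finite_update hf _ _) _ _
      have hagree : ∀ x, x ≠ p → x ≠ γ → f' x = f x := by
        intro x hx hx'; simp [hf'def, hx, hx']
      have hpγ : p ≠ γ := by rintro h; rw [h] at hhp; omega
      have hsz := size_erase_leaf hf' hγ1 hp hd (by simp [hf'def, hpγ.symm]) hagree
      have e2 := len_add_height (t := t) hf' p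
      have hadj : (SimpleGraph.mulCayley (switchWalkSwitch L S)).Adj (state f' p hf') g := by
        refine Lamplighter.adj_iff.2 ⟨fun h => ?_, Or.inl ?_, ?_⟩
        · exact hpγ (congrArg pos h)
        · exact (t.adj_iff _ _).2 (Or.inl ⟨hγ1, hp⟩)
        · exact hagree
      by_cases h0 : t.size f' p = 0
      · obtain ⟨h1, h2⟩ := size_eq_zero hf' h0
        have : (1 : Lamplighter Γ L) = state f' p hf' := by
          refine ext_lamps_pos ?_ (by simp [h1])
          funext x
          by_cases hx : x = 1
          · subst hx; simp [hf'def, h1]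
          · simp [h2 x hx]
        rw [← this] at hadj
        refine ⟨SimpleGraph.Walk.cons hadj SimpleGraph.Walk.nil, ?_⟩
        have := height_one (t := t)
        simp only [SimpleGraph.Walk.length_cons, SimpleGraph.Walk.length_nil]
        rw [h1] at hhp
        omega
      · obtain ⟨w, hw⟩ := ih (state f' p hf') (by simpa using h0) (by simp; omega)
        exact ⟨w.concat hadj, by rw [SimpleGraph.Walk.length_concat, hw]⟩

/-- The word length is `len`, except for the elements with an empty hull. -/
lemma dist_eq_len {g : Lamplighter Γ L} (h : t.size (lamps g) (pos g) ≠ 0) :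
    (SimpleGraph.mulCayley (switchWalkSwitch L S)).dist 1 g = t.len (lamps g) (pos g) := by
  obtain ⟨w, hw⟩ := exists_walk_of_size_ne_zero _ g h rfl
  refine le_antisymm (hw ▸ SimpleGraph.dist_le w) ?_
  obtain ⟨w', hw'⟩ := w.reachable.exists_walk_length_eq_dist
  exact hw' ▸ len_le_length w'

lemma len_le_dist (g : Lamplighter Γ L) :
    t.len (lamps g) (pos g) ≤ (SimpleGraph.mulCayley (switchWalkSwitch L S)).dist 1 g := by
  by_cases h : t.size (lamps g) (pos g) = 0
  · simp [len, h]
  · rw [dist_eq_len h]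

lemma size_ne_zero_of_len_pos {f : Γ → L} {γ : Γ} (h : 0 < t.len f γ) : t.size f γ ≠ 0 := by
  intro h0; simp [len, h0] at h

/-! ### Balls and infinite components -/

lemma finite_states [Finite L] {B : Set Γ} (hB : B.Finite) (f₀ : Γ → L) :
    {g : Lamplighter Γ L | pos g ∈ B ∧ ∀ v, v ∉ B → lamps g v = f₀ v}.Finite := by
  have := hB.to_subtype
  let F : {g : Lamplighter Γ L // pos g ∈ B ∧ ∀ v, v ∉ B → lamps g v = f₀ v} → (B → L) × B :=
    fun g => (fun v => lamps g.1 v, ⟨pos g.1, g.2.1⟩)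
  have hF : Injective F := by
    rintro ⟨g, hg⟩ ⟨g', hg'⟩ h
    simp only [F, Prod.mk.injEq, Subtype.mk.injEq] at h
    refine Subtype.ext (ext_lamps_pos (funext fun v => ?_) h.2)
    by_cases hv : v ∈ B
    · exact congrFun h.1 ⟨v, hv⟩
    · rw [hg.2 v hv, hg'.2 v hv]
  exact Finite.of_injective F hF

lemma finite_dist_le [Finite L] (t : CayleyTree S q) (hq : 0 < q) (m : ℕ) :
    {g : Lamplighter Γ L |
      (SimpleGraph.mulCayley (switchWalkSwitch L S)).dist 1 g ≤ m}.Finite := by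
  refine (finite_states (finite_height_le (t := t) hq m) 1).subset fun g hg => ?_
  have h1 := (len_le_dist (t := t) g).trans hg
  have h2 := (size_le_len (t := t) g.finite_lamps (pos g)).trans h1
  refine ⟨(height_le_size g.finite_lamps _).trans h2, fun v hv => ?_⟩
  by_contra h
  exact hv ((height_le_size_of_mem g.finite_lamps (mem_hull_of_lit h _)).trans h2)

lemma finite_annulusInf [Finite L] (t : CayleyTree S q) (hq : 0 < q) (n r : ℕ) :
    Finite (annulusInf (switchWalkSwitch L S) n r) :=
  ((finite_dist_le t hq (n + r)).subset Set.inter_subset_left).to_subtype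

end CayleyTree

namespace CayleySphere

variable {G : Type*} [Group G] {S : Set G}

lemma reachable_induction {V : Type*} {H : SimpleGraph V} {P : V → Prop}
    (hP : ∀ a b, H.Adj a b → P a → P b) {a b : V} (h : H.Reachable a b) (ha : P a) : P b := by
  obtain ⟨w⟩ := h
  induction w with
  | nil => exact ha
  | cons hadj _ ih => exact ih (hP _ _ hadj ha)

/-- If a property of points outside the ball is preserved along edges and holds only on a finite
set, then points having it are not in an infinite component. -/
lemma notMem_ballComplInf_of_finite {n : ℕ} {P : G → Prop} (hfin : {g | P g}.Finite)
    (hP : ∀ a b, (SimpleGraph.mulCayley S).Adj a b → b ∈ ballCompl S n → P a → P b)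
    {g : G} (hg : P g) : g ∉ ballComplInf S n := by
  rintro ⟨hgn, hinf⟩
  apply hinf
  refine Set.Finite.of_finite_image (f := Subtype.val) (hfin.subset ?_)
    Subtype.val_injective.injOn
  rintro _ ⟨x, hx, rfl⟩
  have hr := (SimpleGraph.ConnectedComponent.exact hx).symm
  exact reachable_induction (V := ballCompl S n) (P := fun y => P y.1) (fun a b hab ha => hP a b hab b.2 ha) hr hg

lemma mem_ballComplInf_of_adj {n : ℕ} {g g' : G} (hg : g ∈ ballComplInf S n)
    (hadj : (SimpleGraph.mulCayley S).Adj g g') (hg' : g' ∈ ballCompl S n) :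
    g' ∈ ballComplInf S n := by
  obtain ⟨hgn, hinf⟩ := hg
  refine ⟨hg', ?_⟩
  have : ((SimpleGraph.mulCayley S).induce (ballCompl S n)).connectedComponentMk ⟨g', hg'⟩ =
      ((SimpleGraph.mulCayley S).induce (ballCompl S n)).connectedComponentMk ⟨g, hgn⟩ :=
    SimpleGraph.ConnectedComponent.sound (SimpleGraph.Adj.reachable hadj.symm)
  rwa [this]

/-- An injective sequence of consecutively adjacent points outside the ball lies in an infinite
component. -/
lemma mem_ballComplInf_of_ray {n : ℕ} (x : ℕ → G) (hinj : Function.Injective x)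
    (hx : ∀ k, x k ∈ ballCompl S n) (hadj : ∀ k, (SimpleGraph.mulCayley S).Adj (x k) (x (k + 1))) :
    x 0 ∈ ballComplInf S n := by
  refine ⟨hx 0, Set.infinite_of_injective_forall_mem (f := fun k => ⟨x k, hx k⟩) ?_ ?_⟩
  · intro a b h; exact hinj (congrArg Subtype.val h)
  · intro k
    refine SimpleGraph.ConnectedComponent.sound (SimpleGraph.Reachable.symm ?_)
    induction k with
    | zero => exact SimpleGraph.Reachable.refl _
    | succ k ih => exact ih.trans (SimpleGraph.Adj.reachable (hadj k))

end CayleySphere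

namespace CayleyTree

open Lamplighter CayleySphere Function

variable {Γ L : Type*} [Group Γ] [Group L] {S : Set Γ} {q : ℕ} {t : CayleyTree S q}

/-- Elements with an empty hull lie in a finite component of the complement of the ball of
radius `n - 1`, as soon as `2 ≤ n`. -/
lemma size_ne_zero_of_mem_ballComplInf [Finite L] (t : CayleyTree S q) {n : ℕ} (hn : 2 ≤ n)
    {g : Lamplighter Γ L}
    (hg : g ∈ ballComplInf (switchWalkSwitch L S) n) : t.size (lamps g) (pos g) ≠ 0 := by
  intro h0
  refine notMem_ballComplInf_of_finite (P := fun g => t.size (lamps g) (pos g) = 0) ?_ ?_ h0 hg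
  · refine (finite_states (Set.finite_singleton (1 : Γ)) 1).subset fun g hg => ?_
    obtain ⟨h1, h2⟩ := size_eq_zero g.finite_lamps hg
    exact ⟨h1, fun v hv => h2 v hv⟩
  · intro a b hab hb ha
    by_contra hne
    have h1 := len_le_of_adj (t := t) hab
    have h2 : n ≤ _ := hb
    rw [dist_eq_len hne] at h2
    have : t.len (lamps a) (pos a) = 0 := by simp [len, ha]
    omega

/-- If the hull contains every vertex of height at most `2 * size - n + 1`, the lamplighter cannot
get to the vertices of height `2 * size - n + 1` outside the ball of radius `n - 1`, and is confined
to a finite set. -/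
lemma exists_notMem_hull_of_mem_ballComplInf [Finite L] (hq : 0 < q) {n : ℕ}
    {g : Lamplighter Γ L} (hg : g ∈ ballComplInf (switchWalkSwitch L S) n)
    (h0 : t.size (lamps g) (pos g) ≠ 0) :
    ∃ v, t.height v + n ≤ 2 * t.size (lamps g) (pos g) + 1 ∧ v ∉ t.hull (lamps g) (pos g) := by
  by_contra hcon
  push Not at hcon
  set N := t.size (lamps g) (pos g) with hN
  have hlen := len_add_height (t := t) g.finite_lamps (pos g)
  have hdist : n ≤ t.len (lamps g) (pos g) := by
    rw [← dist_eq_len h0]; exact hg.1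
  refine notMem_ballComplInf_of_finite
    (P := fun g' => t.height (pos g') + n ≤ 2 * N ∧
      ∀ v, 2 * N < t.height v + n → lamps g' v = lamps g v) ?_ ?_ ⟨by omega, fun _ _ => rfl⟩ hg
  · refine (finite_states (finite_height_le (t := t) hq (2 * N - n)) (lamps g)).subset
      fun g' hg' => ⟨?_, fun v hv => hg'.2 v ?_⟩
    · have := hg'.1; simp only [Set.mem_ofPred_eq]; omega
    · simp only [Set.mem_ofPred_eq] at hv; omega
  · rintro a b hab hb ⟨ha1, ha2⟩
    obtain ⟨-, hab1, hab2⟩ := Lamplighter.adj_iff.1 hab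
    have hh : t.height (pos b) ≤ t.height (pos a) + 1 := by
      rcases hab1 with h | h
      · rcases (t.adj_iff _ _).1 h with ⟨h1, h2⟩ | ⟨h1, h2⟩
        · rw [height_child h1 h2]
        · rw [height_child h1 h2]; omega
      · rw [h.1]; omega
    have hsub : t.hull (lamps b) (pos b) ⊆ t.hull (lamps g) (pos g) := by
      refine hull_subset (hcon _ (by omega)) fun v hv => ?_
      by_cases hv1 : t.height v + n ≤ 2 * N + 1
      · exact hcon v hv1
      · have e1 : lamps a v = lamps b v := by
          apply hab2
          · rintro rfl; omega
          · rintro rfl; omega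
        exact mem_hull_of_lit (by rwa [← ha2 v (by omega), e1]) _
    have hsz := size_le_of_subset g.finite_lamps hsub
    have hb1 : t.height (pos b) + n ≤ 2 * N := by
      by_contra hlt
      have hne : pos b ≠ 1 := ne_one_of_height_pos (t := t) (by omega)
      have hs : t.size (lamps b) (pos b) ≠ 0 :=
        (size_pos_of_mem b.finite_lamps (mem_hull_pos _ _) hne).ne'
      have h2 : n ≤ _ := hb
      rw [dist_eq_len hs] at h2
      have := len_add_height (t := t) b.finite_lamps (pos b)
      omega
    refine ⟨hb1, fun v hv => ?_⟩
    rw [← ha2 v hv]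
    refine (hab2 v ?_ ?_).symm
    · rintro rfl; omega
    · rintro rfl; omega

/-- A lamplighter with no lit lamp further down can walk to infinity. -/
lemma mem_ballComplInf_of_leaf (t : CayleyTree S q) (hq : 0 < q) {n : ℕ} {g : Lamplighter Γ L}
    (hn : n ≤ t.len (lamps g) (pos g))
    (hleaf : ∀ v, lamps g v ≠ 1 → t.Below (pos g) v → pos g = v) :
    g ∈ ballComplInf (switchWalkSwitch L S) n := by
  choose c hc1 hcp using exists_child (t := t) hq
  let x : ℕ → Lamplighter Γ L := fun k => state (lamps g) (c^[k] (pos g)) g.finite_lamps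
  have hx0 : x 0 = g := rfl
  have hheight : ∀ k, t.height (c^[k] (pos g)) = t.height (pos g) + k := by
    intro k
    induction k with
    | zero => rfl
    | succ k ih => rw [iterate_succ_apply', height_child (hc1 _) (hcp _), ih]; omega
  have hbelow : ∀ k, t.Below (pos g) (c^[k] (pos g)) := by
    intro k
    induction k with
    | zero => exact Below.refl _
    | succ k ih =>
      rw [iterate_succ_apply']
      exact ih.trans ⟨1, hcp _⟩
  have hsize : ∀ k, t.size (lamps g) (c^[k] (pos g)) = t.size (lamps g) (pos g) + k := by
    intro k
    induction k with
    | zero => rfl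
    | succ k ih =>
      have := size_eq_add_one (t := t) (f := lamps g) (f' := lamps g)
        (γ := c^[k + 1] (pos g)) (γ' := c^[k] (pos g))
        (w := c^[k + 1] (pos g)) g.finite_lamps ?_ ?_ ?_
      · rw [this, ih]; omega
      · rw [iterate_succ_apply']; exact hc1 _
      · rintro (h | ⟨v, hv, h⟩)
        · have := h.height_le; rw [hheight, hheight] at this; omega
        · have := hleaf v hv ((hbelow _).trans h)
          have h' := h.height_le
          rw [← this, hheight] at h'; omega
      · rw [iterate_succ_apply']
        refine (hull_child_subset (fun _ _ _ => rfl) (hcp _)).antisymm ?_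
        rintro u (rfl | hu)
        · exact mem_hull_pos _ _
        · exact hull_subset_of_agree (fun _ _ _ => rfl) (Or.inl ⟨1, hcp _⟩) hu
  rw [← hx0]
  refine mem_ballComplInf_of_ray x ?_ ?_ ?_
  · intro a b h
    have := congrArg (fun g => t.height (pos g)) h
    simp only [x, pos_state, hheight] at this
    omega
  · intro k
    refine le_trans ?_ (len_le_dist (t := t) (x k))
    have h1 := len_add_height (t := t) g.finite_lamps (pos g)
    have h2 := len_add_height (t := t) g.finite_lamps (c^[k] (pos g))
    rw [hsize, hheight] at h2
    simp only [x, lamps_state, pos_state]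
    omega
  · intro k
    refine Lamplighter.adj_iff.2 ⟨fun h => ?_, Or.inl ((t.adj_iff _ _).2 (Or.inl ?_)),
      fun _ _ _ => rfl⟩
    · have := congrArg (fun g => t.height (pos g)) h
      simp only [x, pos_state, hheight] at this
      omega
    · simp only [x, pos_state, iterate_succ_apply']
      exact ⟨hc1 _, hcp _⟩

/-! ### Paths in an annulus -/

variable (t) in
/-- `t.Linked n m (f, γ) (f', γ')`: one can go from `(f, γ)` to `(f', γ')` through elements with
`len` between `n` and `m`, changing the position in each step. -/
def Linked (n m : ℕ) : (Γ → L) × Γ → (Γ → L) × Γ → Prop :=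
  Relation.ReflTransGen fun x y =>
    ((mulSupport x.1).Finite ∧ n ≤ t.len x.1 x.2 ∧ t.len x.1 x.2 ≤ m) ∧
    ((mulSupport y.1).Finite ∧ n ≤ t.len y.1 y.2 ∧ t.len y.1 y.2 ≤ m) ∧
    (SimpleGraph.mulCayley S).Adj x.2 y.2 ∧ ∀ v, v ≠ x.2 → v ≠ y.2 → x.1 v = y.1 v

lemma Linked.refl {n m : ℕ} (x : (Γ → L) × Γ) : t.Linked n m x x := Relation.ReflTransGen.refl

lemma Linked.trans {n m : ℕ} {x y z : (Γ → L) × Γ} (h : t.Linked n m x y)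
    (h' : t.Linked n m y z) : t.Linked n m x z := Relation.ReflTransGen.trans h h'

lemma Linked.symm {n m : ℕ} {x y : (Γ → L) × Γ} (h : t.Linked n m x y) : t.Linked n m y x := by
  induction h with
  | refl => exact Linked.refl _
  | tail _ hab ih =>
    exact Relation.ReflTransGen.head
      ⟨hab.2.1, hab.1, hab.2.2.1.symm, fun v h1 h2 => (hab.2.2.2 v h2 h1).symm⟩ ih

/-- A step from the parent to a child. -/
lemma Linked.down {n m : ℕ} {f f' : Γ → L} {c γ : Γ} (hc : c ≠ 1) (hp : t.parent c = γ)
    (hf : (mulSupport f).Finite) (hf' : (mulSupport f').Finite)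
    (h1 : n ≤ t.len f γ) (h2 : t.len f γ ≤ m) (h3 : n ≤ t.len f' c) (h4 : t.len f' c ≤ m)
    (h : ∀ v, v ≠ γ → v ≠ c → f v = f' v) : t.Linked n m (f, γ) (f', c) :=
  Relation.ReflTransGen.single
    ⟨⟨hf, h1, h2⟩, ⟨hf', h3, h4⟩, (t.adj_iff _ _).2 (Or.inl ⟨hc, hp⟩), h⟩

lemma Linked.exists_reachable {n r : ℕ} (hn : 1 ≤ n) {x y : (Γ → L) × Γ}
    (h : t.Linked n (n + r) x y) (hx : (mulSupport x.1).Finite)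
    (hx' : state x.1 x.2 hx ∈ annulusInf (switchWalkSwitch L S) n r) :
    ∃ (hy : (mulSupport y.1).Finite)
      (hy' : state y.1 y.2 hy ∈ annulusInf (switchWalkSwitch L S) n r),
      (annulusGraph (switchWalkSwitch L S) n r).Reachable ⟨_, hx'⟩ ⟨_, hy'⟩ := by
  induction h with
  | refl => exact ⟨hx, hx', SimpleGraph.Reachable.refl _⟩
  | tail _ hstep ih =>
    rename_i b c _
    obtain ⟨hb, hb', hreach⟩ := ih
    obtain ⟨-, ⟨hc, h1, h2⟩, hadj, hl⟩ := hstep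
    have hd : (SimpleGraph.mulCayley (switchWalkSwitch L S)).dist 1 (state c.1 c.2 hc) =
        t.len c.1 c.2 := dist_eq_len (size_ne_zero_of_len_pos (by simpa using by omega))
    have hadj' : (SimpleGraph.mulCayley (switchWalkSwitch L S)).Adj (state b.1 b.2 hb)
        (state c.1 c.2 hc) :=
      Lamplighter.adj_iff.2 ⟨fun h => hadj.ne (congrArg pos h), Or.inl hadj, hl⟩
    have hc' : state c.1 c.2 hc ∈ annulusInf (switchWalkSwitch L S) n r := by
      refine ⟨by simp only [Set.mem_ofPred_eq]; omega, mem_ballComplInf_of_adj hb'.2 hadj' ?_⟩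
      simp only [ballCompl, Set.mem_ofPred_eq]; omega
    exact ⟨hc, hc', hreach.trans (SimpleGraph.Adj.reachable hadj')⟩

end CayleyTree

namespace CayleyTree

open Lamplighter CayleySphere Function

variable {Γ L : Type*} [Group Γ] [Group L] {S : Set Γ} {q : ℕ} {t : CayleyTree S q}

/-! ### Changing the hull by one vertex -/

lemma hull_eq_hull_one {f : Γ → L} {δ : Γ} (h : δ ∈ t.hull f 1) : t.hull f δ = t.hull f 1 :=
  (hull_subset h fun _ hv => mem_hull_of_lit hv _).antisymm
    (hull_subset (one_mem_hull _ _) fun _ hv => mem_hull_of_lit hv _)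

lemma len_add_height_of_mem {f : Γ → L} (hf : (mulSupport f).Finite) {δ : Γ}
    (h : δ ∈ t.hull f 1) : t.len f δ + t.height δ = 2 * t.size f 1 := by
  rw [len_add_height hf, size_eq_of_hull_eq (hull_eq_hull_one h)]

lemma len_one {f : Γ → L} : t.len f 1 = 2 * t.size f 1 := by
  simp [len, height_one]

/-- Inside the hull of the lit lamps, the lamplighter can walk down without changing any lamp. -/
lemma Linked.walk_down {n m : ℕ} {f : Γ → L} (hf : (mulSupport f).Finite) {γ : Γ} (δ : Γ)
    (h : t.Below γ δ) (hδ : δ ∈ t.hull f 1) (h1 : n + t.height δ ≤ 2 * t.size f 1)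
    (h2 : 2 * t.size f 1 ≤ m + t.height γ) : t.Linked n m (f, γ) (f, δ) := by
  obtain ⟨k, hk⟩ : ∃ k, k = t.height δ := ⟨_, rfl⟩
  induction k using Nat.strong_induction_on generalizing δ with
  | _ k ih =>
  by_cases hne : γ = δ
  · subst hne; exact Linked.refl _
  · have hb := h.parent_of_ne hne
    have hδ1 : δ ≠ 1 := by
      rintro rfl; exact hne (below_one_iff.1 h)
    have hh := height_child (t := t) hδ1 rfl
    have hpδ : t.parent δ ∈ t.hull f 1 := mem_hull_of_below (below_parent δ) hδ
    refine (ih (t.height (t.parent δ)) (by omega) _ hb hpδ (by omega) rfl).trans ?_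
    have e1 := len_add_height_of_mem hf hδ
    have e2 := len_add_height_of_mem hf hpδ
    have := hb.height_le
    exact Linked.down hδ1 rfl hf hf (by omega) (by omega) (by omega) (by omega) fun _ _ _ => rfl

/-- The lamplighter walks from `γ` down to `w`, changes the lamps at `w` and its parent, and comes
back. -/
lemma Linked.modify {n m : ℕ} {f f' : Γ → L} (hf : (mulSupport f).Finite)
    (hf' : (mulSupport f').Finite) {γ w : Γ} (hw : w ≠ 1) (hγ : t.Below γ (t.parent w))
    (hp : t.parent w ∈ t.hull f 1) (hw' : w ∈ t.hull f' 1)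
    (h : ∀ v, v ≠ t.parent w → v ≠ w → f v = f' v)
    (h1 : n + t.height w ≤ 2 * t.size f 1 + 1) (h2 : 2 * t.size f 1 ≤ m + t.height γ)
    (h3 : n + t.height w ≤ 2 * t.size f' 1) (h4 : 2 * t.size f' 1 ≤ m + t.height γ) :
    t.Linked n m (f, γ) (f', γ) := by
  have hh := height_child (t := t) hw rfl
  have := hγ.height_le
  have e1 := len_add_height_of_mem hf hp
  have e2 := len_add_height_of_mem hf' hw'
  refine (Linked.walk_down hf _ hγ hp (by omega) h2).trans (Linked.trans ?_
    (Linked.walk_down hf' w (hγ.trans (below_parent w)) hw' h3 h4).symm)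
  exact Linked.down hw rfl hf hf' (by omega) (by omega) (by omega) (by omega) h

section Twig

variable [DecidableEq Γ]

/-- Lighting a lamp at a child of a vertex of the hull adds one vertex to the hull. -/
lemma hull_update {f : Γ → L} {w : Γ} {a : L} (ha : a ≠ 1) (hw : w ∉ t.hull f 1)
    (hp : t.parent w ∈ t.hull f 1) : t.hull (update f w a) 1 = insert w (t.hull f 1) := by
  have hlit : ∀ v, f v ≠ 1 → update f w a v ≠ 1 := by
    intro v hv
    by_cases h : v = w
    · subst h; simpa using ha
    · simpa [h] using hv
  apply Set.Subset.antisymm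
  · rintro u (hu | ⟨v, hv, hu⟩)
    · exact Or.inr (Or.inl hu)
    · by_cases h : v = w
      · subst h
        rcases hu.eq_or_parent with rfl | hu
        · exact Or.inl rfl
        · exact Or.inr (mem_hull_of_below hu hp)
      · exact Or.inr (Or.inr ⟨v, by simpa [h] using hv, hu⟩)
  · rintro u (rfl | hu)
    · exact mem_hull_of_lit (by simpa using ha) _
    · exact hull_subset (one_mem_hull _ _) (fun v hv => mem_hull_of_lit (hlit v hv) _) hu

lemma size_update {f : Γ → L} (hf : (mulSupport f).Finite) {w : Γ} {a : L} (ha : a ≠ 1)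
    (hw : w ∉ t.hull f 1) (hp : t.parent w ∈ t.hull f 1) :
    t.size (update f w a) 1 = t.size f 1 + 1 :=
  size_eq_add_one hf (by rintro rfl; exact hw (one_mem_hull _ _)) hw (hull_update ha hw hp)

variable (t) in
/-- Erase the lamp at `l` and light the lamp at its parent, so that exactly the leaf `l` is removed
from the hull. -/
def prune (f : Γ → L) (a : L) (l : Γ) : Γ → L := update (update f l 1) (t.parent l) a

lemma finite_prune {f : Γ → L} (hf : (mulSupport f).Finite) (a : L) (l : Γ) :
    (mulSupport (t.prune f a l)).Finite := finite_update (finite_update hf _ _) _ _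

lemma prune_agree (f : Γ → L) (a : L) (l v : Γ) (h1 : v ≠ t.parent l) (h2 : v ≠ l) :
    t.prune f a l v = f v := by simp [prune, h1, h2]

lemma prune_parent (f : Γ → L) (a : L) (l : Γ) : t.prune f a l (t.parent l) = a := by simp [prune]

lemma notMem_hull_prune {f : Γ → L} {a : L} {l : Γ} (hl : l ≠ 1)
    (hleaf : ∀ v, f v ≠ 1 → t.Below l v → l = v) : l ∉ t.hull (t.prune f a l) 1 := by
  rintro (h | ⟨v, hv, h⟩)
  · exact hl (below_one_iff.1 h)
  · by_cases h1 : v = t.parent l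
    · have := h.height_le
      have := height_child (t := t) hl rfl
      rw [h1] at *
      omega
    by_cases h2 : v = l
    · subst h2; simp [prune, h1] at hv
    · rw [prune_agree _ _ _ _ h1 h2] at hv
      exact h2 (hleaf v hv h).symm

lemma hull_eq_insert_prune {f : Γ → L} {a : L} {l : Γ} (ha : a ≠ 1) (hlit : f l ≠ 1) :
    t.hull f 1 = insert l (t.hull (t.prune f a l) 1) := by
  have hp : t.parent l ∈ t.hull (t.prune f a l) 1 :=
    mem_hull_of_lit (by rwa [prune_parent]) _
  apply Set.Subset.antisymm
  · rintro u (hu | ⟨v, hv, hu⟩)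
    · exact Or.inr (Or.inl hu)
    · by_cases h : v = l
      · subst h
        rcases hu.eq_or_parent with rfl | hu
        · exact Or.inl rfl
        · exact Or.inr (mem_hull_of_below hu hp)
      · by_cases h1 : v = t.parent l
        · subst h1; exact Or.inr (mem_hull_of_below hu hp)
        · exact Or.inr (Or.inr ⟨v, by rwa [prune_agree _ _ _ _ h1 h], hu⟩)
  · rintro u (rfl | hu)
    · exact mem_hull_of_lit hlit _
    · refine hull_subset (one_mem_hull _ _) (fun v hv => ?_) hu
      by_cases h1 : v = t.parent l
      · exact mem_hull_of_below (h1 ▸ below_parent l) (mem_hull_of_lit hlit _)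
      by_cases h : v = l
      · subst h; simp [prune, h1] at hv
      · exact mem_hull_of_lit (by rwa [prune_agree _ _ _ _ h1 h] at hv) _

lemma size_prune {f : Γ → L} (hf : (mulSupport f).Finite) {a : L} {l : Γ} (ha : a ≠ 1)
    (hl : l ≠ 1) (hlit : f l ≠ 1) (hleaf : ∀ v, f v ≠ 1 → t.Below l v → l = v) :
    t.size f 1 = t.size (t.prune f a l) 1 + 1 :=
  size_eq_add_one (finite_prune hf a l) hl (notMem_hull_prune hl hleaf)
    (hull_eq_insert_prune ha hlit)

end Twig

/-! ### Counting descendants -/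

lemma finite_descendants (hq : 0 < q) (v : Γ) (k : ℕ) :
    {u | t.Below v u ∧ t.height u = t.height v + k}.Finite :=
  (finite_height_le (t := t) hq (t.height v + k)).subset fun _ hu => hu.2.le

lemma le_ncard_children (v : Γ) : q ≤ {u | u ≠ 1 ∧ t.parent u = v}.ncard := by
  by_cases h : v = 1
  · subst h; rw [t.ncard_children_one]; omega
  · rw [t.ncard_children v h]

lemma pow_le_ncard_descendants (hq : 0 < q) (v : Γ) (k : ℕ) :
    q ^ k ≤ {u | t.Below v u ∧ t.height u = t.height v + k}.ncard := by
  classical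
  induction k with
  | zero =>
    rw [pow_zero, Nat.one_le_iff_ne_zero, ← Nat.pos_iff_ne_zero,
      Set.ncard_pos (finite_descendants hq v 0)]
    exact ⟨v, Below.refl v, rfl⟩
  | succ k ih =>
    rw [pow_succ']
    refine (Nat.mul_le_mul_left q ih).trans ?_
    rw [Set.ncard_eq_toFinset_card _ (finite_descendants hq v k),
      Set.ncard_eq_toFinset_card _ (finite_descendants hq v (k + 1))]
    refine Finset.mul_card_image_le_card_of_maps_to (f := t.parent) ?_ q ?_
    · intro u hu
      simp only [Set.Finite.mem_toFinset, Set.mem_ofPred_eq] at hu ⊢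
      refine ⟨hu.1.parent_of_ne ?_, ?_⟩
      · rintro rfl; omega
      · rw [height_parent]; omega
    · intro b hb
      simp only [Set.Finite.mem_toFinset, Set.mem_ofPred_eq] at hb
      refine (le_ncard_children (t := t) b).trans ?_
      rw [← Set.ncard_coe_finset]
      refine Set.ncard_le_ncard ?_ (Finset.finite_toSet _)
      rintro u ⟨hu1, hu⟩
      simp only [Finset.coe_filter, Set.Finite.mem_toFinset, Set.mem_ofPred_eq]
      refine ⟨⟨hb.1.trans (hu ▸ below_parent u), ?_⟩, hu⟩
      rw [height_child hu1 hu, hb.2]; omega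

/-- On the way from a vertex of the hull to a vertex outside there is a first vertex outside. -/
lemma exists_first_notMem {f : Γ → L} {δ γ : Γ} (u : Γ) (h : t.Below γ u) (hγ : γ ∈ t.hull f δ)
    (hu : u ∉ t.hull f δ) : ∃ w, w ≠ 1 ∧ t.Below w u ∧ t.Below γ (t.parent w) ∧
      w ∉ t.hull f δ ∧ t.parent w ∈ t.hull f δ := by
  obtain ⟨k, hk⟩ : ∃ k, k = t.height u := ⟨_, rfl⟩
  induction k using Nat.strong_induction_on generalizing u with
  | _ k ih =>
  have hne : γ ≠ u := by rintro rfl; exact hu hγ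
  have hb := h.parent_of_ne hne
  have hu1 : u ≠ 1 := by rintro rfl; exact hu (one_mem_hull _ _)
  by_cases hp : t.parent u ∈ t.hull f δ
  · exact ⟨u, hu1, Below.refl u, hb, hu, hp⟩
  · have := height_child (t := t) hu1 rfl
    obtain ⟨w, h1, h2, h3⟩ := ih _ (by omega) (t.parent u) hb hp rfl
    exact ⟨w, h1, h2.trans (below_parent u), h3⟩

/-- If the hull is too small to contain all descendants of `γ` at depth `k`, then there is room for
one more vertex within this depth. -/
lemma exists_twig (hq : 0 < q) {f : Γ → L} (hf : (mulSupport f).Finite) {γ : Γ}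
    (hγ : γ ∈ t.hull f 1) {k : ℕ} (hk : 0 < k) (hsmall : t.size f 1 < t.height γ + q ^ k) :
    ∃ w, w ≠ 1 ∧ t.Below γ (t.parent w) ∧ t.height w ≤ t.height γ + k ∧ w ∉ t.hull f 1 ∧
      t.parent w ∈ t.hull f 1 := by
  obtain ⟨u, ⟨hu1, hu2⟩, hu⟩ :
      ∃ u ∈ {u | t.Below γ u ∧ t.height u = t.height γ + k}, u ∉ t.hull f 1 := by
    by_contra hcon
    push Not at hcon
    refine hsmall.not_ge ?_
    rw [← ncard_below γ]
    refine (Nat.add_le_add_left (pow_le_ncard_descendants (t := t) hq γ k) _).trans ?_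
    rw [← Set.ncard_union_eq ?_ ((finite_below γ).subset Set.sdiff_subset)
      (finite_descendants hq γ k)]
    · refine Set.ncard_le_ncard ?_ ((finite_hull hf 1).subset Set.sdiff_subset)
      rintro u (⟨h1, h2⟩ | h)
      · exact ⟨mem_hull_of_below h1 hγ, h2⟩
      · refine ⟨hcon u h, ?_⟩
        exact ne_one_of_height_pos (t := t) (by rw [h.2]; omega)
    · rw [Set.disjoint_left]
      rintro u ⟨h1, -⟩ ⟨-, h2⟩
      have := Below.height_le h1
      omega
  obtain ⟨w, h1, h2, h3, h4, h5⟩ := exists_first_notMem u hu1 hγ hu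
  exact ⟨w, h1, h3, h2.height_le.trans hu2.le, h4, h5⟩

/-! ### Removing the deepest leaf -/

/-- A lamplighter at `γ` can remove the deepest leaf `l` below `γ` from the hull and return. A leaf at
distance less than `K` is reached directly. Otherwise the lamplighter moves one step towards `l`,
which makes the word one shorter; before it gets too short, a twig near `γ` is added to the hull, and
removed in the end. There is room for a twig, as a hull of about `(n + K) / 2` edges does not contain
all `q ^ (K - 1)` descendants of `γ` at depth `K - 1`. -/
lemma Linked.prune_deepest [DecidableEq Γ] (hq : 0 < q) {n K m : ℕ} (hK : 2 ≤ K)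
    (hKn : n + K + 2 ≤ 2 * q ^ (K - 1)) (hm : n + K + 2 ≤ m) {a : L} (ha : a ≠ 1) (l : Γ) (d : ℕ) :
    ∀ (γ : Γ) (f : Γ → L), d = t.height l - t.height γ → (mulSupport f).Finite →
      t.Below γ l → γ ≠ l → f l ≠ 1 → (∀ v, f v ≠ 1 → t.Below γ v → t.height v ≤ t.height l) →
      n + K + t.height γ ≤ 2 * t.size f 1 → 2 * t.size f 1 ≤ m + t.height γ →
      t.Linked n m (f, γ) (t.prune f a l, γ) := by
  induction d with
  | zero =>
    intro γ f hd _ hb hne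
    have := hb.height_lt hne
    omega
  | succ d ih =>
  intro γ f hd hf hb hne hlit hdeep hlo hhi
  have hl1 : l ≠ 1 := by rintro rfl; exact hne (below_one_iff.1 hb)
  have hlt := hb.height_lt hne
  have hpl := height_child (t := t) hl1 rfl
  have hbp := hb.parent_of_ne hne
  have hleaf : ∀ {f : Γ → L}, (∀ v, f v ≠ 1 → t.Below γ v → t.height v ≤ t.height l) →
      ∀ v, f v ≠ 1 → t.Below l v → l = v := fun h v hv hlv =>
    hlv.eq_of_height_le (h v hv (hb.trans hlv))
  by_cases hclose : t.height l < t.height γ + K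
  · have hs := size_prune hf ha hl1 hlit (hleaf hdeep)
    refine (Linked.modify (w := l) (finite_prune hf a l) hf hl1 hbp
      (mem_hull_of_lit (by rwa [prune_parent]) _) (mem_hull_of_lit hlit _)
      (fun v h1 h2 => prune_agree _ _ _ _ h1 h2) ?_ ?_ ?_ ?_).symm <;> omega
  have stepA : ∀ f : Γ → L, (mulSupport f).Finite → f l ≠ 1 →
      (∀ v, f v ≠ 1 → t.Below γ v → t.height v ≤ t.height l) →
      n + K + 1 + t.height γ ≤ 2 * t.size f 1 → 2 * t.size f 1 ≤ m + t.height γ →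
      t.Linked n m (f, γ) (t.prune f a l, γ) := by
    intro f hf hlit hdeep hlo hhi
    have hs := size_prune hf ha hl1 hlit (hleaf hdeep)
    obtain ⟨c, hc1, hcp, hcl⟩ := hb.exists_child hne
    have hc := height_child hc1 hcp
    have hγc : t.Below γ c := hcp ▸ below_parent c
    have hcne : c ≠ l := by rintro rfl; omega
    have h1 : t.Linked n m (f, γ) (f, c) :=
      Linked.walk_down hf c hγc (mem_hull_of_below hcl (mem_hull_of_lit hlit _)) (by omega) hhi
    have h2 : t.Linked n m (t.prune f a l, γ) (t.prune f a l, c) :=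
      Linked.walk_down (finite_prune hf a l) c hγc
        (mem_hull_of_below (hcl.parent_of_ne hcne) (mem_hull_of_lit (by rwa [prune_parent]) _))
        (by omega) (by omega)
    refine h1.trans (Linked.trans ?_ h2.symm)
    exact ih c f (by omega) hf hcl hcne hlit (fun v hv hcv => hdeep v hv (hγc.trans hcv))
      (by omega) (by omega)
  by_cases hlo' : n + K + 1 + t.height γ ≤ 2 * t.size f 1
  · exact stepA f hf hlit hdeep hlo' hhi
  -- Here `len f γ = n + K`: a twig is added before going further down, and removed afterwards.
  have hlhull : l ∈ t.hull f 1 := mem_hull_of_lit hlit _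
  obtain ⟨w, hw1, hγw, hwh, hwn, hwp⟩ := exists_twig (k := K - 1) hq hf
    (mem_hull_of_below hb hlhull) (by omega) (by omega)
  have hwl : w ≠ l := by rintro rfl; exact hwn hlhull
  have hwpl : w ≠ t.parent l := by
    rintro rfl; exact hwn (mem_hull_of_below (below_parent l) hlhull)
  have hs := size_prune hf ha hl1 hlit (hleaf hdeep)
  have hs1 := size_update hf ha hwn hwp
  have hf1 := finite_update hf w a
  have hins := hull_eq_insert_prune (t := t) ha hlit
  have hwn' : w ∉ t.hull (t.prune f a l) 1 := fun h => hwn (hins ▸ Or.inr h)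
  have hwh' := height_child (t := t) hw1 rfl
  have hwp' : t.parent w ∈ t.hull (t.prune f a l) 1 := by
    rw [hins] at hwp
    rcases hwp with h | h
    · rw [h] at hwh'; omega
    · exact h
  have hs2 := size_update (finite_prune hf a l) ha hwn' hwp'
  have hcomm : t.prune (update f w a) a l = update (t.prune f a l) w a := by
    rw [prune, prune, update_comm hwl, update_comm hwpl]
  have h1 : t.Linked n m (f, γ) (update f w a, γ) := by
    refine Linked.modify hf hf1 hw1 hγw hwp (mem_hull_of_lit (by simpa using ha) _)
      (fun v _ h2 => by simp [h2]) ?_ ?_ ?_ ?_ <;> omega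
  have h2 : t.Linked n m (t.prune f a l, γ) (update (t.prune f a l) w a, γ) := by
    refine Linked.modify (finite_prune hf a l) (finite_update (finite_prune hf a l) w a) hw1 hγw
      hwp' (mem_hull_of_lit (by simpa using ha) _) (fun v _ h2 => by simp [h2]) ?_ ?_ ?_ ?_ <;>
    omega
  refine h1.trans (Linked.trans ?_ h2.symm)
  rw [← hcomm]
  refine stepA _ hf1 (by simpa [hwl.symm] using hlit) (fun v hv hγv => ?_) (by omega) (by omega)
  by_cases hvw : v = w
  · subst hvw; omega
  · exact hdeep v (by simpa [hvw] using hv) hγv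

end CayleyTree

namespace CayleyTree

open Lamplighter CayleySphere Function

variable {Γ L : Type*} [Group Γ] [Group L] {S : Set Γ} {q : ℕ} {t : CayleyTree S q}

/-! ### Walking to the root -/

lemma hull_eq_of_agree {f f' : Γ → L} {γ γ' : Γ} (h : ∀ x, x ≠ γ → x ≠ γ' → f x = f' x)
    (h1 : γ' ∈ t.hull f γ) (h2 : γ ∈ t.hull f' γ') : t.hull f' γ' = t.hull f γ :=
  (hull_subset_of_agree h h1).antisymm
    (hull_subset_of_agree (fun x hx hx' => (h x hx' hx).symm) h2)

lemma exists_deepest {f : Γ → L} (hf : (mulSupport f).Finite) {P : Γ → Prop}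
    (h : ∃ v, f v ≠ 1 ∧ P v) :
    ∃ l, f l ≠ 1 ∧ P l ∧ ∀ v, f v ≠ 1 → P v → t.height v ≤ t.height l := by
  obtain ⟨l, ⟨h1, h2⟩, h3⟩ := Set.exists_max_image {v | f v ≠ 1 ∧ P v} t.height
    (hf.subset fun v hv => hv.1) h
  exact ⟨l, h1, h2, fun v hv hv' => h3 v ⟨hv, hv'⟩⟩

/-- The lamplighter can return to the root. A step to the parent makes the word longer, unless the
position is a leaf of the hull that is removed by the step. When the word must not get longer and the
position is not a leaf, a leaf further down is removed first. -/
lemma Linked.exists_root [Nontrivial L] (hq : 0 < q) {n K m : ℕ} (hK : 2 ≤ K)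
    (hKn : n + K + 2 ≤ 2 * q ^ (K - 1)) (hm : n + K + 2 ≤ m) (d : ℕ) :
    ∀ (f : Γ → L) (γ : Γ), t.height γ = d → (mulSupport f).Finite → n ≤ t.len f γ →
      t.len f γ ≤ m → ∃ f' : Γ → L, (mulSupport f').Finite ∧ t.Linked n m (f, γ) (f', 1) ∧
        n ≤ 2 * t.size f' 1 ∧ 2 * t.size f' 1 ≤ m := by
  classical
  obtain ⟨a, ha⟩ := exists_ne (1 : L)
  induction d with
  | zero =>
    intro f γ hγ hf h1 h2
    obtain rfl := (t.height_eq_zero γ).1 hγ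
    rw [len_one] at h1 h2
    exact ⟨f, hf, Linked.refl _, h1, h2⟩
  | succ d ih =>
  intro f γ hγ hf h1 h2
  have hγ1 : γ ≠ 1 := ne_one_of_height_pos (t := t) (by omega)
  obtain ⟨p, hp⟩ : ∃ p, t.parent γ = p := ⟨_, rfl⟩
  have hhp := height_child hγ1 hp
  have hpγ : t.Below p γ := hp ▸ below_parent γ
  have e := len_add_height (t := t) hf γ
  -- It is enough to move to the parent within the annulus.
  suffices h : ∃ f' : Γ → L, (mulSupport f').Finite ∧ t.Linked n m (f, γ) (f', p) ∧
      n ≤ t.len f' p ∧ t.len f' p ≤ m by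
    obtain ⟨f', hf', h1, h2, h3⟩ := h
    obtain ⟨f'', hf'', h4, h5⟩ := ih f' p (by omega) hf' h2 h3
    exact ⟨f'', hf'', h1.trans h4, h5⟩
  by_cases hlt : t.len f γ < m
  · have hf' := finite_update hf γ a
    have hag : ∀ x, x ≠ γ → x ≠ p → f x = update f γ a x := fun x hx _ => by simp [hx]
    have hsz := size_eq_of_hull_eq (hull_eq_of_agree (t := t) hag (Or.inl hpγ)
      (mem_hull_of_lit (by simpa using ha) _))
    have e' := len_add_height (t := t) hf' p
    exact ⟨_, hf', (Linked.down hγ1 hp hf' hf (by omega) (by omega) h1 h2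
      fun v h h' => (hag v h' h).symm).symm, by omega, by omega⟩
  by_cases hd : ∃ v, f v ≠ 1 ∧ t.Below γ v ∧ γ ≠ v
  · obtain ⟨l, hlit, ⟨hb, hne⟩, hdeep⟩ := exists_deepest (t := t) hf hd
    have hl1 : l ≠ 1 := hb.ne_one hγ1
    have hγh : γ ∈ t.hull f 1 := mem_hull_of_below hb (mem_hull_of_lit hlit _)
    have e' := len_add_height_of_mem hf hγh
    have hlt := hb.height_lt hne
    have hdeep' : ∀ v, f v ≠ 1 → t.Below γ v → t.height v ≤ t.height l := by
      intro v hv hγv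
      by_cases h : γ = v
      · subst h; omega
      · exact hdeep v hv ⟨hγv, h⟩
    have hs := size_prune hf ha hl1 hlit fun v hv hlv =>
      hlv.eq_of_height_le (hdeep' v hv (hb.trans hlv))
    have hγh' : γ ∈ t.hull (t.prune f a l) 1 :=
      mem_hull_of_below (hb.parent_of_ne hne) (mem_hull_of_lit (by rwa [prune_parent]) _)
    have hf' := finite_prune (t := t) hf a l
    have h3 := Linked.prune_deepest hq hK hKn hm ha l _ γ f rfl hf hb hne hlit hdeep'
      (by omega) (by omega)
    have e'' := len_add_height_of_mem hf' (mem_hull_of_below hpγ hγh')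
    exact ⟨_, hf', h3.trans (Linked.walk_down hf' γ hpγ hγh' (by omega) (by omega)).symm,
      by omega, by omega⟩
  · push Not at hd
    have hf' := finite_update hf γ (1 : L)
    have hag : ∀ x, x ≠ p → x ≠ γ → update f γ 1 x = f x := fun x _ hx => by simp [hx]
    have hs := size_erase_leaf hf' hγ1 hp hd (by simp) hag
    have e' := len_add_height (t := t) hf' p
    exact ⟨_, hf', (Linked.down hγ1 hp hf' hf (by omega) (by omega) h1 h2 hag).symm,
      by omega, by omega⟩

/-! ### A common normal form -/

lemma exists_lit_of_size_pos {f : Γ → L} (hf : (mulSupport f).Finite) (h : 0 < t.size f 1) :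
    ∃ v, f v ≠ 1 ∧ v ≠ 1 := by
  rw [size, Set.ncard_pos ((finite_hull hf 1).subset Set.sdiff_subset)] at h
  obtain ⟨u, hu | ⟨v, hv, hu⟩, hu1⟩ := h
  · exact absurd (below_one_iff.1 hu) hu1
  · exact ⟨v, hv, hu.ne_one hu1⟩

/-- From the root, leaves can be removed until the hull has `E` edges. -/
lemma Linked.exists_smaller [Nontrivial L] (hq : 0 < q) {n K m E : ℕ} (hK : 2 ≤ K)
    (hKn : n + K + 2 ≤ 2 * q ^ (K - 1)) (hm : n + K + 2 ≤ m) (hE : n + K ≤ 2 * E) (k : ℕ) :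
    ∀ f : Γ → L, (mulSupport f).Finite → t.size f 1 = E + k → 2 * t.size f 1 ≤ m →
      ∃ f' : Γ → L, (mulSupport f').Finite ∧ t.Linked n m (f, 1) (f', 1) ∧ t.size f' 1 = E := by
  classical
  obtain ⟨a, ha⟩ := exists_ne (1 : L)
  induction k with
  | zero => intro f hf h _; exact ⟨f, hf, Linked.refl _, h⟩
  | succ k ih =>
    intro f hf hs hm'
    obtain ⟨l, hlit, hl1, hdeep⟩ := exists_deepest (t := t) hf
      (exists_lit_of_size_pos (t := t) hf (by omega))
    have hdeep' : ∀ v, f v ≠ 1 → t.height v ≤ t.height l := by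
      intro v hv
      by_cases h : v = 1
      · rw [h, height_one]; omega
      · exact hdeep v hv h
    have hs' := size_prune hf ha hl1 hlit fun v hv hlv => hlv.eq_of_height_le (hdeep' v hv)
    have h1 := Linked.prune_deepest hq hK hKn hm ha l _ 1 f rfl hf (one_below l) hl1.symm hlit
      (fun v hv _ => hdeep' v hv) (by rw [height_one]; omega) (by rw [height_one]; omega)
    obtain ⟨f', h2, h3, h4⟩ := ih (t.prune f a l) (finite_prune hf a l) (by omega) (by omega)
    exact ⟨f', h2, h1.trans h3, h4⟩

/-- From the root, edges can be added until the hull has `E` edges: elements in an infinite component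
have a vertex outside the hull within reach. -/
lemma Linked.exists_larger [Nontrivial L] [Finite L] (hq : 0 < q) {n r E : ℕ} (hn : 1 ≤ n)
    (hE : 2 * E ≤ n + r) (k : ℕ) :
    ∀ (f : Γ → L) (hf : (mulSupport f).Finite), t.size f 1 + k = E →
      state f 1 hf ∈ annulusInf (switchWalkSwitch L S) n r → n ≤ 2 * t.size f 1 →
      ∃ f' : Γ → L, (mulSupport f').Finite ∧ t.Linked n (n + r) (f, 1) (f', 1) ∧
        t.size f' 1 = E := by
  classical
  obtain ⟨a, ha⟩ := exists_ne (1 : L)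
  induction k with
  | zero => intro f hf h _ _; exact ⟨f, hf, Linked.refl _, h⟩
  | succ k ih =>
    intro f hf hs hmem hnf
    obtain ⟨v, hv, hvn⟩ := exists_notMem_hull_of_mem_ballComplInf (t := t) hq hmem.2
      (by simp only [lamps_state, pos_state]; omega)
    simp only [lamps_state, pos_state] at hv hvn
    obtain ⟨w, hw1, hwv, hγw, hwn, hwp⟩ := exists_first_notMem v (one_below v)
      (one_mem_hull _ _) hvn
    have := hwv.height_le
    have hs' := size_update hf ha hwn hwp
    have h1 : t.Linked n (n + r) (f, 1) (update f w a, 1) := by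
      refine Linked.modify hf (finite_update hf w a) hw1 hγw hwp
        (mem_hull_of_lit (by simpa using ha) _) (fun v _ h2 => by simp [h2]) ?_ ?_ ?_ ?_ <;>
      omega
    obtain ⟨h2, h3, -⟩ := h1.exists_reachable hn hf hmem
    obtain ⟨f', h4, h5, h6⟩ := ih (update f w a) h2 (by omega) h3 (by omega)
    exact ⟨f', h4, h1.trans h5, h6⟩

/-- Hulls with a given number of edges can be realized within a small ball. -/
lemma exists_shallow [Nontrivial L] (hq : 0 < q) {k : ℕ} (hk : 0 < k) (E : ℕ) (hE : E ≤ q ^ k) :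
    ∃ f : Γ → L, (mulSupport f).Finite ∧ (∀ v ∈ t.hull f 1, t.height v ≤ k) ∧
      t.size f 1 = E := by
  classical
  obtain ⟨a, ha⟩ := exists_ne (1 : L)
  induction E with
  | zero =>
    refine ⟨1, by simp, ?_, size_one⟩
    rintro v (hv | ⟨u, hu, -⟩)
    · rw [below_one_iff.1 hv, height_one]; omega
    · simp at hu
  | succ E ih =>
    obtain ⟨f, hf, hh, hs⟩ := ih (by omega)
    obtain ⟨w, hw1, hγw, hwh, hwn, hwp⟩ := exists_twig hq hf (one_mem_hull (t := t) f 1) hk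
      (by omega)
    refine ⟨_, finite_update hf w a, ?_, by rw [size_update hf ha hwn hwp, hs]⟩
    rw [hull_update ha hwn hwp]
    rintro v (rfl | hv)
    · rw [height_one] at hwh; omega
    · exact hh v hv

/-- Two hulls of the same size: a leaf outside the shallow hull of `g` can be exchanged for a vertex
of the hull of `g`. -/
lemma Linked.exists_exchange [Nontrivial L] (hq : 0 < q) {n K m : ℕ} (hK : 2 ≤ K)
    (hKn : n + K + 2 ≤ 2 * q ^ (K - 1)) {f g : Γ → L} (hf : (mulSupport f).Finite)
    (hg : (mulSupport g).Finite) (hgh : ∀ v ∈ t.hull g 1, t.height v ≤ K - 1)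
    (hfg : t.size f 1 = t.size g 1) (hlo : n + K ≤ 2 * t.size f 1)
    (hhi : 2 * t.size f 1 + 2 ≤ m) (hne : t.hull f 1 ≠ t.hull g 1) :
    ∃ f' : Γ → L, (mulSupport f').Finite ∧ t.Linked n m (f, 1) (f', 1) ∧
      t.size f' 1 = t.size f 1 ∧
      (t.hull f' 1 \ t.hull g 1).ncard < (t.hull f 1 \ t.hull g 1).ncard := by
  classical
  obtain ⟨a, ha⟩ := exists_ne (1 : L)
  have hsize : ∀ {f : Γ → L}, (mulSupport f).Finite → (t.hull f 1).ncard = t.size f 1 + 1 := by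
    intro f hf
    rw [size, Set.ncard_sdiff_singleton_add_one (one_mem_hull _ _) (finite_hull hf 1)]
  have hnsub : ¬ t.hull g 1 ⊆ t.hull f 1 := fun h => hne
    (Set.eq_of_subset_of_ncard_le h (by rw [hsize hf, hsize hg, hfg]) (finite_hull hf 1)).symm
  have hnsub' : ¬ t.hull f 1 ⊆ t.hull g 1 := fun h => hne
    (Set.eq_of_subset_of_ncard_le h (by rw [hsize hf, hsize hg, hfg]) (finite_hull hg 1))
  obtain ⟨u, hug, huf⟩ := Set.not_subset.1 hnsub
  obtain ⟨w, hw1, hwu, hγw, hwn, hwp⟩ := exists_first_notMem u (one_below u)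
    (one_mem_hull _ _) huf
  have hwg : w ∈ t.hull g 1 := mem_hull_of_below hwu hug
  have hwh := hgh w hwg
  have hf₁ := finite_update hf w a
  have hins₁ := hull_update ha hwn hwp
  have hs₁ := size_update hf ha hwn hwp
  set f₁ := update f w a with hf₁def
  have hadd : t.Linked n m (f, 1) (f₁, 1) := by
    refine Linked.modify hf hf₁ hw1 hγw hwp
      (mem_hull_of_lit (by simpa [hf₁def] using ha) _) (fun v _ h2 => by simp [hf₁def, h2])
      ?_ ?_ ?_ ?_ <;> omega
  have hlit₁ : ∀ v, f₁ v ≠ 1 → f v ≠ 1 ∨ v = w := by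
    intro v hv
    by_cases h : v = w
    · exact Or.inr h
    · exact Or.inl (by simpa [hf₁def, h] using hv)
  obtain ⟨l, hlg, hlit, hleaf, hlinked⟩ : ∃ l, l ∉ t.hull g 1 ∧ f₁ l ≠ 1 ∧
      (∀ v, f₁ v ≠ 1 → t.Below l v → l = v) ∧
      t.Linked n m (f₁, 1) (t.prune f₁ a l, 1) := by
    by_cases hdeep : ∃ v, f₁ v ≠ 1 ∧ K ≤ t.height v
    · -- A deepest leaf of large height is removed.
      obtain ⟨l, hlit, hlK, hmax⟩ := exists_deepest (t := t) hf₁ hdeep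
      have hmax' : ∀ v, f₁ v ≠ 1 → t.height v ≤ t.height l := by
        intro v hv
        by_cases h : K ≤ t.height v
        · exact hmax v hv h
        · omega
      have hl1 : l ≠ 1 := ne_one_of_height_pos (t := t) (by omega)
      refine ⟨l, fun h => ?_, hlit, fun v hv hlv => hlv.eq_of_height_le (hmax' v hv), ?_⟩
      · have := hgh l h; omega
      · exact Linked.prune_deepest hq hK hKn (by omega) ha l _ 1 f₁ rfl hf₁ (one_below l) hl1.symm
          hlit (fun v hv _ => hmax' v hv) (by rw [height_one]; omega) (by rw [height_one]; omega)
    · -- All leaves are within reach, and a leaf outside the hull of `g` is removed.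
      push Not at hdeep
      obtain ⟨l, ⟨hlf, hlg⟩, hmax⟩ := Set.exists_max_image (t.hull f 1 \ t.hull g 1) t.height
        ((finite_hull hf 1).subset Set.sdiff_subset) (Set.not_subset.1 hnsub')
      have hl1 : l ≠ 1 := by rintro rfl; exact hlg (one_mem_hull _ _)
      have hleaf : ∀ v, f₁ v ≠ 1 → t.Below l v → l = v := by
        intro v hv hlv
        have hvg : v ∉ t.hull g 1 := fun h => hlg (mem_hull_of_below hlv h)
        rcases hlit₁ v hv with h | rfl
        · exact hlv.eq_of_height_le (hmax v ⟨mem_hull_of_lit h _, hvg⟩)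
        · exact absurd hwg hvg
      have hlit : f₁ l ≠ 1 := by
        have : l ∈ t.hull f₁ 1 := by rw [hins₁]; exact Or.inr hlf
        rcases this with h | ⟨v, hv, h⟩
        · exact absurd (below_one_iff.1 h) hl1
        · rwa [hleaf v hv h]
      have hlh := hdeep l hlit
      have hs := size_prune hf₁ ha hl1 hlit hleaf
      refine ⟨l, hlg, hlit, hleaf, (Linked.modify (w := l) (finite_prune hf₁ a l) hf₁ hl1
        (one_below _) (mem_hull_of_lit (by rwa [prune_parent]) _) (mem_hull_of_lit hlit _)
        (fun v h1 h2 => prune_agree _ _ _ _ h1 h2) ?_ ?_ ?_ ?_).symm⟩ <;> omega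
  have hl1 : l ≠ 1 := by rintro rfl; exact hlg (one_mem_hull _ _)
  have hs := size_prune hf₁ ha hl1 hlit hleaf
  have hins := hull_eq_insert_prune (t := t) ha hlit
  have hnot := notMem_hull_prune (a := a) hl1 hleaf
  have hlw : l ≠ w := by rintro rfl; exact hlg hwg
  refine ⟨t.prune f₁ a l, finite_prune hf₁ a l, hadd.trans hlinked, by omega,
    Set.ncard_lt_ncard ?_ ((finite_hull hf 1).subset Set.sdiff_subset)⟩
  rw [Set.ssubset_iff_of_subset]
  · refine ⟨l, ⟨?_, hlg⟩, fun h => hnot h.1⟩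
    have : l ∈ t.hull f₁ 1 := mem_hull_of_lit hlit _
    rw [hins₁] at this
    exact this.resolve_left hlw
  · rintro v ⟨hv, hvg⟩
    refine ⟨?_, hvg⟩
    have : v ∈ t.hull f₁ 1 := by rw [hins]; exact Or.inr hv
    rw [hins₁] at this
    exact this.resolve_left (by rintro rfl; exact hvg hwg)

/-- By exchanging leaves, the hull becomes equal to a given shallow hull of the same size. -/
lemma Linked.exists_hull_eq [Nontrivial L] (hq : 0 < q) {n K m : ℕ} (hK : 2 ≤ K)
    (hKn : n + K + 2 ≤ 2 * q ^ (K - 1)) {g : Γ → L}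
    (hg : (mulSupport g).Finite) (hgh : ∀ v ∈ t.hull g 1, t.height v ≤ K - 1)
    (hlo : n + K ≤ 2 * t.size g 1) (hhi : 2 * t.size g 1 + 2 ≤ m) (k : ℕ) :
    ∀ f : Γ → L, (mulSupport f).Finite → t.size f 1 = t.size g 1 →
      (t.hull f 1 \ t.hull g 1).ncard = k →
      ∃ f' : Γ → L, (mulSupport f').Finite ∧ t.Linked n m (f, 1) (f', 1) ∧
        t.hull f' 1 = t.hull g 1 := by
  induction k using Nat.strong_induction_on with
  | _ k ih =>
  intro f hf hs hk
  by_cases hne : t.hull f 1 = t.hull g 1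
  · exact ⟨f, hf, Linked.refl _, hne⟩
  obtain ⟨f₁, hf₁, h1, h2, h3⟩ := Linked.exists_exchange (m := m) hq hK hKn hf hg hgh hs
    (by omega) (by omega) hne
  obtain ⟨f₂, hf₂, h4, h5⟩ := ih _ (hk ▸ h3) f₁ hf₁ (h2.trans hs) rfl
  exact ⟨f₂, hf₂, h1.trans h4, h5⟩

/-- Within a shallow hull all lamps can be changed. -/
lemma Linked.of_hull_eq [Nontrivial L] {n K m : ℕ} {f g : Γ → L}
    (hf : (mulSupport f).Finite) (hg : (mulSupport g).Finite)
    (hgl : ∀ v ∈ t.hull g 1, v ≠ 1 → g v ≠ 1)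
    (hgh : ∀ v ∈ t.hull g 1, t.height v ≤ K)
    (hlo : n + K ≤ 2 * t.size g 1) (hhi : 2 * t.size g 1 ≤ m) (hpos : 0 < t.size g 1)
    (hfg : t.hull f 1 = t.hull g 1) : t.Linked n m (f, 1) (g, 1) := by
  classical
  obtain ⟨k, hk⟩ : ∃ k, k = {v | v ∈ t.hull g 1 ∧ f v ≠ g v}.ncard := ⟨_, rfl⟩
  induction k using Nat.strong_induction_on generalizing f with
  | _ k ih =>
  by_cases hne : ∃ v, f v ≠ g v
  swap
  · push Not at hne
    rw [funext hne]; exact Linked.refl _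
  obtain ⟨v, hv⟩ := hne
  have hvg : v ∈ t.hull g 1 := by
    by_contra h
    have h1 : g v = 1 := by by_contra h'; exact h (mem_hull_of_lit h' _)
    have h2 : f v = 1 := by by_contra h'; exact h (hfg ▸ mem_hull_of_lit h' _)
    exact hv (h2.trans h1.symm)
  obtain ⟨w, hw1, hwg, hvw⟩ : ∃ w, w ≠ 1 ∧ w ∈ t.hull g 1 ∧ (v = w ∨ v = t.parent w) := by
    by_cases hv1 : v = 1
    · obtain ⟨u, hu, hu1⟩ := exists_lit_of_size_pos hg hpos
      obtain ⟨c, hc1, hcp, hcu⟩ := (one_below (t := t) u).exists_child hu1.symm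
      exact ⟨c, hc1, mem_hull_of_below hcu (mem_hull_of_lit hu _), Or.inr (hv1.trans hcp.symm)⟩
    · exact ⟨v, hv1, hvg, Or.inl rfl⟩
  have hfin := finite_update hf v (g v)
  have hhull : t.hull (update f v (g v)) 1 = t.hull g 1 := by
    apply Set.Subset.antisymm
    · refine hull_subset (one_mem_hull _ _) fun u hu => ?_
      by_cases h : u = v
      · exact h ▸ hvg
      · exact hfg ▸ mem_hull_of_lit (by simpa [h] using hu) _
    · rw [← hfg]
      refine hull_subset (one_mem_hull _ _) fun u hu => ?_
      by_cases h : u = v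
      · by_cases hv1 : v = 1
        · rw [h, hv1]; exact one_mem_hull _ _
        · exact mem_hull_of_lit (by rw [h]; simpa using hgl v hvg hv1) _
      · exact mem_hull_of_lit (by simpa [h] using hu) _
  have e1 := size_eq_of_hull_eq hfg
  have e2 := size_eq_of_hull_eq hhull
  have hwh := hgh w hwg
  refine Linked.trans ?_ (ih _ ?_ hfin hhull rfl)
  · refine Linked.modify hf hfin hw1 (one_below _) (hfg ▸ mem_hull_of_below (below_parent w) hwg)
      (hhull ▸ hwg) (fun u h1 h2 => ?_) ?_ ?_ ?_ ?_
    · have : u ≠ v := by rcases hvw with rfl | rfl <;> assumption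
      simp [this]
    all_goals omega
  · rw [hk]
    refine Set.ncard_lt_ncard ?_ ((finite_hull hg 1).subset fun u hu => hu.1)
    rw [Set.ssubset_iff_of_subset]
    · exact ⟨v, ⟨hvg, hv⟩, fun h => h.2 (by simp)⟩
    · rintro u ⟨hu, hu'⟩
      refine ⟨hu, ?_⟩
      by_cases h : u = v
      · subst h; exact hv
      · simpa [h] using hu'

/-- Lighting all lamps of the hull of `f`, except at the root. -/
lemma exists_lit_hull [Nontrivial L] {f : Γ → L} (hf : (mulSupport f).Finite) :
    ∃ g : Γ → L, (mulSupport g).Finite ∧ t.hull g 1 = t.hull f 1 ∧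
      ∀ v ∈ t.hull f 1, v ≠ 1 → g v ≠ 1 := by
  classical
  obtain ⟨a, ha⟩ := exists_ne (1 : L)
  have hg : ∀ v, (if v ∈ t.hull f 1 ∧ v ≠ 1 then a else 1) ≠ 1 ↔ v ∈ t.hull f 1 ∧ v ≠ 1 := by
    intro v; split_ifs with h <;> simp [h, ha]
  refine ⟨fun v => if v ∈ t.hull f 1 ∧ v ≠ 1 then a else 1,
    (finite_hull (t := t) hf 1).subset fun v hv => ((hg v).1 hv).1, ?_,
    fun v hv hv1 => (hg v).2 ⟨hv, hv1⟩⟩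
  apply Set.Subset.antisymm
  · exact hull_subset (one_mem_hull _ _) fun v hv => ((hg v).1 hv).1
  · intro v hv
    by_cases h : v = 1
    · rw [h]; exact one_mem_hull _ _
    · exact Or.inr ⟨v, (hg v).2 ⟨hv, h⟩, Below.refl v⟩

/-! ### Connectedness of thick annuli -/

/-- Annuli of logarithmic thickness are connected. -/
theorem connected_annulusGraph [Nontrivial L] [Finite L] (t : CayleyTree S q) (hq : 0 < q)
    {n K r : ℕ} (hn : 1 ≤ n) (hK : 2 ≤ K) (hKn : n + K + 2 ≤ 2 * q ^ (K - 1))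
    (hr : K + 3 ≤ r) : (annulusGraph (switchWalkSwitch L S) n r).Connected := by
  obtain ⟨E, hE1, hE2⟩ : ∃ E, n + K ≤ 2 * E ∧ 2 * E ≤ n + K + 1 :=
    ⟨(n + K + 1) / 2, by omega, by omega⟩
  obtain ⟨g₀, hg₀, hg₀h, hg₀s⟩ := exists_shallow (t := t) (L := L) hq (k := K - 1) (by omega) E
    (by omega)
  obtain ⟨g, hg, hgh, hgl⟩ := exists_lit_hull (t := t) hg₀
  rw [← hgh] at hg₀h hgl
  have hgs : t.size g 1 = E := (size_eq_of_hull_eq hgh).trans hg₀s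
  -- Every element with a non-empty hull is connected to the normal form `g`.
  have key : ∀ (x : annulusInf (switchWalkSwitch L S) n r),
      t.size (lamps x.1) (pos x.1) ≠ 0 →
      ∃ hy : state g 1 hg ∈ annulusInf (switchWalkSwitch L S) n r,
        (annulusGraph (switchWalkSwitch L S) n r).Reachable x ⟨_, hy⟩ := by
    intro x hx0
    have hd := dist_eq_len hx0
    have hx1 : n ≤ t.len (lamps x.1) (pos x.1) := hd ▸ x.2.2.1
    have hx2 : t.len (lamps x.1) (pos x.1) ≤ n + r := hd ▸ x.2.1
    obtain ⟨f₁, hf₁, h1, h2, h3⟩ := Linked.exists_root (m := n + r) hq hK hKn (by omega) _ _ _ rfl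
      x.1.finite_lamps hx1 hx2
    obtain ⟨hf₁', hmem, -⟩ := h1.exists_reachable hn x.1.finite_lamps x.2
    obtain ⟨f₂, hf₂, h4, h5⟩ : ∃ f₂ : Γ → L, (mulSupport f₂).Finite ∧
        t.Linked n (n + r) (f₁, 1) (f₂, 1) ∧ t.size f₂ 1 = E := by
      rcases le_total E (t.size f₁ 1) with h | h
      · obtain ⟨k, hk⟩ := Nat.exists_eq_add_of_le h
        exact Linked.exists_smaller hq hK hKn (by omega) hE1 k f₁ hf₁ hk h3
      · obtain ⟨k, hk⟩ := Nat.exists_eq_add_of_le h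
        exact Linked.exists_larger hq hn (by omega) k f₁ hf₁ hk.symm hmem h2
    obtain ⟨f₃, hf₃, h6, h7⟩ := Linked.exists_hull_eq (m := n + r) hq hK hKn hg hg₀h (by omega)
      (by omega) _ f₂ hf₂ (h5.trans hgs.symm) rfl
    have h8 : t.Linked n (n + r) (f₃, 1) (g, 1) :=
      Linked.of_hull_eq (K := K - 1) hf₃ hg hgl hg₀h (by omega) (by omega) (by omega) h7
    obtain ⟨_, hy, hreach⟩ := (h1.trans (h4.trans (h6.trans h8))).exists_reachable hn
      x.1.finite_lamps x.2
    exact ⟨hy, hreach⟩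
  have key' : ∀ (x : annulusInf (switchWalkSwitch L S) n r),
      ∃ hy : state g 1 hg ∈ annulusInf (switchWalkSwitch L S) n r,
        (annulusGraph (switchWalkSwitch L S) n r).Reachable x ⟨_, hy⟩ := by
    intro x
    by_cases hx0 : t.size (lamps x.1) (pos x.1) = 0
    · -- An element with an empty hull has distance at most `2`, and first leaves the root.
      have hn1 : n = 1 := by
        by_contra h
        exact size_ne_zero_of_mem_ballComplInf t (by omega) x.2.2 hx0
      obtain ⟨hp, -⟩ := size_eq_zero x.1.finite_lamps hx0
      obtain ⟨c, hc1, hcp⟩ := exists_child (t := t) hq 1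
      have hcs : t.size (lamps x.1) c ≠ 0 :=
        (size_pos_of_mem x.1.finite_lamps (mem_hull_pos _ c) hc1).ne'
      let y : Lamplighter Γ L := state (lamps x.1) c x.1.finite_lamps
      have hadj : (SimpleGraph.mulCayley (switchWalkSwitch L S)).Adj x.1 y :=
        Lamplighter.adj_iff.2 ⟨fun h => hc1 ((congrArg pos h).symm.trans hp),
          Or.inl ((t.adj_iff _ _).2 (Or.inl ⟨hc1, hcp.trans hp.symm⟩)), fun _ _ _ => rfl⟩
      have hd : (SimpleGraph.mulCayley (switchWalkSwitch L S)).dist 1 y = t.len (lamps y) (pos y) :=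
        dist_eq_len hcs
      have h1 := len_le_of_adj (t := t) hadj
      have h2 : t.len (lamps x.1) (pos x.1) = 0 := by simp [len, hx0]
      have h3 : t.size (lamps y) (pos y) ≤ t.len (lamps y) (pos y) := size_le_len y.finite_lamps _
      have h4 : 0 < t.size (lamps y) (pos y) := Nat.pos_of_ne_zero hcs
      have hy : y ∈ annulusInf (switchWalkSwitch L S) n r := by
        refine ⟨?_, mem_ballComplInf_of_adj x.2.2 hadj ?_⟩
        · simp only [Set.mem_ofPred_eq]; omega
        · simp only [ballCompl, Set.mem_ofPred_eq]; omega
      obtain ⟨hz, hreach⟩ := key ⟨y, hy⟩ hcs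
      have hadj' : (annulusGraph (switchWalkSwitch L S) n r).Adj x ⟨y, hy⟩ := hadj
      exact ⟨hz, hadj'.reachable.trans hreach⟩
    · exact key x hx0
  obtain ⟨u, -, hu⟩ := exists_descendant (t := t) hq 1 n
  have hul : t.len (1 : Γ → L) u = n := by
    have h := len_add_height (t := t) (f := (1 : Γ → L)) (by simp) u
    have : t.size (1 : Γ → L) u = t.height u := by
      rw [← ncard_below u, size]
      congr 2
      ext v
      simp [hull]
    rw [height_one] at hu
    omega
  have hne : t.size (1 : Γ → L) u ≠ 0 := size_ne_zero_of_len_pos (by omega)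
  have hu0 : state (1 : Γ → L) u (by simp) ∈ annulusInf (switchWalkSwitch L S) n r := by
    refine ⟨?_, mem_ballComplInf_of_leaf t hq (by simpa using hul.ge) (by simp)⟩
    simp only [Set.mem_ofPred_eq]
    rw [dist_eq_len (t := t) (by simpa using hne)]
    simp only [lamps_state, pos_state]
    omega
  have : Nonempty (annulusInf (switchWalkSwitch L S) n r) := ⟨⟨_, hu0⟩⟩
  refine SimpleGraph.Connected.mk fun x y => ?_
  obtain ⟨hx, hx'⟩ := key' x
  obtain ⟨hy, hy'⟩ := key' y
  exact hx'.trans hy'.symm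

end CayleyTree

namespace CayleyTree

open Lamplighter CayleySphere Function

variable {Γ L : Type*} [Group Γ] [Group L] {S : Set Γ} {q : ℕ} {t : CayleyTree S q}

/-! ### Disconnected annuli over branching trees -/

/-- The number of vertices of a given height, which bounds the hull of the barrier below. -/
lemma ncard_height_eq_le (hq : 0 < q) (k : ℕ) :
    {v | t.height v = k + 1}.ncard ≤ (q + 1) * q ^ k := by
  classical
  have hfin : ∀ k, {v | t.height v = k}.Finite := fun k =>
    (finite_height_le (t := t) hq k).subset fun _ h => le_of_eq h
  induction k with
  | zero =>
    rw [pow_zero, mul_one, ← t.ncard_children_one]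
    refine Set.ncard_le_ncard (fun v hv => ?_) (finite_children hq 1)
    simp only [Set.mem_ofPred_eq, zero_add] at hv
    refine ⟨ne_one_of_height_pos (t := t) (by omega), (t.height_eq_zero _).1 ?_⟩
    rw [height_parent, hv]
  | succ k ih =>
    rw [pow_succ', ← mul_assoc, mul_comm (q + 1) q, mul_assoc]
    refine le_trans ?_ (Nat.mul_le_mul_left q ih)
    rw [Set.ncard_eq_toFinset_card _ (hfin (k + 1)), Set.ncard_eq_toFinset_card _ (hfin (k + 1 + 1))]
    refine Finset.card_le_mul_card_image_of_maps_to (f := t.parent) ?_ q ?_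
    · intro u hu
      simp only [Set.Finite.mem_toFinset, Set.mem_ofPred_eq] at hu ⊢
      rw [height_parent]; omega
    · intro b hb
      simp only [Set.Finite.mem_toFinset, Set.mem_ofPred_eq] at hb
      have hb1 : b ≠ 1 := ne_one_of_height_pos (t := t) (by omega)
      rw [← Set.ncard_coe_finset]
      refine (Set.ncard_le_ncard ?_ (finite_children hq b)).trans (t.ncard_children b hb1).le
      intro u hu
      simp only [Finset.coe_filter, Set.Finite.mem_toFinset, Set.mem_ofPred_eq] at hu
      exact ⟨ne_one_of_height_pos (t := t) (by omega), hu.2⟩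

lemma ncard_height_le_le (hq : 2 ≤ q) (k : ℕ) : {v | t.height v ≤ k}.ncard ≤ q ^ (k + 2) := by
  induction k with
  | zero =>
    have : {v | t.height v ≤ 0} = {1} := by
      ext v; simp [t.height_eq_zero]
    rw [this, Set.ncard_singleton]
    exact Nat.one_le_pow _ _ (by omega)
  | succ k ih =>
    have : {v | t.height v ≤ k + 1} = {v | t.height v ≤ k} ∪ {v | t.height v = k + 1} := by
      ext v; simp only [Set.mem_ofPred_eq, Set.mem_union]; omega
    rw [this]
    refine (Set.ncard_union_le _ _).trans ?_
    have h1 := ncard_height_eq_le (t := t) (by omega) k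
    have h2 : (q + 1) * q ^ k ≤ q ^ (k + 2) := by
      rw [pow_add, mul_comm]
      exact Nat.mul_le_mul_left _ (by nlinarith)
    have h3 : 2 * q ^ (k + 2) ≤ q ^ (k + 1 + 2) := by
      rw [show k + 1 + 2 = (k + 2) + 1 by ring, pow_succ' q (k + 2)]
      exact Nat.mul_le_mul_right _ hq
    omega

/-- If no lamp in the branch of `x` is lit and the lamplighter is in this branch, then the hull is
the union of the hull of the lamps and of a path to the lamplighter. -/
lemma size_of_branch {f : Γ → L} (hf : (mulSupport f).Finite) {x u : Γ} (hx1 : x ≠ 1)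
    (hx : t.parent x = 1)
    (hlit : ∀ v, f v ≠ 1 → ¬ t.Below x v) (hu : t.Below x u) :
    t.size f u = t.size f 1 + t.height u := by
  rw [← ncard_below u, size, size, ← Set.ncard_union_eq ?_
    ((finite_hull hf 1).subset Set.sdiff_subset) ((finite_below u).subset Set.sdiff_subset)]
  · congr 1
    ext v
    simp only [hull, Set.mem_sdiff, Set.mem_ofPred_eq, Set.mem_singleton_iff, Set.mem_union,
      below_one_iff]
    by_cases h : v = 1 <;> simp [h, or_comm]
  · rw [Set.disjoint_left]
    rintro v ⟨h1 | ⟨w, hw, hvw⟩, h2⟩ ⟨h3, -⟩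
    · exact h2 (below_one_iff.1 h1)
    · refine hlit w hw (Below.trans ?_ hvw)
      refine hu.below_of_height_le h3 ?_
      have := height_child hx1 hx
      rw [height_one] at this
      have := height_pos (t := t) h2
      omega

/-- The base of a component of the annulus: the lamps at height `D` outside the branch of `x` are
lit, as well as the lamps in the set `A`. -/
noncomputable def barrierLamps (t : CayleyTree S q) (a : L) (x : Γ) (D : ℕ) (A : Set Γ) : Γ → L :=
  open scoped Classical in
  fun v => if (t.height v = D ∧ ¬ t.Below x v) ∨ v ∈ A then a else 1

/-- As long as the thickness is less than `D`, a lamplighter who starts in the branch of `x` can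
leave this branch only with a hull of size less than `(n + D) / 2`, which is too small for reaching
the lit lamps at height `D` outside the branch. -/
theorem two_pow_le_numComponents [Nontrivial L] [Finite L] (t : CayleyTree S q) (hq : 2 ≤ q)
    {n r D : ℕ} (hD : r < D) (hn : q ^ (D + 5) ≤ n) :
    2 ^ q ^ D ≤ numComponents (switchWalkSwitch L S) n r := by
  have hq0 : 0 < q := by omega
  obtain ⟨a, ha⟩ := exists_ne (1 : L)
  obtain ⟨x, ⟨hx1, hx⟩, y, ⟨hy1, hy⟩, hxy⟩ :
      ∃ x ∈ {u | u ≠ 1 ∧ t.parent u = 1}, ∃ y ∈ {u | u ≠ 1 ∧ t.parent u = 1}, x ≠ y := by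
    rw [← Set.one_lt_ncard (finite_children hq0 1), t.ncard_children_one]
    omega
  have hhx := height_child hx1 hx
  have hhy := height_child hy1 hy
  rw [height_one] at hhx hhy
  -- The branches of `x` and `y` are disjoint.
  have hdisj : ∀ v, t.Below y v → ¬ t.Below x v := fun v h1 h2 =>
    hxy ((h2.below_of_height_le h1 (by omega)).eq_of_height_le (by omega))
  let U : Set Γ := {u | t.Below y u ∧ t.height u = t.height y + D}
  have hUfin : U.Finite := finite_descendants hq0 y D
  have hUh : ∀ u ∈ U, t.height u = D + 1 := fun u hu => by rw [hu.2]; omega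
  let f : Set U → Γ → L := fun A => barrierLamps t a x D (Subtype.val '' A)
  have hf_lit : ∀ A v, f A v ≠ 1 ↔ (t.height v = D ∧ ¬ t.Below x v) ∨ v ∈ Subtype.val '' A := by
    intro A v
    simp only [f, barrierLamps, ne_eq, ite_eq_right_iff, ha, imp_false, not_not]
  have hAU : ∀ (A : Set U) v, v ∈ Subtype.val '' A → v ∈ U := by
    rintro A _ ⟨u, -, rfl⟩; exact u.2
  have hf_height : ∀ A v, f A v ≠ 1 → t.height v ≤ D + 1 := by
    intro A v hv
    rcases (hf_lit A v).1 hv with h | h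
    · omega
    · exact (hUh v (hAU A v h)).le
  have hf_branch : ∀ A v, f A v ≠ 1 → ¬ t.Below x v := by
    intro A v hv
    rcases (hf_lit A v).1 hv with h | h
    · exact h.2
    · exact hdisj v (hAU A v h).1
  have hf_fin : ∀ A, (mulSupport (f A)).Finite := fun A =>
    (finite_height_le (t := t) hq0 (D + 1)).subset fun v hv => hf_height A v hv
  have hW : ∀ A, 2 * t.size (f A) 1 + 1 ≤ n := by
    intro A
    have h1 : t.size (f A) 1 ≤ q ^ (D + 3) := by
      refine le_trans (Set.ncard_le_ncard ?_ (finite_height_le hq0 (D + 1)))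
        (ncard_height_le_le (t := t) hq (D + 1))
      rintro v ⟨hv | ⟨w, hw, hv⟩, -⟩
      · rw [below_one_iff.1 hv]; simp [height_one]
      · exact hv.height_le.trans (hf_height A w hw)
    have h2 : q ^ (D + 5) = q * q * q ^ (D + 3) := by ring
    have h3 : 1 ≤ q ^ (D + 3) := Nat.one_le_pow _ _ hq0
    have h4 := Nat.mul_le_mul_right (q ^ (D + 3)) (Nat.mul_le_mul hq hq)
    omega
  choose u hxu huh using fun A => exists_descendant (t := t) hq0 x (n - 2 * t.size (f A) 1 - 1)
  have hlen : ∀ A, t.len (f A) (u A) = n := by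
    intro A
    have h1 := size_of_branch (hf_fin A) hx1 hx (hf_branch A) (hxu A)
    have h2 := len_add_height (t := t) (hf_fin A) (u A)
    have h3 := huh A
    have h4 := hW A
    omega
  have hn1 : 1 ≤ n := (Nat.one_le_pow _ _ hq0).trans hn
  let g : Set U → Lamplighter Γ L := fun A => state (f A) (u A) (hf_fin A)
  have hg : ∀ A, g A ∈ annulusInf (switchWalkSwitch L S) n r := by
    intro A
    have hl : t.len (lamps (g A)) (pos (g A)) = n := hlen A
    refine ⟨?_, mem_ballComplInf_of_leaf t hq0 hl.ge fun v hv hb => ?_⟩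
    · simp only [Set.mem_ofPred_eq]
      rw [dist_eq_len (t := t) (size_ne_zero_of_len_pos (by omega))]
      omega
    · exact absurd ((hxu A).trans hb) (hf_branch A v hv)
  -- The lamps outside the branch of `x` and at height at least `D` do not change in a component.
  have hinv : ∀ A (z z' : annulusInf (switchWalkSwitch L S) n r),
      (annulusGraph (switchWalkSwitch L S) n r).Adj z z' →
      ((∀ v, ¬ t.Below x v → D ≤ t.height v → lamps z.1 v = f A v) ∧
        (t.Below x (pos z.1) ∨
          (t.height (pos z.1) < D ∧ 2 * t.size (lamps z.1) (pos z.1) < n + D))) →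
      ((∀ v, ¬ t.Below x v → D ≤ t.height v → lamps z'.1 v = f A v) ∧
        (t.Below x (pos z'.1) ∨
          (t.height (pos z'.1) < D ∧ 2 * t.size (lamps z'.1) (pos z'.1) < n + D))) := by
    rintro A ⟨z, hz⟩ ⟨z', hz'⟩ hadj ⟨h1, h2⟩
    dsimp only at h1 h2 ⊢
    obtain ⟨-, hpos, hlamps⟩ :=
      Lamplighter.adj_iff.1 (show (SimpleGraph.mulCayley (switchWalkSwitch L S)).Adj z z' from hadj)
    have hd1 : n ≤ (SimpleGraph.mulCayley (switchWalkSwitch L S)).dist 1 z' := hz'.2.1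
    have hd2 : (SimpleGraph.mulCayley (switchWalkSwitch L S)).dist 1 z' ≤ n + r := hz'.1
    have hl' := len_add_height (t := t) z'.finite_lamps (pos z')
    suffices hs : t.Below x (pos z') ∨
        (t.height (pos z') < D ∧ 2 * t.size (lamps z') (pos z') < n + D) by
      refine ⟨fun v hv hvD => ?_, hs⟩
      rw [← h1 v hv hvD]
      refine (hlamps v ?_ ?_).symm
      · rintro rfl
        rcases h2 with h2 | h2
        · exact hv h2
        · omega
      · rintro rfl
        rcases hs with hs | hs
        · exact hv hs
        · omega
    by_cases hz'x : t.Below x (pos z')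
    · exact Or.inl hz'x
    right
    by_cases hzx : t.Below x (pos z)
    · have hp1 : pos z' = 1 := by
        rcases hpos with h | h
        · rcases (t.adj_iff _ _).1 h with ⟨-, h⟩ | ⟨-, h⟩
          · exact absurd (hzx.trans (h ▸ below_parent _)) hz'x
          · rcases hzx.eq_or_parent with h' | h'
            · rw [← h, ← h', hx]
            · exact absurd (h ▸ h') hz'x
        · exact absurd (h.1 ▸ hzx) hz'x
      have := len_le_dist (t := t) z'
      rw [hp1] at hl' this ⊢
      rw [height_one] at hl' ⊢
      omega
    · obtain ⟨hzD, hzs⟩ := h2.resolve_left hzx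
      have hle : t.height (pos z') ≤ D := by
        rcases hpos with h | h
        · rcases (t.adj_iff _ _).1 h with ⟨h1, h2⟩ | ⟨h1, h2⟩
          · rw [height_child h1 h2]; omega
          · have := height_child h1 h2; omega
        · rw [← h.1]; omega
      have hmem : pos z' ∈ t.hull (lamps z) (pos z) := by
        obtain ⟨w, hw1, hw2, hw3⟩ : ∃ w, t.Below (pos z') w ∧ ¬ t.Below x w ∧ t.height w = D := by
          by_cases h1 : pos z' = 1
          · obtain ⟨w, hw, hw'⟩ := exists_descendant (t := t) hq0 y (D - 1)
            exact ⟨w, h1 ▸ one_below w, hdisj w hw, by omega⟩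
          · obtain ⟨w, hw, hw'⟩ := exists_descendant (t := t) hq0 (pos z') (D - t.height (pos z'))
            refine ⟨w, hw, fun h => hz'x ?_, by omega⟩
            have := height_pos (t := t) h1
            exact h.below_of_height_le hw (by omega)
        refine Or.inr ⟨w, ?_, hw1⟩
        rw [h1 w hw2 hw3.ge]
        exact (hf_lit A w).2 (Or.inl ⟨hw3, hw2⟩)
      have hsz := size_le_of_subset z.finite_lamps (hull_subset_of_agree hlamps hmem)
      refine ⟨lt_of_le_of_ne hle fun heq => ?_, by omega⟩
      have hne : pos z' ≠ 1 := ne_one_of_height_pos (t := t) (by omega)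
      rw [dist_eq_len (t := t) (size_pos_of_mem z'.finite_lamps (mem_hull_pos _ _) hne).ne'] at hd1
      omega
  have := finite_annulusInf (L := L) t hq0 n r
  have := hUfin.to_subtype
  have hcard : 2 ^ q ^ D ≤ Nat.card (Set U) := by
    have h := pow_le_ncard_descendants (t := t) hq0 y D
    have := Fintype.ofFinite U
    rw [Nat.card_eq_fintype_card, Fintype.card_set, ← Nat.card_eq_fintype_card,
      Nat.card_coe_set_eq]
    exact Nat.pow_le_pow_right (by omega) h
  refine hcard.trans (Nat.card_le_card_of_injective
    (fun A => (annulusGraph (switchWalkSwitch L S) n r).connectedComponentMk ⟨g A, hg A⟩) ?_)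
  intro A A' h
  have hreach := SimpleGraph.ConnectedComponent.exact h
  have hfin := (reachable_induction (hinv A) hreach ⟨fun _ _ _ => rfl, Or.inl (hxu A)⟩).1
  ext v
  have hv : ∀ A : Set U, v ∈ A ↔ f A v ≠ 1 := by
    intro A
    rw [hf_lit]
    have := hUh v v.2
    simp [this]
  rw [hv A, hv A', ← hfin v (hdisj v v.2.1) (by have := hUh v v.2; omega)]
  rfl

end CayleyTree

namespace CayleyTree

open Lamplighter CayleySphere Function

/-! ### Regular trees -/

section Tree

variable {V : Type*} {G : SimpleGraph V}

/-- A vertex other than `o` has a neighbour closer to `o`. -/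
lemma exists_adj_dist (hG : G.Connected) {o v : V} (hv : v ≠ o) :
    ∃ u, G.Adj u v ∧ G.dist o u + 1 = G.dist o v := by
  obtain ⟨p, hp, hlen⟩ := (hG.preconnected o v).exists_path_of_dist
  have hnil : ¬ p.Nil := fun h => hv h.eq.symm
  refine ⟨p.penultimate, p.adj_penultimate hnil, ?_⟩
  have h1 : G.dist o p.penultimate ≤ p.dropLast.length := SimpleGraph.dist_le _
  have h2 := (p.adj_penultimate hnil).diff_dist_adj (u := o)
  have h3 : p.dropLast.length = p.length - 1 := by simp
  have h4 : 0 < G.dist o v := (hG.preconnected o v).pos_dist_of_ne hv.symm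
  omega

/-- In a tree, a vertex has at most one neighbour closer to `o`. -/
lemma eq_of_adj_dist (hG : G.IsTree) {o u u' v : V} (h : G.Adj u v) (h' : G.Adj u' v)
    (hd : G.dist o u + 1 = G.dist o v) (hd' : G.dist o u' + 1 = G.dist o v) : u = u' := by
  obtain ⟨p, hp, hlen⟩ := (hG.connected.preconnected o u).exists_path_of_dist
  obtain ⟨p', hp', hlen'⟩ := (hG.connected.preconnected o u').exists_path_of_dist
  have h1 : (p.concat h).IsPath :=
    SimpleGraph.Walk.isPath_of_length_eq_dist _ (by rw [SimpleGraph.Walk.length_concat]; omega)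
  have h2 : (p'.concat h').IsPath :=
    SimpleGraph.Walk.isPath_of_length_eq_dist _ (by rw [SimpleGraph.Walk.length_concat]; omega)
  have h3 := (hG.existsUnique_path o v).unique h1 h2
  have h4 := congrArg SimpleGraph.Walk.penultimate h3
  simpa using h4

end Tree

variable {Γ L : Type*} [Group Γ] [Group L] {S : Set Γ}

/-- The rooted tree structure of a Cayley graph that is a regular tree; the height is the distance
to the root. -/
noncomputable def ofIsRegularTreeCayley {d : ℕ} (hS : IsRegularTreeCayley S d) (hd : 1 ≤ d) :
    CayleyTree S (d - 1) := by
  classical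
  let G := SimpleGraph.mulCayley S
  have hG : G.IsTree := hS.1
  let par : Γ → Γ := fun v => if h : v = 1 then 1 else (exists_adj_dist hG.connected h).choose
  have hpar : ∀ v, v ≠ 1 → G.Adj (par v) v ∧ G.dist 1 (par v) + 1 = G.dist 1 v := by
    intro v hv
    simp only [par, hv, dite_false]
    exact (exists_adj_dist hG.connected hv).choose_spec
  have hdist : ∀ v, G.dist 1 v = 0 ↔ v = 1 := fun v => by
    rw [hG.connected.dist_eq_zero_iff, eq_comm]
  have huniq : ∀ u v, G.Adj u v → G.dist 1 u + 1 = G.dist 1 v → v ≠ 1 ∧ par v = u := by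
    intro u v h hd
    have hv : v ≠ 1 := fun h1 => by rw [(hdist v).2 h1] at hd; omega
    exact ⟨hv, eq_of_adj_dist hG (hpar v hv).1 h (hpar v hv).2 hd⟩
  have hadj : ∀ u v, G.Adj u v ↔ (v ≠ 1 ∧ par v = u) ∨ (u ≠ 1 ∧ par u = v) := by
    intro u v
    constructor
    · intro h
      rcases hG.dist_eq_dist_add_one_of_adj 1 h with h1 | h1
      · exact Or.inr (huniq v u h.symm h1.symm)
      · exact Or.inl (huniq u v h h1.symm)
    · rintro (⟨h1, rfl⟩ | ⟨h1, rfl⟩)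
      · exact (hpar v h1).1
      · exact (hpar u h1).1.symm
  have hpar1 : par 1 = 1 := by simp [par]
  have hdeg : ∀ v, (G.neighborSet v).ncard = d := fun v => by
    rw [Set.ncard, hS.2 v, ENat.toNat_natCast]
  have hne : ∀ u, u ≠ 1 → par u ≠ u := fun u hu h => by
    have := (hpar u hu).2; rw [h] at this; omega
  have hpp : ∀ v u, v ≠ 1 → u ≠ 1 → par u = v → par v ≠ u := fun v u hv hu h h' => by
    have h1 := (hpar u hu).2
    have h2 := (hpar v hv).2
    rw [h] at h1; rw [h'] at h2; omega
  refine ⟨G.dist 1, par, hpar1, hdist, fun v hv => (hpar v hv).2, hadj, ?_, ?_⟩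
  · rw [show d - 1 + 1 = d by omega, ← hdeg 1]
    congr 1
    ext u
    rw [SimpleGraph.mem_neighborSet, hadj]
    simp
  · intro v hv
    have hins : G.neighborSet v = insert (par v) {u | u ≠ 1 ∧ par u = v} := by
      ext u
      simp only [SimpleGraph.mem_neighborSet, hadj, Set.mem_insert_iff, Set.mem_ofPred_eq, hv,
        ne_eq, not_false_eq_true, true_and]
      constructor
      · rintro (h | h)
        · exact Or.inr h
        · exact Or.inl h.symm
      · rintro (h | h)
        · exact Or.inr h.symm
        · exact Or.inl h
    have hfin : (G.neighborSet v).Finite := Set.finite_of_ncard_ne_zero (by rw [hdeg]; omega)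
    have h1 := hdeg v
    rw [hins, Set.ncard_insert_of_notMem _ (hfin.subset (hins ▸ Set.subset_insert _ _))] at h1
    · omega
    · rintro ⟨h2, h3⟩
      exact hpp v (par v) hv h2 h3 rfl

/-! ### Thickness over regular trees -/

lemma numComponents_of_connected {G : Type*} [Group G] {S : Set G} {n r : ℕ}
    (h : (annulusGraph S n r).Connected) : numComponents S n r = 1 := by
  have h1 := h.preconnected.subsingleton_connectedComponent
  have h2 : Nonempty (annulusGraph S n r).ConnectedComponent :=
    h.nonempty.map (annulusGraph S n r).connectedComponentMk
  exact Nat.card_eq_one_iff_unique.2 ⟨h1, h2⟩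

/-- The thickness is attained. -/
lemma exists_thickness_eq {G : Type*} [Group G] {S : Set G} {n r : ℕ}
    (h : (annulusGraph S n r).Connected) :
    ∃ t : ℕ, thickness S n = t ∧ t ≤ r ∧ (annulusGraph S n t).Connected := by
  classical
  have hex : ∃ r, (annulusGraph S n r).Connected := ⟨r, h⟩
  refine ⟨Nat.find hex, le_antisymm ?_ ?_, Nat.find_min' hex h, Nat.find_spec hex⟩
  · exact sInf_le ⟨_, rfl, Nat.find_spec hex⟩
  · refine le_sInf ?_
    rintro _ ⟨r, rfl, hr⟩
    exact_mod_cast Nat.find_min' hex hr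

/-- Over a branching tree the thickness differs from `log_q n` by a bounded amount: if it were much
smaller, a connected annulus would have exponentially many components. -/
theorem exists_thickness_near_log [Nontrivial L] [Finite L] {q : ℕ} (t : CayleyTree S q)
    (hq : 2 ≤ q) :
    ∃ c K : ℝ, 0 < c ∧ 1 < K ∧ ∀ n : ℕ, 1 ≤ n →
      (∃ t : ℕ, thickness (switchWalkSwitch L S) n = (t : ℕ∞) ∧
        |(t : ℝ) - Real.logb q n| ≤ c) ∧
      ∀ r : ℕ, (r : ℝ) ≤ Real.logb q n - c →
        K ^ n ≤ (numComponents (switchWalkSwitch L S) n r : ℝ) := by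
  have hq0 : 0 < q := by omega
  have hq1 : (1 : ℝ) < q := by exact_mod_cast (by omega : 1 < q)
  have hpow : ∀ k, (0 : ℝ) < (q : ℝ) ^ k := fun k => by positivity
  have hK1 : (1 : ℝ) < 2 ^ ((1 : ℝ) / q ^ 6) :=
    Real.one_lt_rpow (by norm_num) (by have := hpow 6; positivity)
  refine ⟨7, 2 ^ ((1 : ℝ) / q ^ 6), by norm_num, hK1, fun n hn => ?_⟩
  have hn0 : n ≠ 0 := by omega
  have hnpos : (0 : ℝ) < n := by exact_mod_cast hn
  set ℓ := Nat.log q n with hℓ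
  have hlog1 : q ^ ℓ ≤ n := Nat.pow_log_le_self q hn0
  have hlog2 : n < q ^ (ℓ + 1) := Nat.lt_pow_succ_log_self (by omega) n
  have hlogb1 : (ℓ : ℝ) ≤ Real.logb q n := by
    rw [Real.le_logb_iff_rpow_le hq1 hnpos, Real.rpow_natCast]
    exact_mod_cast hlog1
  have hlogb2 : Real.logb q n < ℓ + 1 := by
    rw [Real.logb_lt_iff_lt_rpow hq1 hnpos]
    have : ((ℓ : ℝ) + 1) = ((ℓ + 1 : ℕ) : ℝ) := by push_cast; ring
    rw [this, Real.rpow_natCast]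
    exact_mod_cast hlog2
  have hcomp : ∀ r : ℕ, (r : ℝ) ≤ Real.logb q n - 7 →
      ((2 : ℝ) ^ ((1 : ℝ) / q ^ 6)) ^ n ≤ (numComponents (switchWalkSwitch L S) n r : ℝ) := by
    intro r hr
    have hrℓ : r + 6 < ℓ := by
      have : (r : ℝ) + 6 < ℓ := by linarith
      exact_mod_cast this
    have h1 := two_pow_le_numComponents (L := L) (n := n) (r := r) (D := ℓ - 5) t hq (by omega)
      (by rw [show ℓ - 5 + 5 = ℓ by omega]; exact hlog1)
    have h2 : (n : ℝ) / q ^ 6 ≤ ((q ^ (ℓ - 5) : ℕ) : ℝ) := by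
      rw [div_le_iff₀ (hpow 6)]
      have : n ≤ q ^ (ℓ - 5) * q ^ 6 := by
        rw [← pow_add, show ℓ - 5 + 6 = ℓ + 1 by omega]; exact hlog2.le
      exact_mod_cast this
    calc ((2 : ℝ) ^ ((1 : ℝ) / q ^ 6)) ^ n = 2 ^ ((n : ℝ) / q ^ 6) := by
          rw [← Real.rpow_natCast, ← Real.rpow_mul (by norm_num)]
          congr 1; ring
      _ ≤ 2 ^ ((q ^ (ℓ - 5) : ℕ) : ℝ) := Real.rpow_le_rpow_of_exponent_le (by norm_num) h2
      _ = ((2 ^ q ^ (ℓ - 5) : ℕ) : ℝ) := by rw [Real.rpow_natCast]; push_cast; ring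
      _ ≤ _ := by exact_mod_cast h1
  refine ⟨?_, hcomp⟩
  have hconn : (annulusGraph (switchWalkSwitch L S) n (ℓ + 6)).Connected := by
    refine connected_annulusGraph (K := ℓ + 3) t hq0 hn (by omega) ?_ le_rfl
    have h1 : q ^ (ℓ + 3 - 1) = q * q ^ (ℓ + 1) := by
      rw [show ℓ + 3 - 1 = ℓ + 1 + 1 by omega, pow_succ']
    have h2 : 2 * q ^ (ℓ + 1) ≤ q * q ^ (ℓ + 1) := Nat.mul_le_mul_right _ hq
    have h3 : ℓ + 3 - 1 < q ^ (ℓ + 3 - 1) := Nat.lt_pow_self (by omega)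
    omega
  obtain ⟨τ, h1, h2, h3⟩ := exists_thickness_eq hconn
  refine ⟨τ, h1, abs_le.2 ⟨?_, ?_⟩⟩
  · by_contra hlt
    have h4 := hcomp τ (by linarith)
    rw [numComponents_of_connected h3, Nat.cast_one] at h4
    exact absurd (one_lt_pow₀ hK1 hn0) (not_lt.2 h4)
  · have : (τ : ℝ) ≤ ℓ + 6 := by exact_mod_cast h2
    linarith

end CayleyTree

namespace CayleyTree

open Lamplighter CayleySphere Function Multiplicative

/-! ### The line as a rooted tree -/

/-- The two standard generating sets of the integers. -/
def IsLineGenerators (S : Set (Multiplicative ℤ)) : Prop :=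
  S = {ofAdd 1, ofAdd (-1)} ∨ S = {1, ofAdd 1, ofAdd (-1)}

lemma line_adj_iff {S : Set (Multiplicative ℤ)} (hS : IsLineGenerators S) (u v : Multiplicative ℤ) :
    (SimpleGraph.mulCayley S).Adj u v ↔ toAdd v = toAdd u + 1 ∨ toAdd u = toAdd v + 1 := by
  have hmul : ∀ (a b : Multiplicative ℤ) (k : ℤ), a * ofAdd k = b ↔ toAdd b = toAdd a + k := by
    intro a b k
    rw [← toAdd.injective.eq_iff, toAdd_mul, toAdd_ofAdd, eq_comm]
  have hne : u ≠ v ↔ toAdd u ≠ toAdd v := toAdd.injective.ne_iff.symm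
  rw [SimpleGraph.mulCayley_adj', hne]
  constructor
  · rintro ⟨h, g, hg, h' | h'⟩
    all_goals
      obtain rfl | rfl | rfl : g = ofAdd 0 ∨ g = ofAdd 1 ∨ g = ofAdd (-1) := by
        rcases hS with rfl | rfl <;> simp at hg <;> tauto
    all_goals
      first
        | rw [hmul] at h'
        | rw [eq_comm, hmul] at h'
      omega
  · have h1 : ofAdd 1 ∈ S := by rcases hS with rfl | rfl <;> simp
    rintro (h | h)
    · exact ⟨by omega, _, h1, Or.inl ((hmul _ _ _).2 h)⟩
    · exact ⟨by omega, _, h1, Or.inr ((hmul _ _ _).2 h).symm⟩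

/-- The Cayley graph of the integers is a rooted tree in which every vertex but the root has one
child. -/
def lineTree {S : Set (Multiplicative ℤ)} (hS : IsLineGenerators S) : CayleyTree S 1 where
  height v := (toAdd v).natAbs
  parent v := ofAdd (toAdd v - (toAdd v).sign)
  parent_one := by simp
  height_eq_zero v := by simp
  height_parent_add_one v hv := by
    have h : toAdd v ≠ 0 := by simpa using hv
    rw [toAdd_ofAdd]
    rcases lt_or_gt_of_ne h with h | h
    · rw [Int.sign_eq_neg_one_of_neg h]; omega
    · rw [Int.sign_eq_one_of_pos h]; omega
  adj_iff u v := by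
    rw [line_adj_iff hS]
    have h1 : ∀ a b : Multiplicative ℤ, (a ≠ 1 ∧ ofAdd (toAdd a - (toAdd a).sign) = b) ↔
        (0 < toAdd a ∧ toAdd b = toAdd a - 1) ∨ (toAdd a < 0 ∧ toAdd b = toAdd a + 1) := by
      intro a b
      rw [← toAdd.injective.ne_iff, ← toAdd.injective.eq_iff, toAdd_ofAdd, toAdd_one]
      rcases lt_trichotomy (toAdd a) 0 with h | h | h
      · rw [Int.sign_eq_neg_one_of_neg h]; omega
      · rw [h]; simp
      · rw [Int.sign_eq_one_of_pos h]; omega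
    rw [h1, h1]
    omega
  ncard_children_one := by
    have : {u : Multiplicative ℤ | u ≠ 1 ∧ ofAdd (toAdd u - (toAdd u).sign) = 1} =
        {ofAdd 1, ofAdd (-1)} := by
      ext u
      simp only [Set.mem_ofPred_eq, Set.mem_insert_iff, Set.mem_singleton_iff]
      rw [← toAdd.injective.ne_iff, ← toAdd.injective.eq_iff, ← toAdd.injective.eq_iff,
        ← toAdd.injective.eq_iff, toAdd_ofAdd, toAdd_one, toAdd_ofAdd, toAdd_ofAdd]
      rcases lt_trichotomy (toAdd u) 0 with h | h | h
      · rw [Int.sign_eq_neg_one_of_neg h]; omega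
      · rw [h]; simp
      · rw [Int.sign_eq_one_of_pos h]; omega
    rw [this, Set.ncard_pair]
    exact ofAdd.injective.ne (by norm_num)
  ncard_children v hv := by
    have hv' : toAdd v ≠ 0 := by simpa using hv
    have : {u : Multiplicative ℤ | u ≠ 1 ∧ ofAdd (toAdd u - (toAdd u).sign) = v} =
        {ofAdd (toAdd v + (toAdd v).sign)} := by
      ext u
      simp only [Set.mem_ofPred_eq, Set.mem_singleton_iff]
      rw [← toAdd.injective.ne_iff, ← toAdd.injective.eq_iff, ← toAdd.injective.eq_iff,
        toAdd_ofAdd, toAdd_one, toAdd_ofAdd]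
      rcases lt_trichotomy (toAdd u) 0 with h | h | h <;>
      rcases lt_or_gt_of_ne hv' with h' | h' <;>
      simp only [Int.sign_eq_neg_one_of_neg, Int.sign_eq_one_of_pos, h, h', Int.sign_zero] <;>
      omega
    rw [this, Set.ncard_singleton]

variable {S : Set (Multiplicative ℤ)} {hS : IsLineGenerators S}

lemma line_height (v : Multiplicative ℤ) : (lineTree hS).height v = (toAdd v).natAbs := rfl

lemma line_parent (v : Multiplicative ℤ) :
    toAdd ((lineTree hS).parent v) = toAdd v - (toAdd v).sign := rfl

lemma line_below_iff (u v : Multiplicative ℤ) : (lineTree hS).Below u v ↔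
    (0 ≤ toAdd u ∧ toAdd u ≤ toAdd v) ∨ (toAdd v ≤ toAdd u ∧ toAdd u ≤ 0) := by
  constructor
  · rintro ⟨k, rfl⟩
    induction k with
    | zero => simp only [iterate_zero, id_eq]; omega
    | succ k ih =>
      rw [iterate_succ_apply', line_parent]
      rcases lt_trichotomy (toAdd ((lineTree hS).parent^[k] v)) 0 with h | h | h
      · rw [Int.sign_eq_neg_one_of_neg h]; omega
      · rw [h] at ih ⊢; simpa using ih
      · rw [Int.sign_eq_one_of_pos h]; omega
  · obtain ⟨k, hk⟩ : ∃ k, k = (toAdd v).natAbs := ⟨_, rfl⟩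
    induction k using Nat.strong_induction_on generalizing v with
    | _ k ih =>
    intro h
    by_cases huv : toAdd u = toAdd v
    · rw [toAdd.injective huv]; exact Below.refl _
    · refine Below.trans (ih _ ?_ ((lineTree hS).parent v) rfl ?_) (below_parent v)
      all_goals
        rw [line_parent]
        rcases lt_trichotomy (toAdd v) 0 with h' | h' | h'
        · rw [Int.sign_eq_neg_one_of_neg h']; omega
        · omega
        · rw [Int.sign_eq_one_of_pos h']; omega

variable {L : Type*} [Group L]

/-- The hull is an interval, with end points `b` in the direction `σ = ±1` and `a` in the opposite
direction. -/
def Spans (hS : IsLineGenerators S) (σ : ℤ) (f : Multiplicative ℤ → L) (γ : Multiplicative ℤ)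
    (a b : ℕ) : Prop :=
  ∀ u, u ∈ (lineTree hS).hull f γ ↔ -(a : ℤ) ≤ σ * toAdd u ∧ σ * toAdd u ≤ b

lemma Spans.neg {σ : ℤ} {f : Multiplicative ℤ → L} {γ : Multiplicative ℤ} {a b : ℕ}
    (h : Spans hS σ f γ a b) : Spans hS (-σ) f γ b a := by
  intro u
  rw [h u, neg_mul]
  omega

lemma exists_spans {f : Multiplicative ℤ → L} (hf : (mulSupport f).Finite) {σ : ℤ}
    (hσ : σ = 1 ∨ σ = -1) (γ : Multiplicative ℤ) : ∃ a b, Spans hS σ f γ a b := by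
  have hmax : ∀ τ : ℤ, (τ = 1 ∨ τ = -1) → ∃ b : ℕ, ∀ k : ℕ,
      ofAdd (τ * k) ∈ (lineTree hS).hull f γ ↔ k ≤ b := by
    intro τ hτ
    have hfin : {k : ℕ | ofAdd (τ * k) ∈ (lineTree hS).hull f γ}.Finite := by
      refine Set.Finite.preimage (f := fun k : ℕ => ofAdd (τ * (k : ℤ))) ?_ (finite_hull hf γ)
      intro k _ l _ h
      have := ofAdd.injective h
      rcases hτ with rfl | rfl <;> simpa using this
    obtain ⟨b, hb, hmax⟩ := Set.exists_max_image _ id hfin ⟨0, by simpa using one_mem_hull f γ⟩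
    refine ⟨b, fun k => ⟨fun h => hmax k h, fun h => mem_hull_of_below ?_ hb⟩⟩
    rw [line_below_iff]
    simp only [toAdd_ofAdd]
    rcases hτ with rfl | rfl <;> omega
  obtain ⟨b, hb⟩ := hmax σ hσ
  obtain ⟨a, ha⟩ := hmax (-σ) (by omega)
  refine ⟨a, b, fun u => ?_⟩
  rcases le_total 0 (σ * toAdd u) with h | h
  · have e : ofAdd (σ * ((σ * toAdd u).natAbs : ℤ)) = u := by
      rw [Int.natAbs_of_nonneg h]; rcases hσ with rfl | rfl <;> simp
    have := hb (σ * toAdd u).natAbs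
    rw [e] at this
    rw [this]; omega
  · have e : ofAdd (-σ * ((σ * toAdd u).natAbs : ℤ)) = u := by
      rw [Int.ofNat_natAbs_of_nonpos h]; rcases hσ with rfl | rfl <;> simp
    have := ha (σ * toAdd u).natAbs
    rw [e] at this
    rw [this]; omega

lemma Spans.size_eq {σ : ℤ} (hσ : σ = 1 ∨ σ = -1) {f : Multiplicative ℤ → L}
    {γ : Multiplicative ℤ} {a b : ℕ} (h : Spans hS σ f γ a b) :
    (lineTree hS).size f γ = a + b := by
  have : (lineTree hS).hull f γ \ {1} = (fun k : ℤ => ofAdd (σ * k)) ''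
      ((Finset.Icc (-(a : ℤ)) b).erase 0 : Finset ℤ) := by
    ext u
    simp only [Set.mem_sdiff, h u, Set.mem_singleton_iff, Finset.coe_erase, Finset.coe_Icc,
      Set.mem_image, Set.mem_Icc]
    rw [← toAdd.injective.eq_iff, toAdd_one]
    constructor
    · rintro ⟨h1, h2⟩
      refine ⟨σ * toAdd u, ⟨h1, ?_⟩, ?_⟩
      · rcases hσ with rfl | rfl <;> omega
      · rcases hσ with rfl | rfl <;> simp
    · rintro ⟨k, ⟨h1, h2⟩, rfl⟩
      rw [toAdd_ofAdd]
      rcases hσ with rfl | rfl <;> omega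
  rw [size, this, Set.ncard_image_of_injective, Set.ncard_coe_finset,
    Finset.card_erase_of_mem (by simp), Int.card_Icc]
  · omega
  · intro k l h
    have := ofAdd.injective h
    rcases hσ with rfl | rfl <;> simpa using this

lemma Spans.len_add {σ : ℤ} (hσ : σ = 1 ∨ σ = -1) {f : Multiplicative ℤ → L}
    (hf : (mulSupport f).Finite) {γ : Multiplicative ℤ} {a b : ℕ} (h : Spans hS σ f γ a b) :
    (lineTree hS).len f γ + (toAdd γ).natAbs = 2 * (a + b) := by
  rw [← h.size_eq hσ]; exact len_add_height hf γ

lemma Spans.pos_mem {σ : ℤ} {f : Multiplicative ℤ → L} {γ : Multiplicative ℤ} {a b : ℕ}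
    (h : Spans hS σ f γ a b) : -(a : ℤ) ≤ σ * toAdd γ ∧ σ * toAdd γ ≤ b :=
  (h γ).1 (mem_hull_pos f γ)

lemma Spans.of_hull_eq {σ : ℤ} {f f' : Multiplicative ℤ → L} {γ γ' : Multiplicative ℤ} {a b : ℕ}
    (h : Spans hS σ f γ a b) (h' : (lineTree hS).hull f' γ' = (lineTree hS).hull f γ) :
    Spans hS σ f' γ' a b := fun u => by rw [h', h u]

/-- The size of the hull is at least the distance between two of its vertices on different sides of
the root. -/
lemma add_le_size {f : Multiplicative ℤ → L} (hf : (mulSupport f).Finite) {γ : Multiplicative ℤ}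
    {σ : ℤ} (hσ : σ = 1 ∨ σ = -1) {k l : ℕ} (hk : ofAdd (-(σ * k)) ∈ (lineTree hS).hull f γ)
    (hl : ofAdd (σ * l) ∈ (lineTree hS).hull f γ) : k + l ≤ (lineTree hS).size f γ := by
  obtain ⟨a, b, h⟩ := exists_spans (hS := hS) hf hσ γ
  rw [h, toAdd_ofAdd] at hk hl
  rw [h.size_eq hσ]
  rcases hσ with rfl | rfl <;> omega

/-! ### Moving around on the line -/

lemma Linked.line_step {n m : ℕ} {f f' : Multiplicative ℤ → L} {γ γ' : Multiplicative ℤ}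
    (hf : (mulSupport f).Finite) (hf' : (mulSupport f').Finite)
    (hadj : toAdd γ' = toAdd γ + 1 ∨ toAdd γ = toAdd γ' + 1)
    (h1 : n ≤ (lineTree hS).len f γ) (h2 : (lineTree hS).len f γ ≤ m)
    (h3 : n ≤ (lineTree hS).len f' γ') (h4 : (lineTree hS).len f' γ' ≤ m)
    (h : ∀ v, v ≠ γ → v ≠ γ' → f v = f' v) : (lineTree hS).Linked n m (f, γ) (f', γ') :=
  Relation.ReflTransGen.single ⟨⟨hf, h1, h2⟩, ⟨hf', h3, h4⟩, (line_adj_iff hS _ _).2 hadj, h⟩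

/-- The lamplighter can walk within the hull without changing it, by lighting all lamps on the
way. -/
lemma Linked.line_walk [Nontrivial L] {n m a b : ℕ} {σ : ℤ} (hσ : σ = 1 ∨ σ = -1)
    (s : Multiplicative ℤ) (hs : -(a : ℤ) ≤ σ * toAdd s ∧ σ * toAdd s ≤ b) (d : ℕ) :
    ∀ (f : Multiplicative ℤ → L) (γ : Multiplicative ℤ), (mulSupport f).Finite →
      (toAdd s - toAdd γ).natAbs = d → Spans hS σ f γ a b →
      (∀ k : ℤ, (toAdd γ ≤ k ∧ k ≤ toAdd s) ∨ (toAdd s ≤ k ∧ k ≤ toAdd γ) →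
        n + k.natAbs ≤ 2 * (a + b) ∧ 2 * (a + b) ≤ m + k.natAbs) →
      ∃ f' : Multiplicative ℤ → L, (mulSupport f').Finite ∧
        (lineTree hS).Linked n m (f, γ) (f', s) ∧ Spans hS σ f' s a b := by
  obtain ⟨x, hx⟩ := exists_ne (1 : L)
  induction d with
  | zero =>
    intro f γ hf hd hsp _
    obtain rfl : γ = s := toAdd.injective (by omega)
    exact ⟨f, hf, Linked.refl _, hsp⟩
  | succ d ih =>
    intro f γ hf hd hsp hk
    obtain ⟨γ', hγ', hγ'd⟩ : ∃ γ' : Multiplicative ℤ,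
        (toAdd γ' = toAdd γ + 1 ∨ toAdd γ = toAdd γ' + 1) ∧ (toAdd s - toAdd γ').natAbs = d := by
      rcases le_total (toAdd γ) (toAdd s) with h | h
      · exact ⟨ofAdd (toAdd γ + 1), by rw [toAdd_ofAdd]; omega, by rw [toAdd_ofAdd]; omega⟩
      · exact ⟨ofAdd (toAdd γ - 1), by rw [toAdd_ofAdd]; omega, by rw [toAdd_ofAdd]; omega⟩
    have hpos := hsp.pos_mem
    have hmem : γ' ∈ (lineTree hS).hull f γ := by
      rw [hsp]; rcases hσ with rfl | rfl <;> omega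
    have hf' := finite_update hf γ x
    have hag : ∀ v, v ≠ γ → v ≠ γ' → f v = update f γ x v := fun v hv _ => by simp [hv]
    have hsp' := hsp.of_hull_eq (hull_eq_of_agree hag hmem
      (mem_hull_of_lit (by simpa using hx) _))
    have e1 := hsp.len_add hσ hf
    have e2 := hsp'.len_add hσ hf'
    have k1 := hk (toAdd γ) (by omega)
    have k2 := hk (toAdd γ') (by omega)
    obtain ⟨f'', h1, h2, h3⟩ := ih _ γ' hf' hγ'd hsp' fun k hk' => hk k (by omega)
    exact ⟨f'', h1, (Linked.line_step hf hf' hγ' (by omega) (by omega) (by omega) (by omega)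
      hag).trans h2, h3⟩

/-- At the end of the hull, the lamplighter can make it longer. -/
lemma Linked.line_grow {n m a b : ℕ} {σ : ℤ} (hσ : σ = 1 ∨ σ = -1) {f : Multiplicative ℤ → L}
    (hf : (mulSupport f).Finite) (hsp : Spans hS σ f (ofAdd (σ * b)) a b)
    (h1 : n + b ≤ 2 * (a + b)) (h2 : 2 * (a + b) + 1 ≤ m + b) :
    (lineTree hS).Linked n m (f, ofAdd (σ * b)) (f, ofAdd (σ * (b + 1 : ℕ))) ∧
      Spans hS σ f (ofAdd (σ * (b + 1 : ℕ))) a (b + 1) := by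
  have hsp' : Spans hS σ f (ofAdd (σ * (b + 1 : ℕ))) a (b + 1) := by
    intro u
    constructor
    · rintro (h | ⟨v, hv, h⟩)
      · rw [line_below_iff, toAdd_ofAdd] at h
        rcases hσ with rfl | rfl <;> omega
      · have := (hsp v).1 (mem_hull_of_lit hv _)
        rw [line_below_iff] at h
        rcases hσ with rfl | rfl <;> omega
    · intro h
      by_cases hu : σ * toAdd u ≤ b
      · rcases (hsp u).2 ⟨h.1, hu⟩ with h' | ⟨v, hv, h'⟩
        · refine Or.inl (h'.trans ?_)
          rw [line_below_iff]
          simp only [toAdd_ofAdd]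
          rcases hσ with rfl | rfl <;> omega
        · exact Or.inr ⟨v, hv, h'⟩
      · left
        rw [line_below_iff]
        simp only [toAdd_ofAdd]
        rcases hσ with rfl | rfl <;> omega
  have e1 := hsp.len_add hσ hf
  have e2 := hsp'.len_add hσ hf
  rw [toAdd_ofAdd] at e1 e2
  have hb : (σ * (b : ℕ)).natAbs = b := by rcases hσ with rfl | rfl <;> omega
  have hb' : (σ * (b + 1 : ℕ)).natAbs = b + 1 := by rcases hσ with rfl | rfl <;> omega
  rw [hb] at e1
  rw [hb'] at e2
  refine ⟨Linked.line_step hf hf ?_ (by omega) (by omega) (by omega) (by omega)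
    fun _ _ _ => rfl, hsp'⟩
  simp only [toAdd_ofAdd]
  rcases hσ with rfl | rfl <;> omega

/-- At the end of the hull, the lamplighter can make it shorter. -/
lemma Linked.line_shrink {n m a b : ℕ} {σ : ℤ} (hσ : σ = 1 ∨ σ = -1) {f : Multiplicative ℤ → L}
    (hf : (mulSupport f).Finite) (hsp : Spans hS σ f (ofAdd (σ * (b + 1 : ℕ))) a (b + 1))
    (h1 : n + b ≤ 2 * (a + b)) (h2 : 2 * (a + b) + 1 ≤ m + b) :
    ∃ f' : Multiplicative ℤ → L, (mulSupport f').Finite ∧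
      (lineTree hS).Linked n m (f, ofAdd (σ * (b + 1 : ℕ))) (f', ofAdd (σ * b)) ∧
      Spans hS σ f' (ofAdd (σ * b)) a b := by
  set γ : Multiplicative ℤ := ofAdd (σ * (b + 1 : ℕ)) with hγ
  have hγt : toAdd γ = σ * (b + 1 : ℕ) := rfl
  have hγ1 : γ ≠ 1 := by
    rw [← toAdd.injective.ne_iff, toAdd_one, hγt]
    rcases hσ with rfl | rfl <;> omega
  have hp : (lineTree hS).parent γ = ofAdd (σ * b) := by
    rw [← toAdd.injective.eq_iff, line_parent, hγt, toAdd_ofAdd]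
    rcases hσ with rfl | rfl
    · rw [Int.sign_eq_one_of_pos (by omega)]; omega
    · rw [Int.sign_eq_neg_one_of_neg (by omega)]; omega
  have hf' := finite_update hf γ (1 : L)
  have hag : ∀ v, v ≠ ofAdd (σ * b) → v ≠ γ → update f γ 1 v = f v := fun v _ hv => by simp [hv]
  have hleaf : ∀ v, f v ≠ 1 → (lineTree hS).Below γ v → γ = v := by
    intro v hv hb
    have := (hsp v).1 (mem_hull_of_lit hv _)
    rw [line_below_iff, hγt] at hb
    rw [← toAdd.injective.eq_iff, hγt]
    rcases hσ with rfl | rfl <;> omega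
  obtain ⟨h3, h4⟩ := hull_erase_leaf hγ1 hp hleaf (f' := update f γ 1) (by simp) hag
  have hsp' : Spans hS σ (update f γ 1) (ofAdd (σ * b)) a b := by
    intro u
    have h5 := hsp u
    rw [h4, Set.mem_insert_iff, ← toAdd.injective.eq_iff, hγt] at h5
    have h6 : u ∈ (lineTree hS).hull (update f γ 1) (ofAdd (σ * b)) →
        toAdd u ≠ σ * (b + 1 : ℕ) := fun h h' =>
      h3 ((toAdd.injective (h'.trans hγt.symm) : u = γ) ▸ h)
    constructor
    · intro h
      have := h5.1 (Or.inr h)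
      have := h6 h
      rcases hσ with rfl | rfl <;> omega
    · intro h
      refine (h5.2 (by omega)).resolve_left ?_
      rcases hσ with rfl | rfl <;> omega
  have e1 := hsp.len_add hσ hf
  have e2 := hsp'.len_add hσ hf'
  rw [hγt] at e1
  rw [toAdd_ofAdd] at e2
  have hb : (σ * (b : ℕ)).natAbs = b := by rcases hσ with rfl | rfl <;> omega
  have hb' : (σ * (b + 1 : ℕ)).natAbs = b + 1 := by rcases hσ with rfl | rfl <;> omega
  rw [hb'] at e1
  rw [hb] at e2
  refine ⟨_, hf', Linked.line_step hf hf' ?_ (by omega) (by omega) (by omega) (by omega)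
    fun v h h' => (hag v h' h).symm, hsp'⟩
  rw [hγt, toAdd_ofAdd]
  rcases hσ with rfl | rfl <;> omega

end CayleyTree

namespace CayleyTree

open Lamplighter CayleySphere Function Multiplicative

variable {S : Set (Multiplicative ℤ)} {hS : IsLineGenerators S} {L : Type*} [Group L]

/-! ### Connected annuli over the line -/

/-- A hull with more than `n + 1` edges can be shortened at the end on the side of the
lamplighter. -/
lemma Linked.line_exists_shorter [Nontrivial L] {n : ℕ} {σ : ℤ} (hσ : σ = 1 ∨ σ = -1) (d : ℕ) :
    ∀ (f : Multiplicative ℤ → L) (γ : Multiplicative ℤ) (a b : ℕ), (mulSupport f).Finite →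
      Spans hS σ f γ a b → a + b = n + 1 + d → 0 ≤ σ * toAdd γ →
      2 * (a + b : ℤ) ≤ 2 * n + 2 + σ * toAdd γ →
      ∃ (f' : Multiplicative ℤ → L) (γ' : Multiplicative ℤ) (a' b' : ℕ), (mulSupport f').Finite ∧
        (lineTree hS).Linked n (n + (n + 2)) (f, γ) (f', γ') ∧ Spans hS σ f' γ' a' b' ∧
        a' + b' = n + 1 := by
  induction d with
  | zero => exact fun f γ a b hf hsp hab _ _ => ⟨f, γ, a, b, hf, Linked.refl _, hsp, hab⟩
  | succ d ih =>
    intro f γ a b hf hsp hab h0 hle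
    have hpos := hsp.pos_mem
    obtain ⟨b, rfl⟩ : ∃ b', b = b' + 1 := ⟨b - 1, by omega⟩
    obtain ⟨f₁, hf₁, h1, hsp₁⟩ := Linked.line_walk (n := n) (m := n + (n + 2)) hσ
      (ofAdd (σ * (b + 1 : ℕ)))
      (by rw [toAdd_ofAdd]; rcases hσ with rfl | rfl <;> omega) _ f γ hf rfl hsp (by
        intro k hk
        rw [toAdd_ofAdd] at hk
        rcases hσ with rfl | rfl <;> omega)
    obtain ⟨f₂, hf₂, h2, hsp₂⟩ := Linked.line_shrink (n := n) (m := n + (n + 2)) hσ hf₁ hsp₁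
      (by omega) (by omega)
    have hb : σ * toAdd (ofAdd (σ * (b : ℤ))) = b := by
      rw [toAdd_ofAdd]; rcases hσ with rfl | rfl <;> omega
    obtain ⟨f₃, γ₃, a₃, b₃, hf₃, h3, hsp₃, hab₃⟩ := ih f₂ _ a b hf₂ hsp₂ (by omega)
      (by rw [hb]; omega) (by rw [hb]; omega)
    exact ⟨f₃, γ₃, a₃, b₃, hf₃, h1.trans (h2.trans h3), hsp₃, hab₃⟩

/-- A hull with at most `n + 1` edges can be made longer at an end that the lamplighter can
reach. -/
lemma Linked.line_exists_longer [Nontrivial L] {n : ℕ} {σ : ℤ} (hσ : σ = 1 ∨ σ = -1)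
    (f : Multiplicative ℤ → L) (hf : (mulSupport f).Finite) (d : ℕ) :
    ∀ a b : ℕ, Spans hS σ f (ofAdd (σ * b)) a b → a + b + d = n + 1 → n + b ≤ 2 * (a + b) →
      ∃ (γ' : Multiplicative ℤ) (a' b' : ℕ),
        (lineTree hS).Linked n (n + (n + 2)) (f, ofAdd (σ * b)) (f, γ') ∧
        Spans hS σ f γ' a' b' ∧ a' + b' = n + 1 := by
  induction d with
  | zero => exact fun a b hsp hab _ => ⟨_, a, b, Linked.refl _, hsp, hab⟩
  | succ d ih =>
    intro a b hsp hab hle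
    obtain ⟨h1, hsp₁⟩ := Linked.line_grow (n := n) (m := n + (n + 2)) hσ hf hsp hle (by omega)
    obtain ⟨γ₂, a₂, b₂, h2, hsp₂, hab₂⟩ := ih a (b + 1) hsp₁ (by omega) (by omega)
    exact ⟨γ₂, a₂, b₂, h1.trans h2, hsp₂, hab₂⟩

/-- A hull with `n + 1` edges can be moved to the negative half of the line, one edge at a time:
an edge is removed on the right and added on the left. -/
lemma Linked.line_shift [Nontrivial L] {n : ℕ} (b : ℕ) :
    ∀ (f : Multiplicative ℤ → L) (γ : Multiplicative ℤ) (a : ℕ), (mulSupport f).Finite →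
      Spans hS 1 f γ a b → a + b = n + 1 →
      ∃ (f' : Multiplicative ℤ → L) (γ' : Multiplicative ℤ), (mulSupport f').Finite ∧
        (lineTree hS).Linked n (n + (n + 2)) (f, γ) (f', γ') ∧ Spans hS 1 f' γ' (n + 1) 0 := by
  induction b with
  | zero => exact fun f γ a hf hsp hab => ⟨f, γ, hf, Linked.refl _, hab ▸ hsp⟩
  | succ b ih =>
    intro f γ a hf hsp hab
    have hpos := hsp.pos_mem
    obtain ⟨f₁, hf₁, h1, hsp₁⟩ := Linked.line_walk (n := n) (m := n + (n + 2)) (.inl rfl)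
      (ofAdd (1 * (b + 1 : ℕ))) (by rw [toAdd_ofAdd]; omega) _ f γ hf rfl hsp (by
        intro k hk
        rw [toAdd_ofAdd] at hk
        omega)
    obtain ⟨f₂, hf₂, h2, hsp₂⟩ := Linked.line_shrink (n := n) (m := n + (n + 2)) (.inl rfl)
      hf₁ hsp₁ (by omega) (by omega)
    obtain ⟨f₃, hf₃, h3, hsp₃⟩ := Linked.line_walk (n := n) (m := n + (n + 2)) (.inl rfl)
      (ofAdd (-1 * (a : ℤ))) (by rw [toAdd_ofAdd]; omega) _ f₂ _ hf₂ rfl hsp₂ (by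
        intro k hk
        simp only [toAdd_ofAdd] at hk
        omega)
    obtain ⟨h4, hsp₄⟩ := Linked.line_grow (n := n) (m := n + (n + 2)) (.inr rfl) hf₃ hsp₃.neg
      (by omega) (by omega)
    obtain ⟨f₅, γ₅, hf₅, h5, hsp₅⟩ := ih f₃ _ (a + 1) hf₃ (neg_neg (1 : ℤ) ▸ hsp₄.neg) (by omega)
    exact ⟨f₅, γ₅, hf₅, h1.trans (h2.trans (h3.trans (h4.trans h5))), hsp₅⟩

/-- On the way to the end of the hull, the lamplighter switches off all lamps. -/
lemma Linked.line_clear {n : ℕ} (d : ℕ) :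
    ∀ (f : Multiplicative ℤ → L) (k : ℕ), (mulSupport f).Finite → k + d = n →
      Spans hS 1 f (ofAdd (-(k : ℤ))) (n + 1) 0 → (∀ v, -(k : ℤ) < toAdd v → f v = 1) →
      (lineTree hS).Linked n (n + (n + 2)) (f, ofAdd (-(k : ℤ)))
        (1, ofAdd (-((n + 1 : ℕ) : ℤ))) := by
  -- A step towards the end leaves the hull unchanged, whatever happens to the lamps left behind.
  have step : ∀ (f f' : Multiplicative ℤ → L) (k : ℕ), (mulSupport f).Finite →
      (mulSupport f').Finite → k ≤ n → Spans hS 1 f (ofAdd (-(k : ℤ))) (n + 1) 0 →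
      (∀ v, v ≠ ofAdd (-(k : ℤ)) → v ≠ ofAdd (-((k + 1 : ℕ) : ℤ)) → f v = f' v) →
      (lineTree hS).Linked n (n + (n + 2)) (f, ofAdd (-(k : ℤ)))
        (f', ofAdd (-((k + 1 : ℕ) : ℤ))) ∧ Spans hS 1 f' (ofAdd (-((k + 1 : ℕ) : ℤ))) (n + 1) 0 := by
    intro f f' k hf hf' hk hsp hag
    have hsp' := hsp.of_hull_eq (hull_eq_of_agree hag
      ((hsp _).2 (by rw [toAdd_ofAdd]; omega)) (Or.inl (by
        rw [line_below_iff, toAdd_ofAdd, toAdd_ofAdd]; omega)))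
    have e1 := hsp.len_add (.inl rfl) hf
    have e2 := hsp'.len_add (.inl rfl) hf'
    rw [toAdd_ofAdd] at e1 e2
    exact ⟨Linked.line_step hf hf' (by rw [toAdd_ofAdd, toAdd_ofAdd]; omega) (by omega) (by omega)
      (by omega) (by omega) hag, hsp'⟩
  induction d with
  | zero =>
    intro f k hf hk hsp hoff
    obtain rfl : k = n := by omega
    refine (step f 1 k hf (by simp) le_rfl hsp fun v h1 h2 => ?_).1
    by_contra h
    have h3 := (hsp v).1 (mem_hull_of_lit h _)
    have h4 : ¬ -(k : ℤ) < toAdd v := fun h' => h (hoff v h')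
    rw [← toAdd.injective.ne_iff, toAdd_ofAdd] at h1 h2
    omega
  | succ d ih =>
    intro f k hf hk hsp hoff
    have hf' := finite_update hf (ofAdd (-(k : ℤ))) (1 : L)
    obtain ⟨h1, hsp'⟩ := step f _ k hf hf' (by omega) hsp fun v hv _ =>
      (update_of_ne hv _ _).symm
    refine h1.trans (ih _ (k + 1) hf' (by omega) hsp' fun v hv => ?_)
    by_cases h : v = ofAdd (-(k : ℤ))
    · simp [h]
    · rw [update_of_ne h]
      refine hoff v ?_
      have h' : toAdd v ≠ -(k : ℤ) := fun h' => h (toAdd.injective h')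
      omega

lemma spans_of_forall {σ : ℤ} (hσ : σ = 1 ∨ σ = -1) {f : Multiplicative ℤ → L} {n : ℕ}
    (h : ∀ v, f v ≠ 1 → 0 ≤ σ * toAdd v ∧ σ * toAdd v ≤ n) :
    Spans hS σ f (ofAdd (σ * n)) 0 n := by
  intro u
  constructor
  · rintro (h' | ⟨v, hv, h'⟩)
    · rw [line_below_iff, toAdd_ofAdd] at h'
      rcases hσ with rfl | rfl <;> omega
    · have := h v hv
      rw [line_below_iff] at h'
      rcases hσ with rfl | rfl <;> omega
  · intro h'
    left
    rw [line_below_iff, toAdd_ofAdd]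
    rcases hσ with rfl | rfl <;> omega

lemma mem_annulusInf_of_forall (hS : IsLineGenerators S) {σ : ℤ} (hσ : σ = 1 ∨ σ = -1)
    {f : Multiplicative ℤ → L} {k n r : ℕ} (hk : k ≠ 0)
    (h : ∀ v, f v ≠ 1 → 0 ≤ σ * toAdd v ∧ σ * toAdd v ≤ k) (hf : (mulSupport f).Finite)
    (h1 : n ≤ k) (h2 : k ≤ n + r) :
    state f (ofAdd (σ * k)) hf ∈ annulusInf (switchWalkSwitch L S) n r := by
  have hsp := spans_of_forall (hS := hS) hσ h
  have e := hsp.len_add hσ hf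
  have hs := hsp.size_eq hσ
  rw [toAdd_ofAdd] at e
  have e' : (lineTree hS).len f (ofAdd (σ * k)) = k := by rcases hσ with rfl | rfl <;> omega
  refine ⟨?_, mem_ballComplInf_of_leaf (lineTree hS) one_pos ?_ ?_⟩
  · rw [Set.mem_ofPred_eq, dist_eq_len (t := lineTree hS), lamps_state, pos_state]
    · omega
    · rw [lamps_state, pos_state]; omega
  · rw [lamps_state, pos_state]; omega
  · rw [lamps_state, pos_state]
    intro v hv hb
    have := h v hv
    rw [line_below_iff, toAdd_ofAdd] at hb
    rw [← toAdd.injective.eq_iff, toAdd_ofAdd]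
    rcases hσ with rfl | rfl <;> omega

/-- Every element of the annulus can be moved to an interval with `n + 1` edges, then to
`[-(n + 1), 0]`, and finally all lamps can be switched off. -/
theorem connected_annulusGraph_line [Nontrivial L] [Finite L] (hS : IsLineGenerators S) {n : ℕ}
    (hn : 2 ≤ n) : (annulusGraph (switchWalkSwitch L S) n (n + 2)).Connected := by
  have hσ1 : (1 : ℤ) = 1 ∨ (1 : ℤ) = -1 := Or.inl rfl
  have key : ∀ x : annulusInf (switchWalkSwitch L S) n (n + 2),
      (lineTree hS).Linked n (n + (n + 2)) (lamps x.1, pos x.1)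
        (1, ofAdd (-((n + 1 : ℕ) : ℤ))) := by
    rintro ⟨x, hx⟩
    dsimp only
    have h0 := size_ne_zero_of_mem_ballComplInf (lineTree hS) hn hx.2
    have hd := dist_eq_len h0
    have hx1 : n ≤ (lineTree hS).len (lamps x) (pos x) := hd ▸ hx.2.1
    have hx2 : (lineTree hS).len (lamps x) (pos x) ≤ n + (n + 2) := hd ▸ hx.1
    obtain ⟨f₁, γ₁, a₁, b₁, hf₁, h1, hsp₁, hab₁⟩ :
        ∃ (f' : Multiplicative ℤ → L) (γ' : Multiplicative ℤ) (a b : ℕ), (mulSupport f').Finite ∧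
          (lineTree hS).Linked n (n + (n + 2)) (lamps x, pos x) (f', γ') ∧
          Spans hS 1 f' γ' a b ∧ a + b = n + 1 := by
      have hneg : ∀ (σ : ℤ) (f' : Multiplicative ℤ → L) (γ' : Multiplicative ℤ) (a b : ℕ),
          (σ = 1 ∨ σ = -1) → Spans hS σ f' γ' a b → a + b = n + 1 →
          ∃ a b, Spans hS 1 f' γ' a b ∧ a + b = n + 1 := by
        rintro σ f' γ' a b (rfl | rfl) h1 h2
        · exact ⟨a, b, h1, h2⟩
        · exact ⟨b, a, by simpa using h1.neg, by omega⟩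
      by_cases hN : (lineTree hS).size (lamps x) (pos x) ≤ n
      · obtain ⟨v, hv, hv'⟩ := exists_notMem_hull_of_mem_ballComplInf one_pos hx.2 h0
        obtain ⟨σ, hσ, hσv⟩ : ∃ σ : ℤ, (σ = 1 ∨ σ = -1) ∧ 0 ≤ σ * toAdd v := by
          rcases le_total 0 (toAdd v) with h | h
          · exact ⟨1, .inl rfl, by omega⟩
          · exact ⟨-1, .inr rfl, by omega⟩
        obtain ⟨a, b, hsp⟩ := exists_spans (hS := hS) x.finite_lamps hσ (pos x)
        have hs := hsp.size_eq hσ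
        have he := hsp.len_add hσ x.finite_lamps
        have hp := hsp.pos_mem
        rw [hsp] at hv'
        rw [line_height] at hv
        obtain ⟨f₁, hf₁, h1, hsp₁⟩ := Linked.line_walk (n := n) (m := n + (n + 2)) hσ
          (ofAdd (σ * (b : ℤ))) (by rw [toAdd_ofAdd]; rcases hσ with rfl | rfl <;> omega)
          _ _ _ x.finite_lamps rfl hsp (by
            intro k hk
            rw [toAdd_ofAdd] at hk
            rcases hσ with rfl | rfl <;> omega)
        obtain ⟨γ₂, a₂, b₂, h2, hsp₂, hab₂⟩ := Linked.line_exists_longer (n := n) hσ f₁ hf₁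
          (n + 1 - (a + b)) a b hsp₁ (by omega) (by rcases hσ with rfl | rfl <;> omega)
        obtain ⟨a₃, b₃, hsp₃, hab₃⟩ := hneg σ _ _ _ _ hσ hsp₂ hab₂
        exact ⟨f₁, γ₂, a₃, b₃, hf₁, h1.trans h2, hsp₃, hab₃⟩
      · obtain ⟨σ, hσ, hσv⟩ : ∃ σ : ℤ, (σ = 1 ∨ σ = -1) ∧ 0 ≤ σ * toAdd (pos x) := by
          rcases le_total 0 (toAdd (pos x)) with h | h
          · exact ⟨1, .inl rfl, by omega⟩
          · exact ⟨-1, .inr rfl, by omega⟩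
        obtain ⟨a, b, hsp⟩ := exists_spans (hS := hS) x.finite_lamps hσ (pos x)
        have hs := hsp.size_eq hσ
        have he := hsp.len_add hσ x.finite_lamps
        obtain ⟨f₂, γ₂, a₂, b₂, hf₂, h2, hsp₂, hab₂⟩ := Linked.line_exists_shorter (n := n) hσ
          (a + b - (n + 1)) _ _ a b x.finite_lamps hsp (by omega) hσv
          (by rcases hσ with rfl | rfl <;> omega)
        obtain ⟨a₃, b₃, hsp₃, hab₃⟩ := hneg σ _ _ _ _ hσ hsp₂ hab₂
        exact ⟨f₂, γ₂, a₃, b₃, hf₂, h2, hsp₃, hab₃⟩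
    obtain ⟨f₂, γ₂, hf₂, h2, hsp₂⟩ := Linked.line_shift b₁ f₁ γ₁ a₁ hf₁ hsp₁ hab₁
    have hp := hsp₂.pos_mem
    obtain ⟨f₃, hf₃, h3, hsp₃⟩ := Linked.line_walk (n := n) (m := n + (n + 2)) hσ1
      (ofAdd (-((0 : ℕ) : ℤ))) (by rw [toAdd_ofAdd]; omega) _ _ _ hf₂ rfl hsp₂ (by
        intro k hk
        rw [toAdd_ofAdd] at hk
        omega)
    refine h1.trans (h2.trans (h3.trans (Linked.line_clear n f₃ 0 hf₃ (by omega) hsp₃ ?_)))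
    intro v hv
    by_contra h
    have := (hsp₃ v).1 (mem_hull_of_lit h _)
    omega
  have hc : state (1 : Multiplicative ℤ → L) (ofAdd (-1 * ((n + 1 : ℕ) : ℤ))) (by simp) ∈
      annulusInf (switchWalkSwitch L S) n (n + 2) :=
    mem_annulusInf_of_forall hS (.inr rfl) (by omega) (by simp) (by simp) (by omega) (by omega)
  rw [neg_one_mul] at hc
  refine SimpleGraph.connected_iff_exists_forall_reachable _ |>.2 ⟨⟨_, hc⟩, fun x => ?_⟩
  obtain ⟨_, _, h⟩ := (key x).exists_reachable (by omega) x.1.finite_lamps x.2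
  exact h.symm

/-! ### Disconnected annuli over the line -/

/-- A vertex in the hull is still in the hull after a step, unless it is the old position and the
step is towards the root. -/
lemma mem_hull_of_line_step {f f' : Multiplicative ℤ → L} {γ γ' : Multiplicative ℤ} {σ : ℤ}
    (hσ : σ = 1 ∨ σ = -1) {n : ℕ} (hn : 1 ≤ n)
    (hmem : ofAdd (σ * n) ∈ (lineTree hS).hull f γ)
    (hstep : |toAdd γ' - toAdd γ| ≤ 1) (hag : ∀ v, v ≠ γ → v ≠ γ' → f v = f' v) :
    ofAdd (σ * n) ∈ (lineTree hS).hull f' γ' ∨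
      (σ * toAdd γ = n ∧ σ * toAdd γ' = n - 1) := by
  rw [abs_le] at hstep
  have key : ∀ v : Multiplicative ℤ, (lineTree hS).Below (ofAdd (σ * n)) v ↔ n ≤ σ * toAdd v := by
    intro v
    rw [line_below_iff, toAdd_ofAdd]
    rcases hσ with rfl | rfl <;> omega
  have hpos : n ≤ σ * toAdd γ → ofAdd (σ * n) ∈ (lineTree hS).hull f' γ' ∨
      (σ * toAdd γ = n ∧ σ * toAdd γ' = n - 1) := by
    intro h
    by_cases h' : n ≤ σ * toAdd γ'
    · exact Or.inl (Or.inl ((key _).2 h'))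
    · right; rcases hσ with rfl | rfl <;> omega
  rcases hmem with h | ⟨v, hv, h⟩
  · exact hpos ((key _).1 h)
  · by_cases h1 : v = γ
    · exact hpos (h1 ▸ (key _).1 h)
    by_cases h2 : v = γ'
    · exact Or.inl (Or.inl (h2 ▸ h))
    · exact Or.inl (Or.inr ⟨v, hag v h1 h2 ▸ hv, h⟩)

/-- A lamplighter with no lit lamps on the other side of the root cannot move back from the end
of a hull of `n` edges and shorten it, outside the ball of radius `n - 1`. -/
lemma mem_hull_of_line_step_of_le_len {f f' : Multiplicative ℤ → L} {γ γ' : Multiplicative ℤ}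
    {σ : ℤ} (hσ : σ = 1 ∨ σ = -1) {n : ℕ} (hn : 1 ≤ n) (hf' : (mulSupport f').Finite)
    (hmem : ofAdd (σ * n) ∈ (lineTree hS).hull f γ)
    (hstep : |toAdd γ' - toAdd γ| ≤ 1) (hag : ∀ v, v ≠ γ → v ≠ γ' → f v = f' v)
    (hoff : ∀ v, σ * toAdd v < 0 → f v = 1) (hlen : n ≤ (lineTree hS).len f' γ') :
    ofAdd (σ * n) ∈ (lineTree hS).hull f' γ' := by
  rcases mem_hull_of_line_step hσ hn hmem hstep hag with h | ⟨h1, h2⟩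
  · exact h
  by_contra hnot
  obtain ⟨a, b, hsp⟩ := exists_spans (hS := hS) hf' hσ γ'
  have he := hsp.len_add hσ hf'
  rw [hsp, toAdd_ofAdd] at hnot
  have ha : a = 0 := by
    by_contra ha
    have h3 := (hsp (ofAdd (-(σ * a)))).2 (by rw [toAdd_ofAdd]; rcases hσ with rfl | rfl <;> omega)
    rcases h3 with h3 | ⟨v, hv, h3⟩
    · rw [line_below_iff, toAdd_ofAdd] at h3
      rcases hσ with rfl | rfl <;> omega
    · rw [line_below_iff, toAdd_ofAdd] at h3
      have hv0 : σ * toAdd v < 0 := by rcases hσ with rfl | rfl <;> omega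
      refine hv ?_
      rw [← hag v, hoff v hv0]
      · rintro rfl; omega
      · rintro rfl; omega
  have hb : b < n := by rcases hσ with rfl | rfl <;> omega
  rcases hσ with rfl | rfl <;> omega

lemma abs_sub_le_of_adj (hS : IsLineGenerators S) {z z' : Lamplighter (Multiplicative ℤ) L}
    (h : (SimpleGraph.mulCayley (switchWalkSwitch L S)).Adj z z') :
    |toAdd (pos z') - toAdd (pos z)| ≤ 1 := by
  obtain ⟨-, h, -⟩ := Lamplighter.adj_iff.1 h
  rw [abs_le]
  rcases h with h | h
  · rw [line_adj_iff hS] at h; omega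
  · rw [h.1]; omega

theorem not_connected_annulusGraph_line [Finite L] (hS : IsLineGenerators S) {n r : ℕ}
    (hn : 2 ≤ n) (hr : r ≤ n + 1) : ¬ (annulusGraph (switchWalkSwitch L S) n r).Connected := by
  intro hconn
  have hx := mem_annulusInf_of_forall (L := L) (f := 1) (k := n) (n := n) (r := r) hS (.inl rfl)
    (by omega) (by simp) (by simp) le_rfl (by omega)
  have hy := mem_annulusInf_of_forall (L := L) (f := 1) (k := n) (n := n) (r := r) hS (.inr rfl)
    (by omega) (by simp) (by simp) le_rfl (by omega)
  -- Lamplighters with the point `n` in their hull cannot go beyond `-1`.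
  have hinv := reachable_induction (H := annulusGraph (switchWalkSwitch L S) n r)
    (P := fun z => ofAdd ((1 : ℤ) * n) ∈ (lineTree hS).hull (lamps z.1) (pos z.1) ∧
      ((0 ≤ toAdd (pos z.1) ∧ ∀ v, toAdd v < 0 → lamps z.1 v = 1) ∨
        (toAdd (pos z.1) = -1 ∧ ∀ v, toAdd v < -1 → lamps z.1 v = 1))) ?_
    (hconn.preconnected ⟨_, hx⟩ ⟨_, hy⟩)
    ⟨mem_hull_pos _ _, Or.inl ⟨by simp, fun _ _ => rfl⟩⟩
  · obtain ⟨-, ⟨h, -⟩ | ⟨h, -⟩⟩ := hinv <;> simp at h <;> omega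
  rintro ⟨z, hz⟩ ⟨z', hz'⟩ hadj ⟨hmem, hor⟩
  dsimp only at hmem hor ⊢
  have hadj : (SimpleGraph.mulCayley (switchWalkSwitch L S)).Adj z z' := hadj
  have hstep := abs_sub_le_of_adj hS hadj
  have hag := (Lamplighter.adj_iff.1 hadj).2.2
  have hd := dist_eq_len (size_ne_zero_of_mem_ballComplInf (lineTree hS) hn hz'.2)
  have h1 : n ≤ (lineTree hS).len (lamps z') (pos z') := hd ▸ hz'.2.1
  have h2 : (lineTree hS).len (lamps z') (pos z') ≤ n + r := hd ▸ hz'.1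
  have he := len_add_height (t := lineTree hS) z'.finite_lamps (pos z')
  rw [line_height] at he
  have hstep' := abs_le.1 hstep
  have hlit : ∀ k : ℕ, ofAdd (1 * (n : ℤ)) ∈ (lineTree hS).hull (lamps z') (pos z') →
      ofAdd (-(1 * (k : ℤ))) ∈ (lineTree hS).hull (lamps z') (pos z') →
      k + n ≤ (lineTree hS).size (lamps z') (pos z') := fun k h h' =>
    add_le_size z'.finite_lamps (.inl rfl) h' h
  rcases hor with ⟨hp, hoff⟩ | ⟨hp, hoff⟩
  · refine ⟨mem_hull_of_line_step_of_le_len (.inl rfl) (by omega) z'.finite_lamps hmem hstep hag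
      (fun v hv => hoff v (by omega)) h1, ?_⟩
    by_cases hp' : 0 ≤ toAdd (pos z')
    · refine Or.inl ⟨hp', fun v hv => ?_⟩
      rw [← hag v, hoff v hv] <;> rintro rfl <;> omega
    · refine Or.inr ⟨by omega, fun v hv => ?_⟩
      rw [← hag v, hoff v (by omega)] <;> rintro rfl <;> omega
  · have hmem' := (mem_hull_of_line_step (.inl rfl) (by omega) hmem hstep hag).resolve_right
      (by omega)
    refine ⟨hmem', ?_⟩
    have hp2 : toAdd (pos z') ≠ -2 := by
      intro h
      have := hlit 2 hmem' (Or.inl (by rw [line_below_iff, toAdd_ofAdd]; omega))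
      omega
    have hoff' : ∀ v, toAdd v < -1 → lamps z' v = 1 := fun v hv => by
      rw [← hag v, hoff v hv] <;> rintro rfl <;> omega
    by_cases hp' : 0 ≤ toAdd (pos z')
    · refine Or.inl ⟨hp', fun v hv => ?_⟩
      by_cases hv' : toAdd v = -1
      · by_contra h
        have h3 : v = ofAdd (-(1 * ((1 : ℕ) : ℤ))) := toAdd.injective (by rw [hv']; rfl)
        have := hlit 1 hmem' (h3 ▸ mem_hull_of_lit h _)
        omega
      · exact hoff' v (by omega)
    · exact Or.inr ⟨by omega, hoff'⟩

theorem thickness_line [Nontrivial L] [Finite L] (hS : IsLineGenerators S) {n : ℕ}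
    (hn : 2 ≤ n) : thickness (switchWalkSwitch L S) n = ((n + 2 : ℕ) : ℕ∞) := by
  obtain ⟨k, h1, h2, h3⟩ := exists_thickness_eq (connected_annulusGraph_line (L := L) hS hn)
  have : ¬ k ≤ n + 1 := fun h => not_connected_annulusGraph_line hS hn h h3
  rw [h1, show k = n + 2 by omega]

/-! ### Number of components over the line -/

/-- For thickness less than `n`, the lamps at distance less than `n - r` from the root cannot be
reached. -/
theorem two_mul_pow_le_numComponents_line [Finite L] (hS : IsLineGenerators S) {n r : ℕ}
    (hr : r + 1 ≤ n) (hn : 1 ∈ S → 2 ≤ n) :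
    2 * Nat.card L ^ (n - r) ≤ numComponents (switchWalkSwitch L S) n r := by
  classical
  have hdist : ∀ z ∈ annulusInf (switchWalkSwitch L S) n r,
      (SimpleGraph.mulCayley (switchWalkSwitch L S)).dist 1 z =
        (lineTree hS).len (lamps z) (pos z) := by
    intro z hz
    refine dist_eq_len fun h0 => ?_
    by_cases hn2 : 2 ≤ n
    · exact size_ne_zero_of_mem_ballComplInf (lineTree hS) hn2 hz.2 h0
    · -- For `n = 1` the element would be a generator with position `1`.
      have h1 : n ≤ (SimpleGraph.mulCayley (switchWalkSwitch L S)).dist 1 z := hz.2.1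
      have h2 : (SimpleGraph.mulCayley (switchWalkSwitch L S)).dist 1 z ≤ n + r := hz.1
      have hadj := SimpleGraph.dist_eq_one_iff_adj.1
        (show (SimpleGraph.mulCayley (switchWalkSwitch L S)).dist 1 z = 1 by omega)
      obtain ⟨-, h3, -⟩ := Lamplighter.adj_iff.1 hadj
      rw [pos_one, (size_eq_zero z.finite_lamps h0).1] at h3
      rcases h3 with h3 | h3
      · exact h3.ne rfl
      · exact hn2 (hn h3.2)
  let sgn : Bool → ℤ := fun s => if s then 1 else -1
  have hsgn : ∀ s, sgn s = 1 ∨ sgn s = -1 := by rintro (_ | _) <;> simp [sgn]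
  let F : Bool × (Fin (n - r) → L) → Multiplicative ℤ → L := fun p v =>
    if h : 0 ≤ sgn p.1 * toAdd v ∧ sgn p.1 * toAdd v < (n - r : ℕ) then
      p.2 ⟨(sgn p.1 * toAdd v).toNat, by omega⟩ else 1
  have hFlit : ∀ p v, F p v ≠ 1 → 0 ≤ sgn p.1 * toAdd v ∧ sgn p.1 * toAdd v < (n - r : ℕ) := by
    intro p v h
    by_contra h'
    exact h (dif_neg h')
  have hFval : ∀ s w (i : Fin (n - r)), F (s, w) (ofAdd (sgn s * (i : ℕ))) = w i := by
    intro s w i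
    have : sgn s * toAdd (ofAdd (sgn s * ((i : ℕ) : ℤ))) = (i : ℕ) := by
      rw [toAdd_ofAdd]; rcases hsgn s with h | h <;> rw [h] <;> omega
    simp only [F, this]
    rw [dif_pos (by omega)]
    simp
  have hF : ∀ p, (mulSupport (F p)).Finite := by
    intro p
    refine ((Set.finite_Icc (-(n : ℤ)) n).preimage toAdd.injective.injOn).subset fun v hv => ?_
    have := hFlit p v hv
    rw [Set.mem_preimage, Set.mem_Icc]
    rcases hsgn p.1 with h | h <;> rw [h] at this <;> omega
  have hmem : ∀ p, state (F p) (ofAdd (sgn p.1 * n)) (hF p) ∈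
      annulusInf (switchWalkSwitch L S) n r := fun p =>
    mem_annulusInf_of_forall hS (hsgn p.1) (by omega)
      (fun v hv => by have := hFlit p v hv; omega) _ le_rfl (by omega)
  have hinv : ∀ p (y : annulusInf (switchWalkSwitch L S) n r),
      (annulusGraph (switchWalkSwitch L S) n r).Reachable ⟨_, hmem p⟩ y →
      ofAdd (sgn p.1 * n) ∈ (lineTree hS).hull (lamps y.1) (pos y.1) ∧
      n ≤ sgn p.1 * toAdd (pos y.1) + r ∧
      ∀ v, sgn p.1 * toAdd v + r < n → lamps y.1 v = F p v := by
    intro p y hy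
    have hσ := hsgn p.1
    refine reachable_induction (H := annulusGraph (switchWalkSwitch L S) n r)
      (P := fun y => ofAdd (sgn p.1 * n) ∈ (lineTree hS).hull (lamps y.1) (pos y.1) ∧
        n ≤ sgn p.1 * toAdd (pos y.1) + r ∧
        ∀ v, sgn p.1 * toAdd v + r < n → lamps y.1 v = F p v) ?_ hy
      ⟨mem_hull_pos _ _, ?_, fun _ _ => rfl⟩
    swap
    · simp only [pos_state, toAdd_ofAdd]
      rcases hσ with h | h <;> rw [h] <;> omega
    rintro ⟨z, hz⟩ ⟨z', hz'⟩ hadj ⟨h1, h2, h3⟩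
    dsimp only at h1 h2 h3 ⊢
    have hadj : (SimpleGraph.mulCayley (switchWalkSwitch L S)).Adj z z' := hadj
    have hstep := abs_sub_le_of_adj hS hadj
    have hag := (Lamplighter.adj_iff.1 hadj).2.2
    have hd := hdist z' hz'
    have hlen : n ≤ (lineTree hS).len (lamps z') (pos z') := hd ▸ hz'.2.1
    have hlen' : (lineTree hS).len (lamps z') (pos z') ≤ n + r := hd ▸ hz'.1
    have he := len_add_height (t := lineTree hS) z'.finite_lamps (pos z')
    rw [line_height] at he
    have h1' := mem_hull_of_line_step_of_le_len hσ (by omega) z'.finite_lamps h1 hstep hag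
      (fun v hv => by
        rw [h3 v (by omega)]
        by_contra h
        have := hFlit p v h
        omega) hlen
    have hsz := height_le_size_of_mem z'.finite_lamps h1'
    rw [line_height, toAdd_ofAdd] at hsz
    rw [abs_le] at hstep
    have h2' : n ≤ sgn p.1 * toAdd (pos z') + r := by
      rcases hσ with h | h <;> rw [h] at h2 hsz ⊢ <;> omega
    refine ⟨h1', h2', fun v hv => ?_⟩
    rw [← h3 v hv]
    refine (hag v ?_ ?_).symm <;> rintro rfl <;> omega
  have := finite_annulusInf (L := L) (lineTree hS) one_pos n r
  have hcard : Nat.card (Bool × (Fin (n - r) → L)) = 2 * Nat.card L ^ (n - r) := by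
    rw [Nat.card_prod, Nat.card_fun]
    simp
  rw [← hcard]
  refine Nat.card_le_card_of_injective
    (fun p => (annulusGraph (switchWalkSwitch L S) n r).connectedComponentMk ⟨_, hmem p⟩) ?_
  rintro ⟨s, w⟩ ⟨s', w'⟩ h
  obtain ⟨-, h2, h3⟩ := hinv _ _ (SimpleGraph.ConnectedComponent.exact h)
  dsimp only [pos_state, lamps_state] at h2 h3
  rw [toAdd_ofAdd] at h2
  obtain rfl : s = s' := by
    revert h2
    rcases s <;> rcases s' <;> simp [sgn] <;> omega
  refine Prod.ext rfl (funext fun i => ?_)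
  have h4 := h3 (ofAdd (sgn s * (i : ℕ))) (by
    have := i.2
    rw [toAdd_ofAdd]; rcases hsgn s with h | h <;> rw [h] <;> omega)
  rw [hFval, hFval] at h4
  exact h4.symm

end CayleyTree

theorem theorem2 (L : Type*) [Group L] [Finite L] [Nontrivial L] :
    -- (1) lamps on a line; the walk generators are `±1`, with or without the identity
    (∀ S : Set (Multiplicative ℤ),
      (S = {Multiplicative.ofAdd 1, Multiplicative.ofAdd (-1)} ∨
        S = {1, Multiplicative.ofAdd 1, Multiplicative.ofAdd (-1)}) →
      (∀ n : ℕ, 2 ≤ n →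
        CayleySphere.thickness (Lamplighter.switchWalkSwitch L S) n = ((n + 2 : ℕ) : ℕ∞)) ∧
      (∀ n r : ℕ, 1 ≤ r + 1 → r + 1 ≤ n → (1 ∈ S → 2 ≤ n) →
        2 * Nat.card L ^ (n - r) ≤
          CayleySphere.numComponents (Lamplighter.switchWalkSwitch L S) n r)) ∧
    -- (2) lamps on a `d`-regular tree
    (∀ d : ℕ, 3 ≤ d → ∀ (T : Type*) [Group T] (S : Set T), IsRegularTreeCayley S d →
      ∃ c K : ℝ, 0 < c ∧ 1 < K ∧ ∀ n : ℕ, 1 ≤ n →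
        (∃ t : ℕ, CayleySphere.thickness (Lamplighter.switchWalkSwitch L S) n = (t : ℕ∞) ∧
          |(t : ℝ) - Real.logb ((d : ℝ) - 1) n| ≤ c) ∧
        ∀ r : ℕ, (r : ℝ) ≤ Real.logb ((d : ℝ) - 1) n - c →
          K ^ n ≤ (CayleySphere.numComponents (Lamplighter.switchWalkSwitch L S) n r : ℝ)) := by
  refine ⟨fun S hS => ⟨fun n hn => CayleyTree.thickness_line hS hn, fun n r _ hr hn =>
    CayleyTree.two_mul_pow_le_numComponents_line hS hr hn⟩, fun d hd T _ S hS => ?_⟩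
  have h := CayleyTree.exists_thickness_near_log (L := L)
    (CayleyTree.ofIsRegularTreeCayley hS (by omega)) (by omega)
  rwa [Nat.cast_sub (by omega), Nat.cast_one] at h
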